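/- Let $m>0$ and let $Q_n=(q^{ij}_n)_{i,j=1,2}$, $n\in\mathbb Z$, be a real matrix potential with $q^{12}_n=q^{21}_n\neq -1$ for all $n\in\mathbb Z$. Consider the discrete Dirac operator $$\mathcal D=\begin{pmatrix} m & d\\ d^* & -m\end{pmatrix}+Q,\qquad (du)_n=u_n-u_{n+1},\quad (d^*u)_n=u_n-u_{n-1},$$ acting on sequences $\mathbf w_n=(u_n,v_n)\in\mathbb C^2$, $n\in\mathbb Z$. For $\sigma\in\mathbb R$ let $\ell^p_\sigma=\ell^p_\sigma(\mathbb Z)$ be the weighted space with norm $\|u\|_{\ell^p_\sigma}=\big(\sum_{n}(1+|n|)^{p\sigma}|u_n|^p\big)^{1/p}$ for $1\le p<\infty$ and $\|u\|_{\ell^\infty_\sigma}=\sup_n(1+|n|)^\sigma|u_n|$, and put $\mathbf l^p_\sigma=\ell^p_\sigma\oplus\ell^p_\sigma$, $\mathbf l^p=\mathbf l^p_0$. Assume that $q^{ij}\in\ell^1_3$ for $i,j=1,2$; in particular $\mathcal D$ is a bounded self-adjoint operator on $\mathbf l^2$. Assume moreover that none of the four points $\lambda=\pm m,\ \pm\sqrt{m^2+4}$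 is a resonance, that is, for none of them does the difference equation $\mathcal D\mathbf w=\lambda\mathbf w$ have a nonzero solution $\mathbf w\in\mathbf l^\infty$. Let $P_c$ be the orthogonal projection in $\mathbf l^2$ onto the continuous spectral subspace of $\mathcal D$, i.e. onto the orthogonal complement of the closed linear span of all eigenvectors of $\mathcal D$ in $\mathbf l^2$. Then $$\|e^{-it\mathcal D}P_c\|_{\mathbf l^1_{3/2}\to\mathbf l^\infty_{-3/2}}=\mathcal O(t^{-4/3}),\qquad t\to\infty,$$ and, for every $\sigma>2$, $$\|e^{-it\mathcal D}P_c\|_{\mathbf l^2_\sigma\to\mathbf l^2_{-\sigma}}=\mathcal O(t^{-3/2}),\qquad t\to\infty.$$ -/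

import Mathlib

open Filter MeasureTheory
open scoped ENNReal Topology

/-- The weighted norm `‖w‖_{ℓ^p_σ}` of a two-sided sequence, with values in `[0, ∞]`: the `L^p` norm
for counting measure on `ℤ` of `n ↦ (1 + |n|)^σ ‖w n‖`, that is
`(∑ₙ (1 + |n|)^(pσ) ‖w n‖^p)^(1/p)` for `1 ≤ p < ∞` and `supₙ (1 + |n|)^σ ‖w n‖` for `p = ∞`.
The sequence belongs to the weighted space iff this is finite. -/
noncomputable def weightedNorm {E : Type*} [NormedAddCommGroup E] (p : ℝ≥0∞) (σ : ℝ)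
    (w : ℤ → E) : ℝ≥0∞ :=
  eLpNorm (fun n : ℤ => (1 + |(n : ℝ)|) ^ σ * ‖w n‖) p Measure.count

/-- The fibre `ℂ²`; coordinate `0` is `u`, coordinate `1` is `v`. -/
abbrev Spinor : Type := EuclideanSpace ℂ (Fin 2)

/-- The Hilbert space `ℓ²(ℤ) ⊕ ℓ²(ℤ)`, realized as `ℓ²(ℤ; ℂ²)`. -/
abbrev SpinorL2 : Type := lp (fun _ : ℤ => Spinor) 2

/-- The Dirac expression `D₀ + Q` on arbitrary sequences `w n = (u n, v n)`, where
`D₀ = [[m, d], [d*, -m]]`, `(d v) n = v n - v (n+1)` and `(d* u) n = u n - u (n-1)`. -/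
noncomputable def diracExpr (m : ℝ) (Q : ℤ → Matrix (Fin 2) (Fin 2) ℝ) :
    (ℤ → Spinor) →ₗ[ℂ] (ℤ → Spinor) where
  toFun w n := !₂[
    (m : ℂ) * w n 0 + (w n 1 - w (n + 1) 1) + ((Q n 0 0 : ℂ) * w n 0 + (Q n 0 1 : ℂ) * w n 1),
    (w n 0 - w (n - 1) 0) - (m : ℂ) * w n 1 + ((Q n 1 0 : ℂ) * w n 0 + (Q n 1 1 : ℂ) * w n 1)]
  map_add' w z := by
    funext n; ext i; fin_cases i <;> simp <;> ring
  map_smul' c w := by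
    funext n; ext i; fin_cases i <;> simp <;> ring

theorem memlp_coord {w : ℤ → Spinor} (hw : Memℓp w 2) (j : Fin 2) (k : ℤ) :
    Memℓp (fun n : ℤ => w (n + k) j) 2 := by
  rw [memℓp_gen_iff (by norm_num)] at hw ⊢
  have h := (Equiv.addRight k).summable_iff.mpr hw
  refine Summable.of_nonneg_of_le (fun n => by positivity) (fun n => ?_) h
  simp only [Function.comp, Equiv.coe_addRight]
  gcongr
  exact PiLp.norm_apply_le (w (n + k)) j

theorem memlp_bdd_mul {a : ℤ → ℝ} {f : ℤ → ℂ} {C : ℝ} (ha : ∀ n, |a n| ≤ C)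
    (hf : Memℓp f 2) : Memℓp (fun n : ℤ => (a n : ℂ) * f n) 2 := by
  rw [memℓp_gen_iff (by norm_num)] at hf ⊢
  refine Summable.of_nonneg_of_le (fun n => by positivity) (fun n => ?_)
    (hf.mul_left (C ^ (2 : ℝ≥0∞).toReal))
  have hC : 0 ≤ C := (abs_nonneg _).trans (ha 0)
  rw [← Real.mul_rpow hC (norm_nonneg _), norm_mul, Complex.norm_real, Real.norm_eq_abs]
  gcongr
  exact ha n

theorem memlp_spinor {w : ℤ → Spinor} (h : ∀ j, Memℓp (fun n : ℤ => w n j) 2) : Memℓp w 2 := by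
  have h0 := h 0
  have h1 := h 1
  rw [memℓp_gen_iff (by norm_num)] at h0 h1 ⊢
  refine (h0.add h1).congr (fun n => ?_)
  simp [EuclideanSpace.norm_sq_eq, Fin.sum_univ_two]

theorem diracExpr_memlp (m : ℝ) (Q : ℤ → Matrix (Fin 2) (Fin 2) ℝ)
    (hQ : ∃ C : ℝ, ∀ n i j, |Q n i j| ≤ C) {w : ℤ → Spinor} (hw : Memℓp w 2) :
    Memℓp (diracExpr m Q w) 2 := by
  obtain ⟨C, hC⟩ := hQ
  have c (j : Fin 2) : Memℓp (fun n : ℤ => w n j) 2 := by simpa using memlp_coord hw j 0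
  have hq (i j : Fin 2) := memlp_bdd_mul (fun n => hC n i j) (c j)
  have hm (j : Fin 2) := memlp_bdd_mul (fun _ => le_refl |m|) (c j)
  refine memlp_spinor (fun j => ?_)
  fin_cases j
  · exact (((hm 0).add ((c 1).sub (memlp_coord hw 1 1))).add ((hq 0 0).add (hq 0 1)))
  · exact ((((c 0).sub (memlp_coord hw 0 (-1))).sub (hm 1)).add ((hq 1 0).add (hq 1 1)))

/-- The Dirac expression with a bounded potential `Q`, as a linear map on `ℓ²(ℤ; ℂ²)`. -/
noncomputable def diracLin (m : ℝ) (Q : ℤ → Matrix (Fin 2) (Fin 2) ℝ)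
    (hQ : ∃ C : ℝ, ∀ n i j, |Q n i j| ≤ C) : SpinorL2 →ₗ[ℂ] SpinorL2 where
  toFun w := ⟨diracExpr m Q w, diracExpr_memlp m Q hQ (lp.memℓp w)⟩
  map_add' w z := Subtype.ext ((diracExpr m Q).map_add w z)
  map_smul' c w := Subtype.ext ((diracExpr m Q).map_smul c w)

theorem diracExpr_continuous (m : ℝ) (Q : ℤ → Matrix (Fin 2) (Fin 2) ℝ) :
    Continuous (diracExpr m Q) := by
  have e (k : ℤ) (j : Fin 2) : Continuous (fun w : ℤ → Spinor => w k j) :=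
    (EuclideanSpace.proj (𝕜 := ℂ) (ι := Fin 2) j).continuous.comp (continuous_apply k)
  refine continuous_pi fun n => (PiLp.continuous_toLp 2 _).comp (continuous_pi fun i => ?_)
  fin_cases i
  · exact ((continuous_const.mul (e n 0)).add ((e n 1).sub (e (n + 1) 1))).add
      ((continuous_const.mul (e n 0)).add (continuous_const.mul (e n 1)))
  · exact (((e n 0).sub (e (n - 1) 0)).sub (continuous_const.mul (e n 1))).add
      ((continuous_const.mul (e n 0)).add (continuous_const.mul (e n 1)))

theorem diracLin_continuous (m : ℝ) (Q : ℤ → Matrix (Fin 2) (Fin 2) ℝ)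
    (hQ : ∃ C : ℝ, ∀ n i j, |Q n i j| ≤ C) : Continuous (diracLin m Q hQ) := by
  have ev : Continuous (fun z : SpinorL2 => (z : ℤ → Spinor)) :=
    (lp.uniformContinuous_coe (p := 2)).continuous
  refine LinearMap.continuous_of_seq_closed_graph (g := diracLin m Q hQ) (fun s x y hs hy => ?_)
  refine Subtype.ext ?_
  have h1 := (ev.tendsto y).comp hy
  have h2 := (((diracExpr_continuous m Q).comp ev).tendsto x).comp hs
  exact tendsto_nhds_unique (X := ℤ → Spinor) h1 h2

/-- The bounded operator `D = D₀ + Q` on `ℓ²(ℤ; ℂ²)`, for a bounded potential `Q`. -/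
noncomputable def diracOp (m : ℝ) (Q : ℤ → Matrix (Fin 2) (Fin 2) ℝ)
    (hQ : ∃ C : ℝ, ∀ n i j, |Q n i j| ≤ C) : SpinorL2 →L[ℂ] SpinorL2 where
  toLinearMap := diracLin m Q hQ
  cont := diracLin_continuous m Q hQ

/-- A potential with entries in `ℓ^1_3` is bounded. -/
theorem bounded_of_weighted {Q : ℤ → Matrix (Fin 2) (Fin 2) ℝ}
    (hQ : ∀ i j, weightedNorm 1 3 (fun n => Q n i j) < ⊤) :
    ∃ C : ℝ, ∀ n i j, |Q n i j| ≤ C := by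
  have key (i j : Fin 2) (n : ℤ) : |Q n i j| ≤ (weightedNorm 1 3 (fun n => Q n i j)).toReal := by
    have h : ENNReal.ofReal |Q n i j| ≤ weightedNorm 1 3 (fun n => Q n i j) := by
      unfold weightedNorm
      rw [eLpNorm_one_eq_lintegral_enorm, lintegral_count]
      refine le_trans ?_ (ENNReal.le_tsum n)
      rw [Real.enorm_eq_ofReal (by positivity)]
      refine ENNReal.ofReal_le_ofReal ?_
      rw [Real.norm_eq_abs]
      have : (1 : ℝ) ≤ (1 + |(n : ℝ)|) ^ (3 : ℝ) :=
        Real.one_le_rpow (by linarith [abs_nonneg (n : ℝ)]) (by norm_num)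
      exact le_mul_of_one_le_left (abs_nonneg _) this
    exact (ENNReal.ofReal_le_iff_le_toReal (hQ i j).ne).mp h
  refine ⟨∑ i, ∑ j, (weightedNorm 1 3 (fun n => Q n i j)).toReal, fun n i j => ?_⟩
  refine (key i j n).trans ?_
  refine le_trans ?_ (Finset.single_le_sum (f := fun i => ∑ j,
    (weightedNorm 1 3 (fun n => Q n i j)).toReal) (fun _ _ => by positivity) (Finset.mem_univ i))
  exact Finset.single_le_sum (f := fun j => (weightedNorm 1 3 (fun n => Q n i j)).toReal)
    (fun _ _ => by positivity) (Finset.mem_univ j)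

/-- `μ` is a resonance: `D w = μ w` has a nonzero bounded solution. -/
def IsResonance (m : ℝ) (Q : ℤ → Matrix (Fin 2) (Fin 2) ℝ) (μ : ℝ) : Prop :=
  ∃ w : ℤ → Spinor, w ≠ 0 ∧ (∃ C : ℝ, ∀ n, ‖w n‖ ≤ C) ∧ diracExpr m Q w = (μ : ℂ) • w

/-- The non-resonant case: none of the four edges of the continuous spectrum is a resonance. -/
def NonResonant (m : ℝ) (Q : ℤ → Matrix (Fin 2) (Fin 2) ℝ) : Prop :=
  ∀ μ : ℝ, (μ = m ∨ μ = -m ∨ μ = √(m ^ 2 + 4) ∨ μ = -√(m ^ 2 + 4)) → ¬ IsResonance m Q μ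

/-- The continuous spectral subspace of a (self-adjoint) operator: the orthogonal complement of the
pure point subspace, which is the closed linear span of all eigenvectors. -/
noncomputable def continuousSubspace (D : SpinorL2 →L[ℂ] SpinorL2) : Submodule ℂ SpinorL2 :=
  (⨆ μ : ℂ, Module.End.eigenspace (D : SpinorL2 →ₗ[ℂ] SpinorL2) μ).topologicalClosureᗮ

instance continuousSubspace_hasOrthogonalProjection (D : SpinorL2 →L[ℂ] SpinorL2) :
    (continuousSubspace D).HasOrthogonalProjection := by
  unfold continuousSubspace; infer_instance

/-- The orthogonal projection `P_c` onto the continuous spectral subspace. -/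
noncomputable def contProj (D : SpinorL2 →L[ℂ] SpinorL2) : SpinorL2 →L[ℂ] SpinorL2 :=
  (continuousSubspace D).starProjection

/-- The propagator `exp(-i t D)`. -/
noncomputable def propagator (D : SpinorL2 →L[ℂ] SpinorL2) (t : ℝ) : SpinorL2 →L[ℂ] SpinorL2 :=
  NormedSpace.exp ((-Complex.I * (t : ℂ)) • D)

/-- The norm `‖A‖` of `A` as an operator from `l^p_σ` to `l^q_τ`, with values in `[0, ∞]`: the
supremum of `‖A w‖_{l^q_τ}` over `w ∈ ℓ²(ℤ; ℂ²)` with `‖w‖_{l^p_σ} ≤ 1`. (It is used with `p ≤ 2` and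
`0 ≤ σ`, where `l^p_σ` is contained in `ℓ²(ℤ; ℂ²)`.) -/
noncomputable def weightedOpNorm (p : ℝ≥0∞) (σ : ℝ) (q : ℝ≥0∞) (τ : ℝ)
    (A : SpinorL2 →L[ℂ] SpinorL2) : ℝ≥0∞ :=
  ⨆ (w : SpinorL2) (_ : weightedNorm p σ (w : ℤ → Spinor) ≤ 1),
    weightedNorm q τ (A w : ℤ → Spinor)

open Filter MeasureTheory
open scoped ENNReal Topology

section ProductGrowth

variable {R : Type*} [NormedRing R]

/-- The ordered product `P n * P (n + 1) * ⋯ * P (n + j - 1)`. -/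
def orderedProd (P : ℤ → R) (n : ℤ) : ℕ → R
  | 0 => 1
  | j + 1 => orderedProd P n j * P (n + j)

theorem orderedProd_succ_left (P : ℤ → R) (n : ℤ) (j : ℕ) :
    orderedProd P n (j + 1) = P n * orderedProd P (n + 1) j := by
  induction j with
  | zero => simp [orderedProd]
  | succ j ih =>
    rw [orderedProd, ih, orderedProd, mul_assoc]
    congr 3
    push_cast
    ring

theorem duhamel {A : R} {r N : ℕ → R} {K : ℕ} (h0 : N 0 = 1)
    (hN : ∀ k < K, N (k + 1) = (A + r k) * N k) {k : ℕ} (hk : k ≤ K) :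
    N k = A ^ k + ∑ l ∈ Finset.range k, A ^ (k - 1 - l) * r l * N l := by
  induction k with
  | zero => simp [h0]
  | succ k ih =>
    rw [hN k hk, add_mul]
    nth_rw 1 [ih (Nat.le_of_succ_le hk)]
    rw [Finset.sum_range_succ, mul_add, ← pow_succ', Finset.mul_sum, add_assoc]
    congr 2
    · refine Finset.sum_congr rfl fun l hl => ?_
      have hl := Finset.mem_range.mp hl
      rw [show k + 1 - 1 - l = (k - 1 - l) + 1 by omega, pow_succ']
      simp only [mul_assoc]
    · simp

/-- Linear growth of a product of perturbations of a matrix with linearly growing powers. -/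
theorem norm_le_of_perturbed_powers {A : R} {r N : ℕ → R} {K : ℕ} {C c S : ℝ}
    (hC : 0 ≤ C) (hc : 0 ≤ c) (hA : ∀ k ≤ K, ‖A ^ k‖ ≤ C * (1 + k)) (h0 : N 0 = 1)
    (hN : ∀ k < K, N (k + 1) = (A + r k) * N k)
    (hS : ∑ l ∈ Finset.range K, (1 + c + l) * ‖r l‖ ≤ S) {k : ℕ} (hk : k ≤ K) :
    ‖N k‖ ≤ C * Real.exp (C * S) * (1 + c + k) := by
  have hpos (l : ℕ) : 0 < 1 + c + (l : ℝ) := by positivity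
  set U : ℕ → ℝ := fun k => C + ∑ l ∈ Finset.range k, C * (‖r l‖ * ‖N l‖) with hU
  have step (k : ℕ) (hk : k ≤ K) : ‖N k‖ ≤ (1 + c + k) * U k := by
    rw [duhamel h0 hN hk]
    refine (norm_add_le _ _).trans ?_
    rw [hU, mul_add]
    refine add_le_add ((hA k hk).trans ?_) ((norm_sum_le _ _).trans ?_)
    · rw [mul_comm]; gcongr; linarith
    · rw [Finset.mul_sum]
      refine Finset.sum_le_sum fun l hl => ?_
      have hl := Finset.mem_range.mp hl
      have e : ((k - 1 - l : ℕ) : ℝ) ≤ k - 1 := by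
        have : (k - 1 - l : ℕ) + 1 ≤ k := by omega
        have : ((k - 1 - l : ℕ) : ℝ) + 1 ≤ k := by exact_mod_cast this
        linarith
      calc ‖A ^ (k - 1 - l) * r l * N l‖ ≤ ‖A ^ (k - 1 - l)‖ * ‖r l‖ * ‖N l‖ :=
            (norm_mul_le _ _).trans (by gcongr; exact norm_mul_le _ _)
        _ ≤ (C * (1 + c + k)) * ‖r l‖ * ‖N l‖ := by
            have h2 := (hA (k - 1 - l) (by omega)).trans
              (mul_le_mul_of_nonneg_left (show (1 : ℝ) + (k - 1 - l : ℕ) ≤ 1 + c + k by linarith) hC)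
            exact mul_le_mul_of_nonneg_right (mul_le_mul_of_nonneg_right h2 (norm_nonneg _))
              (norm_nonneg _)
        _ = _ := by ring
  have hUb (k : ℕ) (hk : k ≤ K) :
      U k ≤ C * Real.exp (C * ∑ l ∈ Finset.range k, (1 + c + l) * ‖r l‖) := by
    induction k with
    | zero => simp [hU]
    | succ k ih =>
      have ih := ih (by omega)
      have hUs : U (k + 1) = U k + C * (‖r k‖ * ‖N k‖) := by
        simp only [hU, Finset.sum_range_succ]; ring
      have hU0 : 0 ≤ U k := by simp only [hU]; positivity
      rw [hUs, Finset.sum_range_succ, mul_add, Real.exp_add]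
      calc U k + C * (‖r k‖ * ‖N k‖)
          ≤ U k + C * (‖r k‖ * ((1 + c + k) * U k)) := by gcongr; exact step k (by omega)
        _ = U k * (C * ((1 + c + k) * ‖r k‖) + 1) := by ring
        _ ≤ U k * Real.exp (C * ((1 + c + k) * ‖r k‖)) := by
            gcongr; exact Real.add_one_le_exp _
        _ ≤ _ := by
            exact (mul_le_mul_of_nonneg_right ih (Real.exp_pos _).le).trans_eq (mul_assoc _ _ _)
  calc ‖N k‖ ≤ (1 + c + k) * U k := step k hk
    _ ≤ (1 + c + k) * (C * Real.exp (C * S)) := by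
        gcongr
        refine (hUb k hk).trans ?_
        gcongr
        refine le_trans (Finset.sum_le_sum_of_subset_of_nonneg ?_ ?_) hS
        · simpa using hk
        · intros; have := hpos; positivity
    _ = _ := by ring

theorem norm_orderedProd_le {A : R} {r : ℤ → R} {n : ℤ} {K : ℕ} {C c S : ℝ}
    (hC : 0 ≤ C) (hc : 0 ≤ c) (hA : ∀ k ≤ K, ‖A ^ k‖ ≤ C * (1 + k))
    (hS : ∑ l ∈ Finset.range K, (1 + c + l) * ‖r (n + l)‖ ≤ S) :
    ‖orderedProd (fun i => A + r i) n K‖ ≤ C * Real.exp (C * S) * (1 + c + K) := by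
  have e (a : R) : ‖MulOpposite.op a‖ = ‖a‖ := rfl
  have := norm_le_of_perturbed_powers (R := Rᵐᵒᵖ) (A := MulOpposite.op A)
    (r := fun l => MulOpposite.op (r (n + l)))
    (N := fun k => MulOpposite.op (orderedProd (fun i => A + r i) n k)) (K := K) hC hc
    (fun k hk => by rw [← MulOpposite.op_pow, e]; exact hA k hk)
    (by simp [orderedProd]) (fun k _ => by simp [orderedProd]) (by simpa only [e] using hS) le_rfl
  simpa only [e] using this

theorem norm_orderedProd_neg_le {A : R} {r : ℤ → R} {K : ℕ} {C S : ℝ}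
    (hC : 0 ≤ C) (hA : ∀ k ≤ K, ‖A ^ k‖ ≤ C * (1 + k))
    (hS : ∑ l ∈ Finset.range K, (1 + (l : ℝ)) * ‖r (-l - 1)‖ ≤ S) :
    ‖orderedProd (fun i => A + r i) (-K) K‖ ≤ C * Real.exp (C * S) * (1 + K) := by
  have := norm_le_of_perturbed_powers (A := A) (r := fun l => r (-l - 1)) (c := 0)
    (N := fun k => orderedProd (fun i => A + r i) (-k) k) (K := K) hC le_rfl hA
    (by simp [orderedProd]) (fun k _ => by
      rw [orderedProd_succ_left]; push_cast
      rw [show -((k : ℤ) + 1) = -k - 1 by ring, sub_add_cancel]) (by simpa using hS) le_rfl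
  simpa using this

theorem pow_eq_of_quadratic [Algebra ℂ R] {A : R} {q : ℂ} (h : A * A = (1 + q) • A - q • 1)
    (k : ℕ) : A ^ k = 1 + (∑ i ∈ Finset.range k, q ^ i) • (A - 1) := by
  induction k with
  | zero => simp
  | succ k ih =>
    rw [pow_succ, ih, add_mul, smul_mul_assoc, sub_mul, h, one_mul, geom_sum_succ]
    have hs : q * ∑ i ∈ Finset.range k, q ^ i + 1 = 1 + (∑ i ∈ Finset.range k, q ^ i) * q := by ring
    rw [hs]
    module

theorem norm_pow_le_of_quadratic [NormedAlgebra ℂ R] [NormOneClass R] {A : R} {q : ℂ} {B M : ℝ}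
    {K : ℕ} (h : A * A = (1 + q) • A - q • 1) (hA : ‖A‖ ≤ B) (hM : 0 ≤ M)
    (hq : ∀ i ≤ K, ‖q ^ i‖ ≤ M) : ∀ k ≤ K, ‖A ^ k‖ ≤ (1 + M * (B + 1)) * (1 + k) := by
  intro k hk
  rw [pow_eq_of_quadratic h]
  have hB : 0 ≤ B := (norm_nonneg _).trans hA
  have h1 : ‖∑ i ∈ Finset.range k, q ^ i‖ ≤ k * M := by
    refine (norm_sum_le_of_le _ (f := fun i => q ^ i) (n := fun _ => M) fun i hi => hq i ?_).trans ?_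
    · have := Finset.mem_range.mp hi; omega
    · simp
  calc ‖1 + (∑ i ∈ Finset.range k, q ^ i) • (A - 1)‖ ≤ 1 + (k * M) * (B + 1) := by
        refine (norm_add_le _ _).trans ?_
        rw [norm_one, norm_smul]
        gcongr
        refine (norm_sub_le _ _).trans ?_
        rw [norm_one]
        gcongr
    _ ≤ _ := by nlinarith [mul_nonneg hM (by positivity : 0 ≤ B + 1), (k.cast_nonneg : (0:ℝ) ≤ k)]

end ProductGrowth

section Strip

/-- The open horizontal strip `|Im ζ| < η`. -/
def strip (η : ℝ) : Set ℂ := {ζ | |ζ.im| < η}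

theorem isOpen_strip (η : ℝ) : IsOpen (strip η) :=
  isOpen_lt (Complex.continuous_im.abs) continuous_const

variable {E : Type*} [NormedAddCommGroup E] [NormedSpace ℂ E]

/-- `f` is `C²` on the line and its derivatives of order `j ≤ 2` are at most `C * κ ^ j`. -/
def C2Bound (f : ℝ → E) (C κ : ℝ) : Prop :=
  ContDiff ℝ 2 f ∧ ∀ j ≤ 2, ∀ θ, ‖iteratedFDeriv ℝ j f θ‖ ≤ C * κ ^ j

theorem iteratedDeriv_comp_ofReal {f : ℂ → E} {η : ℝ} (hη : 0 < η)
    (hf : DifferentiableOn ℂ f (strip η)) [CompleteSpace E] (j : ℕ) :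
    iteratedDeriv j (fun θ : ℝ => f θ) = fun θ : ℝ => iteratedDeriv j f θ := by
  have hmem (θ : ℝ) : (θ : ℂ) ∈ strip η := by simpa [strip] using hη
  induction j with
  | zero => simp
  | succ j ih =>
    rw [iteratedDeriv_succ, ih]
    funext θ
    rw [iteratedDeriv_succ]
    have han : AnalyticAt ℂ f θ := hf.analyticAt ((isOpen_strip η).mem_nhds (hmem θ))
    have : DifferentiableAt ℂ (iteratedDeriv j f) θ := by
      rw [iteratedDeriv_eq_iterate]
      exact (han.iterated_deriv j).differentiableAt
    simpa [Function.comp_def] using (HasDerivAt.scomp (𝕜 := ℝ) (𝕜' := ℂ) θ this.hasDerivAt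
      Complex.ofRealCLM.hasDerivAt).deriv

theorem contDiff_comp_ofReal {f : ℂ → E} {η : ℝ} (hη : 0 < η) [CompleteSpace E]
    (hf : DifferentiableOn ℂ f (strip η)) : ContDiff ℝ 2 (fun θ : ℝ => f θ) := by
  have hmem (θ : ℝ) : (θ : ℂ) ∈ strip η := by simpa [strip] using hη
  refine contDiff_iff_contDiffAt.mpr fun θ => ?_
  have han : AnalyticAt ℂ f θ := hf.analyticAt ((isOpen_strip η).mem_nhds (hmem θ))
  have h1 : ContDiffAt ℝ 2 f (θ : ℂ) := (han.contDiffAt (n := 2)).restrict_scalars ℝ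
  exact h1.comp θ Complex.ofRealCLM.contDiff.contDiffAt

theorem C2Bound.of_strip {f : ℂ → E} {η s B : ℝ} [CompleteSpace E]
    (hs : 0 < s) (hsη : s < η)
    (hf : DifferentiableOn ℂ f (strip η)) (hB : ∀ ζ : ℂ, |ζ.im| ≤ s → ‖f ζ‖ ≤ B) :
    C2Bound (fun θ : ℝ => f θ) (2 * B) s⁻¹ := by
  refine ⟨contDiff_comp_ofReal (hs.trans hsη) hf, fun j hj θ => ?_⟩
  rw [norm_iteratedFDeriv_eq_norm_iteratedDeriv, iteratedDeriv_comp_ofReal (hs.trans hsη) hf]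
  have him (z : ℂ) (hz : dist z θ ≤ s) : |z.im| ≤ s := by
    rw [Complex.dist_eq] at hz
    simpa using (Complex.abs_im_le_norm (z - θ)).trans hz
  have hB0 : 0 ≤ B := (norm_nonneg _).trans (hB 0 (by simpa using hs.le))
  have := Complex.norm_iteratedDeriv_le_of_forall_mem_sphere_norm_le (c := (θ : ℂ)) j hs
    (f := f) (C := B) ?_ ?_
  · refine this.trans ?_
    have : (j.factorial : ℝ) ≤ 2 := by
      have : j.factorial ≤ 2 := (Nat.factorial_le hj).trans (by simp)
      exact_mod_cast this
    rw [div_eq_mul_inv, inv_pow]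
    gcongr
  · refine DifferentiableOn.diffContOnCl (hf.mono fun z hz => ?_)
    exact (him z (Metric.closure_ball_subset_closedBall hz)).trans_lt hsη
  · exact fun z hz => hB z (him z (Metric.mem_sphere.mp hz).le)

theorem C2Bound.mono {f : ℝ → E} {C C' κ κ' : ℝ} (h : C2Bound f C κ) (hC : C ≤ C')
    (hκ : 0 ≤ κ) (hκ' : κ ≤ κ') (hC' : 0 ≤ C') : C2Bound f C' κ' :=
  ⟨h.1, fun j hj θ => (h.2 j hj θ).trans (by gcongr)⟩

theorem C2Bound.rescale {f : ℝ → E} {C κ a : ℝ} (h : C2Bound f C (a * κ)) (hC : 0 ≤ C)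
    (hκ : 0 ≤ κ) (ha : 1 ≤ a) : C2Bound f (C * a ^ 2) κ := by
  refine ⟨h.1, fun j hj θ => (h.2 j hj θ).trans ?_⟩
  rw [mul_pow, ← mul_assoc]
  gcongr

theorem C2Bound.add {f g : ℝ → E} {C C' κ : ℝ} (hf : C2Bound f C κ) (hg : C2Bound g C' κ) :
    C2Bound (fun θ => f θ + g θ) (C + C') κ := by
  refine ⟨hf.1.add hg.1, fun j hj θ => ?_⟩
  have hj' : (j : WithTop ℕ∞) ≤ 2 := by exact_mod_cast hj
  have := iteratedFDeriv_add_apply (x := θ) ((hf.1.of_le hj').contDiffAt) ((hg.1.of_le hj').contDiffAt)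
  change ‖iteratedFDeriv ℝ j (f + g) θ‖ ≤ _
  erw [this, add_mul]
  exact (norm_add_le _ _).trans (add_le_add (hf.2 j hj θ) (hg.2 j hj θ))

theorem C2Bound.mul {R : Type*} [NormedRing R] [NormedAlgebra ℂ R] {f g : ℝ → R} {C C' κ : ℝ}
    (hf : C2Bound f C κ) (hg : C2Bound g C' κ) (hC : 0 ≤ C) (hC' : 0 ≤ C') (hκ : 0 ≤ κ) :
    C2Bound (fun θ => f θ * g θ) (4 * (C * C')) κ := by
  refine ⟨hf.1.mul hg.1, fun j hj θ => ?_⟩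
  refine (norm_iteratedFDeriv_mul_le hf.1 hg.1 θ (by exact_mod_cast hj)).trans ?_
  calc _ ≤ ∑ i ∈ Finset.range (j + 1), (j.choose i : ℝ) * (C * C' * κ ^ j) := by
        refine Finset.sum_le_sum fun i hi => ?_
        have hi : i ≤ j := by have := Finset.mem_range.mp hi; omega
        rw [mul_assoc]
        refine mul_le_mul_of_nonneg_left ?_ (Nat.cast_nonneg _)
        calc _ ≤ (C * κ ^ i) * (C' * κ ^ (j - i)) :=
              mul_le_mul (hf.2 i (hi.trans hj) θ) (hg.2 (j - i) (by omega) θ)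
                (norm_nonneg _) (by positivity)
          _ = C * C' * (κ ^ i * κ ^ (j - i)) := by ring
          _ = _ := by rw [← pow_add, Nat.add_sub_cancel' hi]
    _ = 2 ^ j * (C * C' * κ ^ j) := by
        rw [← Finset.sum_mul]; congr 1; exact_mod_cast Nat.sum_range_choose j
    _ ≤ 2 ^ 2 * (C * C' * κ ^ j) := by gcongr; norm_num
    _ = _ := by ring

theorem C2Bound.clm {F : Type*} [NormedAddCommGroup F] [NormedSpace ℂ F] {f : ℝ → E} {C κ : ℝ}
    (hf : C2Bound f C κ) (L : E →L[ℂ] F) : C2Bound (fun θ => L (f θ)) (‖L‖ * C) κ := by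
  refine ⟨(L.restrictScalars ℝ).contDiff.comp hf.1, fun j hj θ => ?_⟩
  have hj' : (j : WithTop ℕ∞) ≤ 2 := by exact_mod_cast hj
  have := (L.restrictScalars ℝ).norm_iteratedFDeriv_comp_left (x := θ)
    (hf.1.of_le hj').contDiffAt le_rfl
  refine this.trans ?_
  rw [mul_assoc]
  gcongr
  · simp
  · exact hf.2 j hj θ

theorem C2Bound.tsum [CompleteSpace E] {f : ℕ → ℝ → E} {v : ℕ → ℝ} {κ : ℕ → ℝ}
    (hf : ∀ i, C2Bound (f i) (v i) (κ i)) (hv : ∀ j ≤ 2, Summable fun i => v i * κ i ^ j)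
    {S : ℝ} (hS : ∀ j ≤ 2, ∑' i, v i * κ i ^ j ≤ S) :
    C2Bound (fun θ => ∑' i, f i θ) S 1 := by
  have h1 (i : ℕ) : ContDiff ℝ ((2 : ℕ∞) : WithTop ℕ∞) (f i) := (hf i).1
  have h2 (k : ℕ) (hk : (k : ℕ∞) ≤ 2) : Summable fun i => v i * κ i ^ k :=
    hv k (by exact_mod_cast hk)
  have h3 (k : ℕ) (i : ℕ) (x : ℝ) (hk : (k : ℕ∞) ≤ 2) :
      ‖iteratedFDeriv ℝ k (f i) x‖ ≤ v i * κ i ^ k := (hf i).2 k (by exact_mod_cast hk) x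
  refine ⟨contDiff_tsum (N := 2) h1 h2 h3, fun j hj θ => ?_⟩
  have hj' : (j : ℕ∞) ≤ 2 := by exact_mod_cast hj
  rw [iteratedFDeriv_tsum_apply (N := 2) h1 h2 h3 hj', one_pow, mul_one]
  exact (tsum_of_norm_bounded (h2 j hj').hasSum fun i => h3 j i θ hj').trans (hS j hj)

end Strip

/-- Perturbations `A + r n` of a multiplier `A` with eigenvalues `1` and `exp (2 i ζ)`, analytic in
a strip, together with a fixed vector `x` of `A`. -/
structure JostData (𝔅 : Type*) [NormedRing 𝔅] [NormedAlgebra ℂ 𝔅] where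
  η : ℝ
  C : ℝ
  ρ : ℤ → ℝ
  A : ℂ → 𝔅
  r : ℤ → ℂ → 𝔅
  x : ℂ → 𝔅
  η_pos : 0 < η
  η_le : η ≤ 1
  A_diff : DifferentiableOn ℂ A (strip η)
  r_diff : ∀ n, DifferentiableOn ℂ (r n) (strip η)
  x_diff : DifferentiableOn ℂ x (strip η)
  A_quad : ∀ ζ ∈ strip η, A ζ * A ζ =
    (1 + Complex.exp (2 * Complex.I * ζ)) • A ζ - Complex.exp (2 * Complex.I * ζ) • 1
  A_mul_x : ∀ ζ ∈ strip η, A ζ * x ζ = x ζ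
  A_le : ∀ ζ ∈ strip η, ‖A ζ‖ ≤ C
  x_le : ∀ ζ ∈ strip η, ‖x ζ‖ ≤ C
  r_le : ∀ n, ∀ ζ ∈ strip η, ‖r n ζ‖ ≤ ρ n
  summable : Summable fun n : ℤ => (1 + |(n : ℝ)|) ^ 3 * ρ n

set_option linter.unusedSectionVars false

namespace JostData

variable {𝔅 : Type*} [NormedRing 𝔅] [NormedAlgebra ℂ 𝔅] [NormOneClass 𝔅] (J : JostData 𝔅)

/-- The closed upper half of the strip. -/
noncomputable def upper : Set ℂ := {ζ | 0 ≤ ζ.im ∧ ζ.im < J.η}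

theorem upper_subset : J.upper ⊆ strip J.η := fun ζ hζ => by
  rw [strip, Set.mem_ofPred_eq, abs_of_nonneg hζ.1]; exact hζ.2

theorem ofReal_mem_upper (θ : ℝ) : (θ : ℂ) ∈ J.upper := by simpa [upper] using J.η_pos

theorem ofReal_mem_strip (θ : ℝ) : (θ : ℂ) ∈ strip J.η := J.upper_subset (J.ofReal_mem_upper θ)

noncomputable def prod (n : ℤ) (j : ℕ) (ζ : ℂ) : 𝔅 := orderedProd (fun i => J.A ζ + J.r i ζ) n j

noncomputable def term (n : ℤ) (j : ℕ) (ζ : ℂ) : 𝔅 := J.prod n j ζ * (J.r (n + j) ζ * J.x ζ)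

/-- The Jost solution, normalized by its limit `x` at `+∞`. -/
noncomputable def sol (n : ℤ) (ζ : ℂ) : 𝔅 := J.x ζ + ∑' j, J.term n j ζ

noncomputable def wt (n : ℤ) : ℝ := (1 + |(n : ℝ)|) ^ 3 * J.ρ n

noncomputable def total : ℝ := ∑' n, J.wt n

/-- The number of steps from `n` to the half-line `ℕ`. -/
noncomputable def defect (n : ℤ) : ℝ := ((-n).toNat : ℝ)

noncomputable def powConst : ℝ := 1 + Real.exp 2 * (J.C + 1)

noncomputable def growth (n : ℤ) : ℝ := J.powConst * Real.exp (J.powConst * (J.total * (1 + 2 * defect n)))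

theorem ρ_nonneg (n : ℤ) : 0 ≤ J.ρ n := (norm_nonneg _).trans (J.r_le n _ (J.ofReal_mem_strip 0))

theorem C_nonneg : 0 ≤ J.C := (norm_nonneg _).trans (J.A_le _ (J.ofReal_mem_strip 0))

theorem wt_nonneg (n : ℤ) : 0 ≤ J.wt n := by have := J.ρ_nonneg n; unfold wt; positivity

theorem total_nonneg : 0 ≤ J.total := tsum_nonneg J.wt_nonneg

theorem defect_nonneg (n : ℤ) : 0 ≤ defect n := Nat.cast_nonneg _

theorem powConst_nonneg : 0 ≤ J.powConst := by have := J.C_nonneg; unfold powConst; positivity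

theorem growth_nonneg (n : ℤ) : 0 ≤ J.growth n := mul_nonneg J.powConst_nonneg (Real.exp_pos _).le

theorem growth_of_nonneg {n : ℤ} (hn : 0 ≤ n) : J.growth n = J.growth 0 := by
  simp [growth, defect, Int.toNat_of_nonpos (show -n ≤ 0 by omega)]

theorem summable_wt_comp {g : ℕ → ℤ} (hg : Function.Injective g) :
    Summable fun l => J.wt (g l) := J.summable.comp_injective hg

theorem sum_wt_comp_le {g : ℕ → ℤ} (hg : Function.Injective g) (K : ℕ) :
    ∑ l ∈ Finset.range K, J.wt (g l) ≤ J.total := by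
  have := J.summable.sum_le_tsum ((Finset.range K).map ⟨g, hg⟩) (fun i _ => J.wt_nonneg i)
  rw [Finset.sum_map] at this
  exact this

theorem tsum_wt_comp_le {g : ℕ → ℤ} (hg : Function.Injective g) :
    ∑' l, J.wt (g l) ≤ J.total :=
  (J.summable_wt_comp hg).tsum_le_of_sum_range_le (J.sum_wt_comp_le hg)

theorem shift_injective (n : ℤ) : Function.Injective fun l : ℕ => n + (l : ℤ) :=
  fun a b h => by simpa using h

theorem linear_weight_le (n : ℤ) (l : ℕ) :
    1 + |(n : ℝ)| + l ≤ (1 + 2 * defect n) * (1 + |((n + l : ℤ) : ℝ)|) := by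
  unfold defect
  have hl : (0 : ℝ) ≤ l := Nat.cast_nonneg _
  rcases le_or_gt 0 n with hn | hn
  · have h0 : (0 : ℝ) ≤ n := by exact_mod_cast hn
    rw [Int.toNat_of_nonpos (by omega), abs_of_nonneg h0]
    push_cast
    rw [abs_of_nonneg (by positivity)]
    linarith
  · have h0 : (n : ℝ) < 0 := by exact_mod_cast hn
    have e : ((-n).toNat : ℝ) = -n := by
      have : ((-n).toNat : ℤ) = -n := Int.toNat_of_nonneg (by omega)
      exact_mod_cast this
    rw [e, abs_of_neg h0]
    push_cast
    have h1 := le_abs_self ((n : ℝ) + l)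
    nlinarith [abs_nonneg ((n : ℝ) + l)]

theorem wt_ge (n : ℤ) : (1 + |(n : ℝ)|) * J.ρ n ≤ J.wt n := by
  refine mul_le_mul_of_nonneg_right ?_ (J.ρ_nonneg n)
  exact le_self_pow₀ (by linarith [abs_nonneg (n : ℝ)]) (by norm_num)

theorem weighted_ρ_le (n : ℤ) (l : ℕ) :
    (1 + |(n : ℝ)| + l) * J.ρ (n + l) ≤ (1 + 2 * defect n) * J.wt (n + l) := by
  refine (mul_le_mul_of_nonneg_right (linear_weight_le n l) (J.ρ_nonneg _)).trans ?_
  rw [mul_assoc]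
  exact mul_le_mul_of_nonneg_left (J.wt_ge _) (by have := defect_nonneg n; positivity)

theorem norm_pow_le {ζ : ℂ} (hζ : ζ ∈ strip J.η) {K : ℕ} (him : -(1 + K : ℝ)⁻¹ ≤ ζ.im) :
    ∀ k ≤ K, ‖J.A ζ ^ k‖ ≤ J.powConst * (1 + k) := by
  refine norm_pow_le_of_quadratic (J.A_quad ζ hζ) (J.A_le ζ hζ) (Real.exp_pos 2).le ?_
  intro i hi
  rw [← Complex.exp_nat_mul, Complex.norm_exp]
  refine Real.exp_le_exp.mpr ?_
  have hi' : (i : ℝ) ≤ K := by exact_mod_cast hi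
  have e : ((i : ℂ) * (2 * Complex.I * ζ)).re = 2 * (i * -ζ.im) := by simp; ring
  rw [e]
  have h1 : (i : ℝ) * -ζ.im ≤ 1 := by
    calc (i : ℝ) * -ζ.im ≤ i * (1 + K : ℝ)⁻¹ := by gcongr; linarith
      _ ≤ (1 + K) * (1 + K : ℝ)⁻¹ := by gcongr; linarith
      _ = 1 := mul_inv_cancel₀ (by positivity)
  linarith

theorem norm_prod_le {ζ : ℂ} (hζ : ζ ∈ strip J.η) (n : ℤ) {K : ℕ}
    (him : -(1 + K : ℝ)⁻¹ ≤ ζ.im) : ‖J.prod n K ζ‖ ≤ J.growth n * (1 + |(n : ℝ)| + K) := by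
  refine norm_orderedProd_le (r := fun i => J.r i ζ) J.powConst_nonneg (abs_nonneg _)
    (J.norm_pow_le hζ him) ?_
  calc _ ≤ ∑ l ∈ Finset.range K, (1 + 2 * defect n) * J.wt (n + l) := by
        refine Finset.sum_le_sum fun l _ => le_trans ?_ (J.weighted_ρ_le n l)
        gcongr
        exact J.r_le _ ζ hζ
    _ ≤ _ := by
        rw [← Finset.mul_sum, mul_comm]
        gcongr
        · have := defect_nonneg n; positivity
        · exact J.sum_wt_comp_le (shift_injective n) K

theorem norm_prod_neg_le {ζ : ℂ} (hζ : ζ ∈ strip J.η) {K : ℕ}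
    (him : -(1 + K : ℝ)⁻¹ ≤ ζ.im) : ‖J.prod (-K) K ζ‖ ≤ J.growth 0 * (1 + K) := by
  have e : J.growth 0 = J.powConst * Real.exp (J.powConst * J.total) := by
    simp [growth, defect]
  rw [e]
  refine norm_orderedProd_neg_le (r := fun i => J.r i ζ) J.powConst_nonneg
    (J.norm_pow_le hζ him) ?_
  refine le_trans ?_ (J.sum_wt_comp_le (g := fun l : ℕ => -(l : ℤ) - 1) ?_ K)
  · refine Finset.sum_le_sum fun l _ => le_trans ?_ (J.wt_ge _)
    have : (1 + l : ℝ) ≤ 1 + |((-(l : ℤ) - 1 : ℤ) : ℝ)| := by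
      push_cast
      rw [abs_of_neg (by linarith [(l.cast_nonneg : (0:ℝ) ≤ l)])]
      linarith
    exact mul_le_mul this (J.r_le _ ζ hζ) (norm_nonneg _) (by positivity)
  · intro a b h; simpa using h

theorem norm_term_le {ζ : ℂ} (hζ : ζ ∈ strip J.η) (n : ℤ) {K : ℕ}
    (him : -(1 + K : ℝ)⁻¹ ≤ ζ.im) :
    ‖J.term n K ζ‖ ≤ J.growth n * J.C * ((1 + |(n : ℝ)| + K) * J.ρ (n + K)) := by
  have h0 := J.growth_nonneg n
  have hC := J.C_nonneg
  have hρ := J.ρ_nonneg (n + K)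
  calc ‖J.term n K ζ‖ ≤ ‖J.prod n K ζ‖ * (‖J.r (n + K) ζ‖ * ‖J.x ζ‖) :=
        (norm_mul_le _ _).trans (by gcongr; exact norm_mul_le _ _)
    _ ≤ (J.growth n * (1 + |(n : ℝ)| + K)) * (J.ρ (n + K) * J.C) := by
        gcongr
        · exact J.norm_prod_le hζ n him
        · exact J.r_le _ ζ hζ
        · exact J.x_le ζ hζ
    _ = _ := by ring

theorem norm_term_le_wt {ζ : ℂ} (hζ : ζ ∈ strip J.η) (n : ℤ) {K : ℕ}
    (him : -(1 + K : ℝ)⁻¹ ≤ ζ.im) :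
    ‖J.term n K ζ‖ ≤ J.growth n * J.C * (1 + 2 * defect n) * J.wt (n + K) := by
  refine (J.norm_term_le hζ n him).trans ?_
  rw [mul_assoc _ (1 + 2 * defect n)]
  exact mul_le_mul_of_nonneg_left (J.weighted_ρ_le n K) (mul_nonneg (J.growth_nonneg n) J.C_nonneg)

theorem norm_term_le_of_upper {ζ : ℂ} (hζ : ζ ∈ J.upper) (n : ℤ) (K : ℕ) :
    ‖J.term n K ζ‖ ≤ J.growth n * J.C * (1 + 2 * defect n) * J.wt (n + K) :=
  J.norm_term_le_wt (J.upper_subset hζ) n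
    ((neg_nonpos.mpr (by positivity)).trans hζ.1)

theorem summable_term_bound (n : ℤ) :
    Summable fun K : ℕ => J.growth n * J.C * (1 + 2 * defect n) * J.wt (n + K) :=
  (J.summable_wt_comp (shift_injective n)).mul_left _

theorem prod_diff (n : ℤ) (j : ℕ) : DifferentiableOn ℂ (J.prod n j) (strip J.η) := by
  induction j with
  | zero => exact differentiableOn_const _
  | succ j ih => exact ih.mul (J.A_diff.add (J.r_diff _))

theorem term_diff (n : ℤ) (j : ℕ) : DifferentiableOn ℂ (J.term n j) (strip J.η) :=
  (J.prod_diff n j).mul ((J.r_diff _).mul J.x_diff)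

variable [CompleteSpace 𝔅]

theorem summable_term {ζ : ℂ} (hζ : ζ ∈ J.upper) (n : ℤ) : Summable fun j => J.term n j ζ :=
  .of_norm_bounded (J.summable_term_bound n) (J.norm_term_le_of_upper hζ n)

theorem sol_eq_mul {ζ : ℂ} (hζ : ζ ∈ J.upper) (n : ℤ) :
    J.sol n ζ = (J.A ζ + J.r n ζ) * J.sol (n + 1) ζ := by
  have h0 : J.term n 0 ζ = J.r n ζ * J.x ζ := by simp [term, prod, orderedProd]
  have h1 (b : ℕ) : J.term n (b + 1) ζ = (J.A ζ + J.r n ζ) * J.term (n + 1) b ζ := by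
    rw [term, prod, orderedProd_succ_left, term, prod, mul_assoc]
    congr 4
    push_cast
    ring
  rw [sol, sol, (J.summable_term hζ n).tsum_eq_zero_add, mul_add,
    ← (J.summable_term hζ (n + 1)).tsum_mul_left, add_mul,
    J.A_mul_x ζ (J.upper_subset hζ), h0, add_assoc]
  simp only [h1]

theorem sol_eq_prod_mul {ζ : ℂ} (hζ : ζ ∈ J.upper) (n : ℤ) (j : ℕ) :
    J.sol n ζ = J.prod n j ζ * J.sol (n + j) ζ := by
  induction j with
  | zero => simp [prod, orderedProd]
  | succ j ih =>
    rw [ih, J.sol_eq_mul hζ (n + j), ← mul_assoc]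
    congr 2
    push_cast
    ring

theorem continuousOn_sol (n : ℤ) : ContinuousOn (J.sol n) J.upper :=
  (J.x_diff.continuousOn.mono J.upper_subset).add
    (continuousOn_tsum (fun j => (J.term_diff n j).continuousOn.mono J.upper_subset)
      (J.summable_term_bound n) fun K _ hζ => J.norm_term_le_of_upper hζ n K)

theorem norm_sol_sub_le {ζ : ℂ} (hζ : ζ ∈ J.upper) {n : ℤ} (hn : 0 ≤ n) :
    ‖J.sol n ζ - J.x ζ‖ ≤ J.growth 0 * J.C * ∑' j : ℕ, J.wt (n + j) := by
  rw [sol, add_sub_cancel_left]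
  refine (tsum_of_norm_bounded (J.summable_term_bound n).hasSum
    (J.norm_term_le_of_upper hζ n)).trans_eq ?_
  rw [tsum_mul_left, J.growth_of_nonneg hn]
  simp [defect, Int.toNat_of_nonpos (show -n ≤ 0 by omega)]

theorem tendsto_sol {ζ : ℂ} (hζ : ζ ∈ J.upper) :
    Tendsto (fun n : ℕ => J.sol n ζ) atTop (𝓝 (J.x ζ)) := by
  rw [tendsto_iff_norm_sub_tendsto_zero]
  refine squeeze_zero (fun _ => norm_nonneg _)
    (fun n => J.norm_sol_sub_le hζ (Int.natCast_nonneg n)) ?_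
  have := tendsto_sum_nat_add (fun l : ℕ => J.wt l)
  simpa [add_comm] using this.const_mul (J.growth 0 * J.C)

noncomputable def solBound : ℝ := J.C + J.growth 0 * J.C * J.total

theorem norm_sol_le {ζ : ℂ} (hζ : ζ ∈ J.upper) {n : ℤ} (hn : 0 ≤ n) :
    ‖J.sol n ζ‖ ≤ J.solBound := by
  rw [← add_sub_cancel (J.x ζ) (J.sol n ζ)]
  refine (norm_add_le _ _).trans (add_le_add (J.x_le ζ (J.upper_subset hζ)) ?_)
  refine (J.norm_sol_sub_le hζ hn).trans ?_
  exact mul_le_mul_of_nonneg_left (J.tsum_wt_comp_le (shift_injective n))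
    (mul_nonneg (J.growth_nonneg 0) J.C_nonneg)

theorem sol_C2Bound_of_nonneg : ∃ B, 0 ≤ B ∧ ∀ n : ℤ, 0 ≤ n →
    C2Bound (fun θ : ℝ => J.sol n θ) B 1 := by
  have hη := J.η_pos
  have hη1 := J.η_le
  have hC := J.C_nonneg
  have hG := J.growth_nonneg 0
  have hx : C2Bound (fun θ : ℝ => J.x θ) (2 * J.C * (J.η / 2)⁻¹ ^ 2) 1 := by
    have := C2Bound.of_strip (f := J.x) (s := J.η / 2) (B := J.C) (by positivity) (by linarith)
      J.x_diff (fun ζ hζ => J.x_le ζ (hζ.trans_lt (by linarith)))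
    refine C2Bound.rescale (by simpa using this) (by positivity) zero_le_one ?_
    exact (one_le_inv₀ (by positivity)).mpr (by linarith)
  set a : ℝ := 2 / J.η with ha
  have ha1 : 1 ≤ a := by rw [ha, one_le_div hη]; linarith
  refine ⟨2 * J.C * (J.η / 2)⁻¹ ^ 2 + 2 * (J.growth 0 * J.C) * a ^ 2 * J.total, ?_, ?_⟩
  · have := J.total_nonneg; positivity
  intro n hn
  refine hx.add ?_
  have hn0 : (0 : ℝ) ≤ n := by exact_mod_cast hn
  have hpos (K : ℕ) : 0 < 1 + |(n : ℝ)| + K := by positivity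
  have key (K : ℕ) : C2Bound (fun θ : ℝ => J.term n K θ)
      (2 * (J.growth 0 * J.C * ((1 + |(n : ℝ)| + K) * J.ρ (n + K)))) (a * (1 + |(n : ℝ)| + K)) := by
    have e : a * (1 + |(n : ℝ)| + K) = ((J.η / 2) / (1 + |(n : ℝ)| + K))⁻¹ := by
      rw [ha]; field_simp
    rw [e]
    have h1 : (J.η / 2) / (1 + |(n : ℝ)| + K) ≤ (1 + K : ℝ)⁻¹ := by
      rw [div_le_iff₀ (hpos K), inv_mul_eq_div, le_div_iff₀ (by positivity)]
      nlinarith [abs_nonneg (n : ℝ), (K.cast_nonneg : (0:ℝ) ≤ K)]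
    have h2 : (J.η / 2) / (1 + |(n : ℝ)| + K) < J.η := by
      rw [div_lt_iff₀ (hpos K)]
      nlinarith [abs_nonneg (n : ℝ), (K.cast_nonneg : (0:ℝ) ≤ K)]
    refine C2Bound.of_strip (div_pos (by positivity) (hpos K)) h2 (J.term_diff n K) fun ζ hζ => ?_
    rw [← J.growth_of_nonneg hn]
    exact J.norm_term_le (hζ.trans_lt h2) n (by linarith [neg_abs_le ζ.im])
  have bd (j : ℕ) (hj : j ≤ 2) (K : ℕ) :
      2 * (J.growth 0 * J.C * ((1 + |(n : ℝ)| + K) * J.ρ (n + K))) * (a * (1 + |(n : ℝ)| + K)) ^ j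
        ≤ 2 * (J.growth 0 * J.C) * a ^ 2 * J.wt (n + K) := by
    have e : 1 + |((n + K : ℤ) : ℝ)| = 1 + |(n : ℝ)| + K := by
      push_cast; rw [abs_of_nonneg hn0, abs_of_nonneg (by positivity)]; ring
    rw [wt, e, mul_pow]
    have hρ := J.ρ_nonneg (n + K)
    have h1 : a ^ j ≤ a ^ 2 := pow_le_pow_right₀ ha1 hj
    have h2 : (1 + |(n : ℝ)| + K) ^ j ≤ (1 + |(n : ℝ)| + K) ^ 2 :=
      pow_le_pow_right₀ (by linarith [abs_nonneg (n : ℝ), (K.cast_nonneg : (0:ℝ) ≤ K)]) hj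
    calc _ ≤ 2 * (J.growth 0 * J.C * ((1 + |(n : ℝ)| + K) * J.ρ (n + K))) *
          (a ^ 2 * (1 + |(n : ℝ)| + K) ^ 2) := by gcongr
      _ = _ := by ring
  have hsum : Summable fun K : ℕ => 2 * (J.growth 0 * J.C) * a ^ 2 * J.wt (n + K) :=
    (J.summable_wt_comp (shift_injective n)).mul_left _
  have nonneg (j K : ℕ) : 0 ≤ 2 * (J.growth 0 * J.C * ((1 + |(n : ℝ)| + K) * J.ρ (n + K))) *
      (a * (1 + |(n : ℝ)| + K)) ^ j := by
    have hρ := J.ρ_nonneg (n + K); positivity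
  have hs (j : ℕ) (hj : j ≤ 2) := Summable.of_nonneg_of_le (nonneg j) (bd j hj) hsum
  refine C2Bound.tsum key hs fun j hj => ?_
  refine ((hs j hj).tsum_le_tsum (bd j hj) hsum).trans ?_
  rw [tsum_mul_left]
  exact mul_le_mul_of_nonneg_left (J.tsum_wt_comp_le (shift_injective n)) (by positivity)

/-- The Jost solution is `C²` on the real line; its `j`-th derivative grows at most like
`|n| ^ (1 + j)` in the direction opposite to its normalization. -/
theorem exists_sol_C2Bound : ∃ B, 0 ≤ B ∧ ∀ n : ℤ,
    C2Bound (fun θ : ℝ => J.sol n θ) (B * (1 + defect n)) (1 + defect n) := by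
  obtain ⟨B, hB0, hB⟩ := J.sol_C2Bound_of_nonneg
  have hη := J.η_pos
  have hη1 := J.η_le
  have hG := J.growth_nonneg 0
  set a : ℝ := 2 / J.η with ha
  have ha1 : 1 ≤ a := by rw [ha, one_le_div hη]; linarith
  refine ⟨B + 4 * (2 * J.growth 0 * B) * a ^ 2, by positivity, fun n => ?_⟩
  rcases le_or_gt 0 n with hn | hn
  · have hd : defect n = 0 := by simp [defect, Int.toNat_of_nonpos (show -n ≤ 0 by omega)]
    rw [hd]
    simp only [add_zero, mul_one]
    refine (hB n hn).mono (le_add_of_nonneg_right (by positivity)) zero_le_one le_rfl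
      (by positivity)
  · obtain ⟨K, rfl⟩ : ∃ K : ℕ, n = -K := ⟨(-n).toNat, by omega⟩
    have hd : defect (-K) = K := by simp [defect]
    rw [hd]
    have e : (fun θ : ℝ => J.sol (-K) θ) = fun θ : ℝ => J.prod (-K) K θ * J.sol 0 θ := by
      funext θ
      rw [J.sol_eq_prod_mul (J.ofReal_mem_upper θ) (-K) K]
      simp
    rw [e]
    have hK : (0 : ℝ) ≤ K := K.cast_nonneg
    have h1 : C2Bound (fun θ : ℝ => J.prod (-K) K θ) (2 * (J.growth 0 * (1 + K)))
        (a * (1 + K)) := by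
      have e : a * (1 + K) = ((J.η / 2) / (1 + K))⁻¹ := by
        rw [ha]; field_simp
      rw [e]
      have h1 : (J.η / 2) / (1 + K) ≤ (1 + K : ℝ)⁻¹ := by
        rw [div_eq_mul_inv]
        exact mul_le_of_le_one_left (by positivity) (by linarith)
      have h2 : (J.η / 2) / (1 + K) < J.η := by
        rw [div_lt_iff₀ (by positivity)]
        nlinarith
      refine C2Bound.of_strip (by positivity) h2 (J.prod_diff _ K) fun ζ hζ => ?_
      exact J.norm_prod_neg_le (hζ.trans_lt h2) (by linarith [neg_abs_le ζ.im])
    have h2 : C2Bound (fun θ : ℝ => J.sol 0 θ) B (a * (1 + K)) :=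
      (hB 0 le_rfl).mono le_rfl zero_le_one (by nlinarith) hB0
    have h3 := (h1.mul h2 (by positivity) hB0 (by positivity)).rescale (by positivity)
      (by positivity) ha1
    refine h3.mono ?_ (by positivity) le_rfl (by positivity)
    have : 0 ≤ B * (1 + (K : ℝ)) := by positivity
    nlinarith

end JostData

section Oscillatory

/-- **Van der Corput's lemma** for a phase with second derivative bounded below. -/
theorem norm_integral_exp_le_of_convex {a b κ M₀ M₁ : ℝ} (hab : a ≤ b) (hκ : 0 < κ)
    {φ φ₁ φ₂ : ℝ → ℝ} {f f₁ : ℝ → ℂ} (hφ : ∀ x, HasDerivAt φ (φ₁ x) x)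
    (hφ₁ : ∀ x, HasDerivAt φ₁ (φ₂ x) x) (hφ₂ : Continuous φ₂)
    (hf : ∀ x, HasDerivAt f (f₁ x) x) (hf₁ : Continuous f₁)
    (hlow : ∀ x ∈ Set.Icc a b, κ ≤ φ₂ x) (h0 : ∀ x ∈ Set.Icc a b, ‖f x‖ ≤ M₀)
    (h1 : ∀ x ∈ Set.Icc a b, ‖f₁ x‖ ≤ M₁) :
    ‖∫ x in a..b, Complex.exp (Complex.I * φ x) * f x‖ ≤ (9 * M₀ + (b - a) * M₁) / √κ := by
  set δ := √κ with hδ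
  have hδ0 : 0 < δ := Real.sqrt_pos.mpr hκ
  have hδ2 : δ ^ 2 = κ := Real.sq_sqrt hκ.le
  have hφc : Continuous φ := continuous_iff_continuousAt.mpr fun x => (hφ x).continuousAt
  have hφ₁c : Continuous φ₁ := continuous_iff_continuousAt.mpr fun x => (hφ₁ x).continuousAt
  have hfc : Continuous f := continuous_iff_continuousAt.mpr fun x => (hf x).continuousAt
  have hden (x : ℝ) : 0 < φ₁ x ^ 2 + δ ^ 2 := by positivity
  set g : ℝ → ℝ := fun x => φ₁ x / (φ₁ x ^ 2 + δ ^ 2) with hg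
  set g₁ : ℝ → ℝ := fun x => φ₂ x * (δ ^ 2 - φ₁ x ^ 2) / (φ₁ x ^ 2 + δ ^ 2) ^ 2 with hg₁
  have hgd (x : ℝ) : HasDerivAt g (g₁ x) x := by
    have := (hφ₁ x).div (((hφ₁ x).pow 2).add_const (δ ^ 2)) (hden x).ne'
    refine this.congr_deriv ?_
    simp only [hg₁]
    congr 1
    simp
    ring
  have hgc : Continuous g := hφ₁c.div (by fun_prop) fun x => (hden x).ne'
  have hg₁c : Continuous g₁ :=
    Continuous.div (by fun_prop) (by fun_prop) fun x => (pow_pos (hden x) 2).ne'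
  have hgle (x : ℝ) : |g x| ≤ 1 / (2 * δ) := by
    rw [hg, abs_div, abs_of_pos (hden x), div_le_div_iff₀ (hden x) (by positivity)]
    nlinarith [sq_nonneg (|φ₁ x| - δ), sq_abs (φ₁ x)]
  have hexp (x : ℝ) : ‖Complex.exp (Complex.I * φ x)‖ = 1 := by
    rw [mul_comm]; exact Complex.norm_exp_ofReal_mul_I _
  set F : ℝ → ℂ := fun x => -Complex.I * (Complex.exp (Complex.I * φ x) * (f x * g x)) with hF
  set ρ : ℝ → ℂ := fun x => Complex.exp (Complex.I * φ x) *
    (Complex.I * (f₁ x * g x + f x * g₁ x) + f x * (δ ^ 2 / (φ₁ x ^ 2 + δ ^ 2) : ℝ)) with hρ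
  have hρc : Continuous ρ := by
    refine Continuous.mul (by fun_prop) (Continuous.add (by fun_prop) (hfc.mul ?_))
    exact Complex.continuous_ofReal.comp (continuous_const.div (by fun_prop) fun x => (hden x).ne')
  have hFd (x : ℝ) : HasDerivAt F (Complex.exp (Complex.I * φ x) * f x - ρ x) x := by
    have e1 : HasDerivAt (fun x => Complex.exp (Complex.I * φ x))
        (Complex.exp (Complex.I * φ x) * (Complex.I * φ₁ x)) x :=
      (((hφ x).ofReal_comp).const_mul Complex.I).cexp
    have := (e1.mul ((hf x).mul (hgd x).ofReal_comp)).const_mul (-Complex.I)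
    refine this.congr_deriv ?_
    have hd : ((φ₁ x : ℂ) ^ 2 + (δ : ℂ) ^ 2) ≠ 0 := by exact_mod_cast (hden x).ne'
    have key : (φ₁ x : ℂ) * g x + ((δ ^ 2 / (φ₁ x ^ 2 + δ ^ 2) : ℝ) : ℂ) = 1 := by
      simp only [hg]
      push_cast
      field_simp
    simp only [hρ, Pi.mul_apply]
    linear_combination (Complex.exp (Complex.I * φ x) * f x) * key -
      Complex.exp (Complex.I * φ x) * f x * φ₁ x * g x * Complex.I_sq
  set h : ℝ → ℝ := fun x => M₁ / (2 * δ) + (2 * M₀) * (φ₂ x / (φ₁ x ^ 2 + δ ^ 2)) with hh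
  have hquot : Continuous fun x => φ₂ x / (φ₁ x ^ 2 + δ ^ 2) :=
    hφ₂.div (by fun_prop) fun x => (hden x).ne'
  have hM0 : 0 ≤ M₀ := (norm_nonneg _).trans (h0 a ⟨le_rfl, hab⟩)
  have hM1 : 0 ≤ M₁ := (norm_nonneg _).trans (h1 a ⟨le_rfl, hab⟩)
  have hρle (x : ℝ) (hx : x ∈ Set.Icc a b) : ‖ρ x‖ ≤ h x := by
    have hφ₂0 : 0 ≤ φ₂ x := hκ.le.trans (hlow x hx)
    have hg₁le : |g₁ x| ≤ φ₂ x / (φ₁ x ^ 2 + δ ^ 2) := by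
      rw [hg₁, abs_div, abs_mul, abs_of_nonneg hφ₂0, abs_of_pos (pow_pos (hden x) 2),
        div_le_div_iff₀ (pow_pos (hden x) 2) (hden x)]
      have : |δ ^ 2 - φ₁ x ^ 2| ≤ φ₁ x ^ 2 + δ ^ 2 := by
        rw [abs_le]; constructor <;> nlinarith [sq_nonneg δ, sq_nonneg (φ₁ x)]
      calc φ₂ x * |δ ^ 2 - φ₁ x ^ 2| * (φ₁ x ^ 2 + δ ^ 2)
          ≤ φ₂ x * (φ₁ x ^ 2 + δ ^ 2) * (φ₁ x ^ 2 + δ ^ 2) := by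
            gcongr
        _ = _ := by ring
    have hδle : |δ ^ 2 / (φ₁ x ^ 2 + δ ^ 2)| ≤ φ₂ x / (φ₁ x ^ 2 + δ ^ 2) := by
      rw [abs_of_nonneg (by positivity)]
      gcongr
      rw [hδ2]; exact hlow x hx
    rw [hρ, norm_mul, hexp, one_mul]
    calc _ ≤ ‖f₁ x‖ * |g x| + ‖f x‖ * |g₁ x| + ‖f x‖ * |δ ^ 2 / (φ₁ x ^ 2 + δ ^ 2)| := by
          refine (norm_add_le _ _).trans (add_le_add ?_ ?_)
          · rw [norm_mul, Complex.norm_I, one_mul]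
            refine (norm_add_le _ _).trans_eq ?_
            simp
          · rw [norm_mul, Complex.norm_real, Real.norm_eq_abs]
      _ ≤ M₁ * (1 / (2 * δ)) + M₀ * (φ₂ x / (φ₁ x ^ 2 + δ ^ 2)) +
          M₀ * (φ₂ x / (φ₁ x ^ 2 + δ ^ 2)) := by
          gcongr
          · exact h1 x hx
          · exact hgle x
          · exact h0 x hx
          · exact h0 x hx
      _ = h x := by simp only [hh]; ring
  have hint : ∫ x in a..b, Complex.exp (Complex.I * φ x) * f x =
      (F b - F a) + ∫ x in a..b, ρ x := by
    rw [← intervalIntegral.integral_eq_sub_of_hasDerivAt (fun x _ => hFd x)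
      (Continuous.intervalIntegrable (by fun_prop) _ _),
      intervalIntegral.integral_sub (Continuous.intervalIntegrable (by fun_prop) _ _)
        (hρc.intervalIntegrable _ _), sub_add_cancel]
  have hFle (x : ℝ) (hx : x ∈ Set.Icc a b) : ‖F x‖ ≤ M₀ * (1 / (2 * δ)) := by
    rw [hF]
    simp only [norm_mul, norm_neg, Complex.norm_I, one_mul, hexp, Complex.norm_real,
      Real.norm_eq_abs]
    gcongr
    · exact h0 x hx
    · exact hgle x
  have harc (x : ℝ) : HasDerivAt (fun x => δ⁻¹ * Real.arctan (φ₁ x / δ))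
      (φ₂ x / (φ₁ x ^ 2 + δ ^ 2)) x := by
    have := (((hφ₁ x).div_const δ).arctan).const_mul δ⁻¹
    refine this.congr_deriv ?_
    have := (hden x).ne'
    field_simp
    ring
  have hhint : ∫ x in a..b, h x ≤ (b - a) * (M₁ / (2 * δ)) + 2 * M₀ * (4 / δ) := by
    rw [hh, intervalIntegral.integral_add (by simp) ((hquot.intervalIntegrable _ _).const_mul _),
      intervalIntegral.integral_const, intervalIntegral.integral_const_mul,
      intervalIntegral.integral_eq_sub_of_hasDerivAt (fun x _ => harc x)
        (hquot.intervalIntegrable _ _), smul_eq_mul]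
    gcongr
    rw [← mul_sub, div_eq_inv_mul 4 δ]
    refine mul_le_mul_of_nonneg_left ?_ (inv_nonneg.mpr hδ0.le)
    linarith [Real.arctan_lt_pi_div_two (φ₁ b / δ), Real.neg_pi_div_two_lt_arctan (φ₁ a / δ),
      Real.pi_lt_four]
  rw [hint]
  have hnorm : ‖∫ x in a..b, ρ x‖ ≤ ∫ x in a..b, h x :=
    intervalIntegral.norm_integral_le_of_norm_le hab
      (Eventually.of_forall fun x hx => hρle x (Set.Ioc_subset_Icc_self hx))
      (Continuous.intervalIntegrable (by simp only [hh]; exact (continuous_const.add (continuous_const.mul hquot))) _ _)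
  calc _ ≤ (‖F b‖ + ‖F a‖) + ‖∫ x in a..b, ρ x‖ :=
        (norm_add_le _ _).trans (add_le_add (norm_sub_le _ _) le_rfl)
    _ ≤ (M₀ * (1 / (2 * δ)) + M₀ * (1 / (2 * δ))) +
        ((b - a) * (M₁ / (2 * δ)) + 2 * M₀ * (4 / δ)) :=
        add_le_add (add_le_add (hFle b ⟨hab, le_rfl⟩) (hFle a ⟨le_rfl, hab⟩))
          (hnorm.trans hhint)
    _ ≤ _ := by
        have hba : 0 ≤ (b - a) * M₁ := mul_nonneg (by linarith) hM1
        rw [show M₀ * (1 / (2 * δ)) + M₀ * (1 / (2 * δ)) + ((b - a) * (M₁ / (2 * δ)) +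
          2 * M₀ * (4 / δ)) = (9 * M₀ + (b - a) * M₁ / 2) / δ by field_simp; ring]
        gcongr
        linarith

theorem norm_integral_exp_le_of_concave {a b κ M₀ M₁ : ℝ} (hab : a ≤ b) (hκ : 0 < κ)
    {φ φ₁ φ₂ : ℝ → ℝ} {f f₁ : ℝ → ℂ} (hφ : ∀ x, HasDerivAt φ (φ₁ x) x)
    (hφ₁ : ∀ x, HasDerivAt φ₁ (φ₂ x) x) (hφ₂ : Continuous φ₂)
    (hf : ∀ x, HasDerivAt f (f₁ x) x) (hf₁ : Continuous f₁)
    (hlow : ∀ x ∈ Set.Icc a b, φ₂ x ≤ -κ) (h0 : ∀ x ∈ Set.Icc a b, ‖f x‖ ≤ M₀)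
    (h1 : ∀ x ∈ Set.Icc a b, ‖f₁ x‖ ≤ M₁) :
    ‖∫ x in a..b, Complex.exp (Complex.I * φ x) * f x‖ ≤ (9 * M₀ + (b - a) * M₁) / √κ := by
  have := norm_integral_exp_le_of_convex (f := fun x => star (f x)) (f₁ := fun x => star (f₁ x))
    hab hκ (fun x => (hφ x).neg) (fun x => (hφ₁ x).neg) hφ₂.neg (fun x => (hf x).star)
    (by fun_prop) (fun x hx => le_neg.mpr (hlow x hx)) (by simpa using h0) (by simpa using h1)
  convert this using 1
  rw [← Complex.norm_conj, ← intervalIntegral.intervalIntegral_conj]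
  congr 2
  funext x
  simp [← Complex.exp_conj]

/-- Integration by parts for a phase without stationary points. -/
theorem norm_integral_exp_le_of_nonstationary {a b t c D M₀ M₁ : ℝ} (hab : a ≤ b) (ht : 0 < t)
    (hc : 0 < c) {φ φ₁ φ₂ : ℝ → ℝ} {f f₁ : ℝ → ℂ} (hφ : ∀ x, HasDerivAt φ (φ₁ x) x)
    (hφ₁ : ∀ x, HasDerivAt φ₁ (φ₂ x) x) (hφ₂ : Continuous φ₂)
    (hf : ∀ x, HasDerivAt f (f₁ x) x) (hf₁ : Continuous f₁)
    (hlow : ∀ x ∈ Set.Icc a b, c ≤ |φ₁ x|) (hD : ∀ x ∈ Set.Icc a b, |φ₂ x| ≤ D)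
    (h0 : ∀ x ∈ Set.Icc a b, ‖f x‖ ≤ M₀) (h1 : ∀ x ∈ Set.Icc a b, ‖f₁ x‖ ≤ M₁) :
    ‖∫ x in a..b, Complex.exp (Complex.I * (t * φ x : ℝ)) * f x‖ ≤
      (2 * M₀ / c + (b - a) * (M₁ / c + M₀ * D / c ^ 2)) / t := by
  have hφc : Continuous φ := continuous_iff_continuousAt.mpr fun x => (hφ x).continuousAt
  have hφ₁c : Continuous φ₁ := continuous_iff_continuousAt.mpr fun x => (hφ₁ x).continuousAt
  have hfc : Continuous f := continuous_iff_continuousAt.mpr fun x => (hf x).continuousAt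
  have hne (x : ℝ) (hx : x ∈ Set.Icc a b) : φ₁ x ≠ 0 := fun h => by
    have := hlow x hx
    rw [h, abs_zero] at this
    linarith
  have hexp (x : ℝ) : ‖Complex.exp (Complex.I * (t * φ x : ℝ))‖ = 1 := by
    rw [mul_comm]; exact Complex.norm_exp_ofReal_mul_I _
  have huIcc : Set.uIcc a b = Set.Icc a b := Set.uIcc_of_le hab
  set F : ℝ → ℂ := fun x => -Complex.I / t * (Complex.exp (Complex.I * (t * φ x : ℝ)) *
    (f x / φ₁ x)) with hF
  set ρ : ℝ → ℂ := fun x => Complex.I / t * (Complex.exp (Complex.I * (t * φ x : ℝ)) *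
    (f₁ x / φ₁ x - f x * φ₂ x / φ₁ x ^ 2)) with hρ
  have hρc : ContinuousOn ρ (Set.Icc a b) := by
    have h1 : ContinuousOn (fun x => (φ₁ x : ℂ)) (Set.Icc a b) := by fun_prop
    refine continuousOn_const.mul (ContinuousOn.mul (by fun_prop) (ContinuousOn.sub ?_ ?_))
    · exact hf₁.continuousOn.div h1 fun x hx => by exact_mod_cast hne x hx
    · exact (ContinuousOn.mul (by fun_prop) (by fun_prop)).div (h1.pow 2)
        fun x hx => pow_ne_zero 2 (by exact_mod_cast hne x hx)
  have hFd (x : ℝ) (hx : x ∈ Set.Icc a b) :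
      HasDerivAt F (Complex.exp (Complex.I * (t * φ x : ℝ)) * f x - ρ x) x := by
    have e1 : HasDerivAt (fun x => Complex.exp (Complex.I * (t * φ x : ℝ)))
        (Complex.exp (Complex.I * (t * φ x : ℝ)) * (Complex.I * (t * φ₁ x : ℝ))) x :=
      ((((hφ x).const_mul t).ofReal_comp).const_mul Complex.I).cexp
    have hne' : (φ₁ x : ℂ) ≠ 0 := by exact_mod_cast hne x hx
    have ht' : (t : ℂ) ≠ 0 := by exact_mod_cast ht.ne'
    have := (e1.mul ((hf x).div (hφ₁ x).ofReal_comp hne')).const_mul (-Complex.I / t)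
    refine this.congr_deriv ?_
    simp only [hρ, Pi.div_apply]
    push_cast
    field_simp
    linear_combination (-(f x * φ₁ x ^ 2 * t)) * Complex.I_sq
  have hint : ∫ x in a..b, Complex.exp (Complex.I * (t * φ x : ℝ)) * f x =
      (F b - F a) + ∫ x in a..b, ρ x := by
    have hρi : IntervalIntegrable ρ volume a b :=
      ContinuousOn.intervalIntegrable (by rwa [huIcc])
    have hei : IntervalIntegrable (fun x => Complex.exp (Complex.I * (t * φ x : ℝ)) * f x)
      volume a b := Continuous.intervalIntegrable (by fun_prop) _ _
    rw [← intervalIntegral.integral_eq_sub_of_hasDerivAt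
      (fun x hx => hFd x (by rwa [huIcc] at hx)) (hei.sub hρi),
      intervalIntegral.integral_sub hei hρi, sub_add_cancel]
  have hM0 : 0 ≤ M₀ := (norm_nonneg _).trans (h0 a ⟨le_rfl, hab⟩)
  have hM1 : 0 ≤ M₁ := (norm_nonneg _).trans (h1 a ⟨le_rfl, hab⟩)
  have hD0 : 0 ≤ D := (abs_nonneg _).trans (hD a ⟨le_rfl, hab⟩)
  have hFle (x : ℝ) (hx : x ∈ Set.Icc a b) : ‖F x‖ ≤ M₀ / c / t := by
    rw [hF]
    simp only [norm_mul, norm_neg, norm_div, Complex.norm_I, one_mul, hexp, Complex.norm_real,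
      Real.norm_eq_abs, abs_of_pos ht]
    rw [one_div_mul_eq_div]
    gcongr
    · exact h0 x hx
    · exact hlow x hx
  have hρle (x : ℝ) (hx : x ∈ Set.Icc a b) : ‖ρ x‖ ≤ (M₁ / c + M₀ * D / c ^ 2) / t := by
    rw [hρ]
    simp only [norm_mul, norm_div, Complex.norm_I, one_mul, hexp, Complex.norm_real,
      Real.norm_eq_abs, abs_of_pos ht]
    rw [one_div_mul_eq_div]
    gcongr
    refine (norm_sub_le _ _).trans ?_
    simp only [norm_mul, norm_div, norm_pow, Complex.norm_real, Real.norm_eq_abs]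
    gcongr
    · exact h1 x hx
    · exact hlow x hx
    · exact h0 x hx
    · exact hD x hx
    · exact hlow x hx
  have hnorm : ‖∫ x in a..b, ρ x‖ ≤ (M₁ / c + M₀ * D / c ^ 2) / t * |b - a| :=
    intervalIntegral.norm_integral_le_of_norm_le_const fun x hx =>
      hρle x (by rw [Set.uIoc_of_le hab] at hx; exact Set.Ioc_subset_Icc_self hx)
  rw [hint]
  calc _ ≤ (‖F b‖ + ‖F a‖) + ‖∫ x in a..b, ρ x‖ :=
        (norm_add_le _ _).trans (add_le_add (norm_sub_le _ _) le_rfl)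
    _ ≤ (M₀ / c / t + M₀ / c / t) + (M₁ / c + M₀ * D / c ^ 2) / t * |b - a| :=
        add_le_add (add_le_add (hFle b ⟨hab, le_rfl⟩) (hFle a ⟨le_rfl, hab⟩)) hnorm
    _ = _ := by rw [abs_of_nonneg (by linarith : 0 ≤ b - a)]; ring

/-- The oscillatory integrals with phase `N θ - t L θ` over `[a, b]` and amplitudes of size
`μ κ`, with derivatives of size `μ κ ^ 2`, are `O(t^(-1/2) (μ κ)^(3/2))`. -/
def DecaysOn (L : ℝ → ℝ) (a b : ℝ) : Prop :=
  ∃ C, 0 ≤ C ∧ ∀ (t N μ κ B : ℝ) (f f₁ : ℝ → ℂ), 1 ≤ t → 1 ≤ κ → κ ≤ μ → |N| ≤ 2 * μ → 0 ≤ B →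
    (∀ x, HasDerivAt f (f₁ x) x) → Continuous f₁ → (∀ x, ‖f x‖ ≤ B * (μ * κ)) →
    (∀ x, ‖f₁ x‖ ≤ B * (μ * κ ^ 2)) →
    ‖∫ x in a..b, Complex.exp (Complex.I * (N * x - t * L x : ℝ)) * f x‖ ≤
      C * B * ((μ * κ) * √(μ * κ) / √t)

variable {L L₁ L₂ : ℝ → ℝ}

theorem DecaysOn.refl (L : ℝ → ℝ) (a : ℝ) : DecaysOn L a a :=
  ⟨0, le_rfl, fun _ _ _ _ _ _ _ _ _ _ _ _ _ _ _ _ => by simp⟩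

theorem DecaysOn.append {a b c : ℝ} (hL : Continuous L) (h : DecaysOn L a b)
    (h' : DecaysOn L b c) : DecaysOn L a c := by
  obtain ⟨C, hC, H⟩ := h
  obtain ⟨C', hC', H'⟩ := h'
  refine ⟨C + C', by positivity, fun t N μ κ B f f₁ ht hκ hμ hN hB hf hf₁ h0 h1 => ?_⟩
  have hfc : Continuous f := continuous_iff_continuousAt.mpr fun x => (hf x).continuousAt
  rw [← intervalIntegral.integral_add_adjacent_intervals (b := b)
    (Continuous.intervalIntegrable (by fun_prop) _ _)
    (Continuous.intervalIntegrable (by fun_prop) _ _), add_mul, add_mul]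
  exact (norm_add_le _ _).trans (add_le_add (H t N μ κ B f f₁ ht hκ hμ hN hB hf hf₁ h0 h1)
    (H' t N μ κ B f f₁ ht hκ hμ hN hB hf hf₁ h0 h1))

theorem decaysOn_of_second_derivative {a b c : ℝ} (hab : a ≤ b) (hc : 0 < c)
    (hL : ∀ x, HasDerivAt L (L₁ x) x) (hL₁ : ∀ x, HasDerivAt L₁ (L₂ x) x) (hL₂ : Continuous L₂)
    (h : (∀ x ∈ Set.Icc a b, c ≤ L₂ x) ∨ (∀ x ∈ Set.Icc a b, L₂ x ≤ -c)) : DecaysOn L a b := by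
  refine ⟨(9 + (b - a)) / √c, by have := sub_nonneg.mpr hab; positivity, ?_⟩
  intro t N μ κ B f f₁ ht hκ hμ hN hB hf hf₁ h0 h1
  have ht0 : 0 < t := by linarith
  have hφ (x : ℝ) : HasDerivAt (fun x => N * x - t * L x) (N - t * L₁ x) x := by
    have := ((hasDerivAt_id x).const_mul N).sub ((hL x).const_mul t)
    rw [mul_one] at this
    exact this
  have hφ₁ (x : ℝ) : HasDerivAt (fun x => N - t * L₁ x) (-(t * L₂ x)) x := by
    simpa using ((hL₁ x).const_mul t).const_sub N
  have key : ‖∫ x in a..b, Complex.exp (Complex.I * (N * x - t * L x : ℝ)) * f x‖ ≤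
      (9 * (B * (μ * κ)) + (b - a) * (B * (μ * κ ^ 2))) / √(t * c) := by
    rcases h with h | h
    · exact norm_integral_exp_le_of_concave hab (by positivity) hφ hφ₁ (by fun_prop) hf hf₁
        (fun x hx => neg_le_neg (mul_le_mul_of_nonneg_left (h x hx) ht0.le))
        (fun x _ => h0 x) (fun x _ => h1 x)
    · exact norm_integral_exp_le_of_convex hab (by positivity) hφ hφ₁ (by fun_prop) hf hf₁
        (fun x hx => by have := mul_le_mul_of_nonneg_left (h x hx) ht0.le; linarith)
        (fun x _ => h0 x) (fun x _ => h1 x)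
  refine key.trans ?_
  have hs : κ ≤ √(μ * κ) := by
    refine Real.le_sqrt_of_sq_le ?_
    nlinarith
  have hs1 : 1 ≤ √(μ * κ) := hκ.trans hs
  have hba : 0 ≤ b - a := by linarith
  have hμ0 : 0 ≤ μ := by linarith
  have hκ0 : 0 ≤ κ := by linarith
  rw [Real.sqrt_mul ht0.le]
  have hsc : 0 < √c := Real.sqrt_pos.mpr hc
  have hst : 0 < √t := Real.sqrt_pos.mpr ht0
  calc _ ≤ (9 * (B * (μ * κ * √(μ * κ))) + (b - a) * (B * (μ * κ * √(μ * κ)))) / (√t * √c) := by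
        have a1 : μ * κ ≤ μ * κ * √(μ * κ) := le_mul_of_one_le_right (by positivity) hs1
        have a2 : μ * κ ^ 2 ≤ μ * κ * √(μ * κ) := by
          rw [pow_two, ← mul_assoc]
          exact mul_le_mul_of_nonneg_left hs (by positivity)
        exact div_le_div_of_nonneg_right (add_le_add
          (mul_le_mul_of_nonneg_left (mul_le_mul_of_nonneg_left a1 hB) (by norm_num))
          (mul_le_mul_of_nonneg_left (mul_le_mul_of_nonneg_left a2 hB) hba)) (by positivity)
    _ = _ := by field_simp

theorem decaysOn_of_first_derivative {a b c : ℝ} (hab : a ≤ b) (hc : 0 < c)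
    (hL : ∀ x, HasDerivAt L (L₁ x) x) (hL₁ : ∀ x, HasDerivAt L₁ (L₂ x) x) (hL₂ : Continuous L₂)
    (h : ∀ x ∈ Set.Icc a b, c ≤ |L₁ x|) : DecaysOn L a b := by
  obtain ⟨D, hD⟩ := isCompact_Icc.exists_bound_of_continuousOn (s := Set.Icc a b) hL₂.continuousOn
  have hD0 : 0 ≤ D := (norm_nonneg _).trans (hD a ⟨le_rfl, hab⟩)
  have hba : 0 ≤ b - a := by linarith
  set K : ℝ := 2 / c + (b - a) * (3 / c + D / c ^ 2) with hK
  have hK0 : 0 ≤ K := by positivity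
  refine ⟨(b - a) + K, by positivity, ?_⟩
  intro t N μ κ B f f₁ ht hκ hμ hN hB hf hf₁ h0 h1
  have ht0 : 0 < t := by linarith
  have hμ1 : 1 ≤ μ := by linarith
  have hμ0 : 0 ≤ μ := by linarith
  have hκ0 : 0 ≤ κ := by linarith
  have hst : 0 < √t := Real.sqrt_pos.mpr ht0
  have hexpN (x : ℝ) : ‖Complex.exp (Complex.I * (N * x : ℝ))‖ = 1 := by
    rw [mul_comm]; exact Complex.norm_exp_ofReal_mul_I _
  rcases le_or_gt t μ with htμ | htμ
  · have : ‖∫ x in a..b, Complex.exp (Complex.I * (N * x - t * L x : ℝ)) * f x‖ ≤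
        B * (μ * κ) * |b - a| := by
      refine intervalIntegral.norm_integral_le_of_norm_le_const fun x _ => ?_
      rw [norm_mul, mul_comm Complex.I, Complex.norm_exp_ofReal_mul_I, one_mul]
      exact h0 x
    refine this.trans ?_
    rw [abs_of_nonneg hba]
    have h1 : 1 ≤ √(μ * κ) / √t := by
      rw [one_le_div hst]
      exact Real.sqrt_le_sqrt (by nlinarith)
    calc B * (μ * κ) * (b - a) ≤ B * (μ * κ) * (b - a + K) * (√(μ * κ) / √t) := by
          refine le_trans ?_ (le_mul_of_one_le_right (by positivity) h1)
          gcongr; linarith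
      _ = _ := by ring
  · have e1 (x : ℝ) : HasDerivAt (fun x => Complex.exp (Complex.I * (N * x : ℝ)))
        (Complex.exp (Complex.I * (N * x : ℝ)) * (Complex.I * N)) x := by
      simpa using ((((hasDerivAt_id x).const_mul N).ofReal_comp).const_mul Complex.I).cexp
    have hfc : Continuous f := continuous_iff_continuousAt.mpr fun x => (hf x).continuousAt
    have key := norm_integral_exp_le_of_nonstationary (t := t) (c := c) (D := D)
      (φ := fun x => -L x) (φ₁ := fun x => -L₁ x) (φ₂ := fun x => -L₂ x)
      (f := fun x => Complex.exp (Complex.I * (N * x : ℝ)) * f x)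
      (f₁ := fun x => Complex.exp (Complex.I * (N * x : ℝ)) * (Complex.I * N) * f x +
        Complex.exp (Complex.I * (N * x : ℝ)) * f₁ x)
      (M₀ := B * (μ * κ)) (M₁ := 3 * (B * (μ ^ 2 * κ)))
      hab ht0 hc (fun x => (hL x).neg) (fun x => (hL₁ x).neg) hL₂.neg
      (fun x => (e1 x).mul (hf x)) (by fun_prop)
      (fun x hx => by simpa using h x hx) (fun x hx => by simpa using hD x hx)
      (fun x _ => by rw [norm_mul, hexpN, one_mul]; exact h0 x)
      (fun x _ => by
        refine (norm_add_le _ _).trans ?_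
        simp only [norm_mul, hexpN, one_mul, Complex.norm_I, Complex.norm_real, Real.norm_eq_abs]
        have a1 : |N| * ‖f x‖ ≤ (2 * μ) * (B * (μ * κ)) := by gcongr; exact h0 x
        have a2 : ‖f₁ x‖ ≤ B * (μ ^ 2 * κ) := by
          refine (h1 x).trans ?_
          gcongr B * ?_
          nlinarith [mul_nonneg hμ0 hκ0]
        nlinarith)
    have e2 : ∫ x in a..b, Complex.exp (Complex.I * (N * x - t * L x : ℝ)) * f x =
        ∫ x in a..b, Complex.exp (Complex.I * (t * -L x : ℝ)) *
          (Complex.exp (Complex.I * (N * x : ℝ)) * f x) := by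
      congr 1
      funext x
      rw [← mul_assoc, ← Complex.exp_add]
      congr 2
      push_cast
      ring
    rw [e2]
    refine key.trans ?_
    have hle : μ / t ≤ √(μ * κ) / √t := by
      have : μ / t ≤ √(μ / t) := by
        refine Real.le_sqrt_of_sq_le ?_
        rw [pow_two]
        exact mul_le_of_le_one_left (by positivity) ((div_le_one ht0).mpr htμ.le)
      rw [Real.sqrt_div hμ0] at this
      refine this.trans ?_
      gcongr
      nlinarith
    calc _ ≤ (2 * (B * (μ ^ 2 * κ)) / c + (b - a) * (3 * (B * (μ ^ 2 * κ)) / c +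
          (B * (μ ^ 2 * κ)) * D / c ^ 2)) / t := by
          have : μ * κ ≤ μ ^ 2 * κ := by nlinarith [mul_nonneg hμ0 hκ0]
          gcongr
      _ = K * B * (μ * κ * (μ / t)) := by rw [hK]; ring
      _ ≤ (b - a + K) * B * (μ * κ * (√(μ * κ) / √t)) := by
          gcongr; linarith
      _ = _ := by ring

theorem exists_decaysOn_nhds (hL : ∀ x, HasDerivAt L (L₁ x) x)
    (hL₁ : ∀ x, HasDerivAt L₁ (L₂ x) x) (hL₂ : Continuous L₂) (x₀ : ℝ)
    (h : L₁ x₀ ≠ 0 ∨ L₂ x₀ ≠ 0) :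
    ∃ U : Set ℝ, IsOpen U ∧ x₀ ∈ U ∧ ∀ a b, a ≤ b → Set.Icc a b ⊆ U → DecaysOn L a b := by
  have hL₁c : Continuous L₁ := continuous_iff_continuousAt.mpr fun x => (hL₁ x).continuousAt
  rcases h with h | h
  · refine ⟨{x | |L₁ x₀| / 2 < |L₁ x|}, isOpen_lt continuous_const hL₁c.abs,
      half_lt_self (abs_pos.mpr h), fun a b hab hU => ?_⟩
    exact decaysOn_of_first_derivative hab (half_pos (abs_pos.mpr h)) hL hL₁ hL₂
      fun x hx => (hU hx).le
  · rcases lt_or_gt_of_ne h with h | h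
    · refine ⟨{x | L₂ x < L₂ x₀ / 2}, isOpen_lt hL₂ continuous_const,
        by change L₂ x₀ < L₂ x₀ / 2; linarith, fun a b hab hU => ?_⟩
      exact decaysOn_of_second_derivative (c := -(L₂ x₀ / 2)) hab (by linarith) hL hL₁ hL₂
        (Or.inr fun x hx => by simpa using (hU hx).le)
    · refine ⟨{x | L₂ x₀ / 2 < L₂ x}, isOpen_lt continuous_const hL₂,
        by change L₂ x₀ / 2 < L₂ x₀; linarith, fun a b hab hU => ?_⟩
      exact decaysOn_of_second_derivative hab (half_pos h) hL hL₁ hL₂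
        (Or.inl fun x hx => (hU hx).le)

theorem decaysOn_of_nondegenerate (hL : ∀ x, HasDerivAt L (L₁ x) x)
    (hL₁ : ∀ x, HasDerivAt L₁ (L₂ x) x) (hL₂ : Continuous L₂) (h : ∀ x, L₁ x ≠ 0 ∨ L₂ x ≠ 0)
    {a b : ℝ} (hab : a ≤ b) : DecaysOn L a b := by
  have hLc : Continuous L := continuous_iff_continuousAt.mpr fun x => (hL x).continuousAt
  choose U hUo hxU hU using fun x => exists_decaysOn_nhds hL hL₁ hL₂ x (h x)
  obtain ⟨s, hs0, hsm, ⟨k, hk⟩, hs⟩ := exists_monotone_Icc_subset_open_cover_Icc hab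
    (c := fun x : ℝ => (Subtype.val ⁻¹' U x : Set (Set.Icc a b)))
    (fun x => (hUo x).preimage continuous_subtype_val)
    (fun x _ => Set.mem_iUnion.mpr ⟨x, hxU x⟩)
  have ind (n : ℕ) : DecaysOn L a (s n) := by
    induction n with
    | zero => rw [hs0]; exact DecaysOn.refl L a
    | succ n ih =>
      refine ih.append hLc ?_
      obtain ⟨i, hi⟩ := hs n
      refine hU i _ _ (hsm (Nat.le_succ n)) fun y hy => ?_
      have hyab : y ∈ Set.Icc a b := ⟨(s n).2.1.trans hy.1, hy.2.trans (s (n + 1)).2.2⟩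
      exact hi (show (⟨y, hyab⟩ : Set.Icc a b) ∈ Set.Icc (s n) (s (n + 1)) from hy)
  have := ind k
  rwa [hk k le_rfl] at this

end Oscillatory

section Oscillatory

variable {L L₁ L₂ : ℝ → ℝ}

theorem DecaysOn.norm_integral_deriv_mul_le (hL : ∀ x, HasDerivAt L (L₁ x) x)
    (hL₁ : Continuous L₁) {b c : ℝ} (hdec : DecaysOn L b c) (hper : L b = L c) :
    ∃ C, 0 ≤ C ∧ ∀ (t N μ κ B : ℝ) (a : ℝ → ℂ), 1 ≤ t → 1 ≤ κ → κ ≤ μ → |N| ≤ 2 * μ → 0 ≤ B →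
      C2Bound a (B * κ) κ →
      Complex.exp (Complex.I * (N * b : ℝ)) * a b = Complex.exp (Complex.I * (N * c : ℝ)) * a c →
      ‖∫ x in b..c, Complex.exp (-Complex.I * t * L x) * L₁ x *
        (Complex.exp (Complex.I * (N * x : ℝ)) * a x)‖ ≤
        C * B * ((μ * κ) * √(μ * κ) / √t / t) := by
  obtain ⟨C, hC, H⟩ := hdec
  refine ⟨3 * C, by positivity, fun t N μ κ B a ht hκ hμ hN hB ha hbc => ?_⟩
  have ht0 : 0 < t := by linarith
  have hμ0 : 0 ≤ μ := by linarith
  have hκ0 : 0 ≤ κ := by linarith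
  have hLc : Continuous L := continuous_iff_continuousAt.mpr fun x => (hL x).continuousAt
  have ha1 : ContDiff ℝ 1 (deriv a) := ((contDiff_succ_iff_deriv (n := 1)).mp ha.1).2.2
  have hda (x : ℝ) : HasDerivAt a (deriv a x) x :=
    (ha.1.differentiable (by norm_num)).differentiableAt.hasDerivAt
  have hda1 (x : ℝ) : HasDerivAt (deriv a) (deriv (deriv a) x) x :=
    (ha1.differentiable (by norm_num)).differentiableAt.hasDerivAt
  have hda2 : Continuous (deriv (deriv a)) := ha1.continuous_deriv (by norm_num)
  have b0 (x : ℝ) : ‖a x‖ ≤ B * κ := by simpa using ha.2 0 (by norm_num) x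
  have b1 (x : ℝ) : ‖deriv a x‖ ≤ B * κ * κ := by
    have := ha.2 1 (by norm_num) x
    rwa [norm_iteratedFDeriv_eq_norm_iteratedDeriv, iteratedDeriv_one, pow_one] at this
  have b2 (x : ℝ) : ‖deriv (deriv a) x‖ ≤ B * κ * κ ^ 2 := by
    have := ha.2 2 (by norm_num) x
    rwa [norm_iteratedFDeriv_eq_norm_iteratedDeriv, iteratedDeriv_succ, iteratedDeriv_one] at this
  set f : ℝ → ℂ := fun x => Complex.I * N * a x + deriv a x with hf
  set f₁ : ℝ → ℂ := fun x => Complex.I * N * deriv a x + deriv (deriv a) x with hf₁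
  have e1 (x : ℝ) : HasDerivAt (fun x => Complex.exp (Complex.I * (N * x : ℝ)))
      (Complex.exp (Complex.I * (N * x : ℝ)) * (Complex.I * N)) x := by
    simpa using ((((hasDerivAt_id x).const_mul N).ofReal_comp).const_mul Complex.I).cexp
  have e2 (x : ℝ) : HasDerivAt (fun x => Complex.exp (-Complex.I * t * L x))
      (Complex.exp (-Complex.I * t * L x) * (-Complex.I * t * L₁ x)) x :=
    (((hL x).ofReal_comp).const_mul (-Complex.I * t)).cexp
  have hac : Continuous a := ha.1.continuous
  have hfc : Continuous f := by simp only [hf]; fun_prop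
  have key : ∫ x in b..c, Complex.exp (-Complex.I * t * L x) * L₁ x *
        (Complex.exp (Complex.I * (N * x : ℝ)) * a x) =
      (-Complex.I / t) * ∫ x in b..c, Complex.exp (Complex.I * (N * x - t * L x : ℝ)) * f x := by
    have hd (x : ℝ) : HasDerivAt (fun x => Complex.exp (-Complex.I * t * L x) *
        (Complex.exp (Complex.I * (N * x : ℝ)) * a x))
        ((-Complex.I * t) * (Complex.exp (-Complex.I * t * L x) * L₁ x *
        (Complex.exp (Complex.I * (N * x : ℝ)) * a x)) +
        Complex.exp (Complex.I * (N * x - t * L x : ℝ)) * f x) x := by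
      refine ((e2 x).mul ((e1 x).mul (hda x))).congr_deriv ?_
      have : Complex.exp (Complex.I * (N * x - t * L x : ℝ)) =
          Complex.exp (-Complex.I * t * L x) * Complex.exp (Complex.I * (N * x : ℝ)) := by
        rw [← Complex.exp_add]; congr 1; push_cast; ring
      rw [this]
      simp only [hf, Pi.mul_apply]
      ring
    have hi := intervalIntegral.integral_eq_sub_of_hasDerivAt (a := b) (b := c) (fun x _ => hd x)
      (Continuous.intervalIntegrable (by fun_prop) _ _)
    rw [hbc, hper, sub_self, intervalIntegral.integral_add
      (Continuous.intervalIntegrable (by fun_prop) _ _)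
      (Continuous.intervalIntegrable (by fun_prop) _ _),
      intervalIntegral.integral_const_mul] at hi
    have ht' : (t : ℂ) ≠ 0 := by exact_mod_cast ht0.ne'
    generalize ∫ x in b..c, Complex.exp (-Complex.I * t * L x) * L₁ x *
        (Complex.exp (Complex.I * (N * x : ℝ)) * a x) = Y at hi ⊢
    rw [eq_neg_of_add_eq_zero_right hi]
    field_simp
    linear_combination Y * Complex.I_sq
  rw [key, norm_mul, norm_div, norm_neg, Complex.norm_I, Complex.norm_real, Real.norm_eq_abs,
    abs_of_pos ht0]
  have hN' : ‖Complex.I * (N : ℂ)‖ ≤ 2 * μ := by simpa using hN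
  have hb := H t N μ κ (3 * B) f f₁ ht hκ hμ hN (by positivity)
    (fun x => ((hda x).const_mul _).add (hda1 x)) (by simp only [hf₁]; fun_prop)
    (fun x => by
      refine (norm_add_le _ _).trans ?_
      rw [norm_mul]
      calc _ ≤ 2 * μ * (B * κ) + B * κ * κ := by
            gcongr
            · exact b0 x
            · exact b1 x
        _ ≤ 2 * μ * (B * κ) + B * κ * μ := by gcongr
        _ = _ := by ring)
    (fun x => by
      refine (norm_add_le _ _).trans ?_
      rw [norm_mul]
      calc _ ≤ 2 * μ * (B * κ * κ) + B * κ * κ ^ 2 := by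
            gcongr
            · exact b1 x
            · exact b2 x
        _ ≤ 2 * μ * (B * κ * κ) + B * κ * (κ * μ) := by rw [pow_two]; gcongr
        _ = _ := by ring)
  calc _ ≤ 1 / t * (C * (3 * B) * (μ * κ * √(μ * κ) / √t)) := by gcongr
    _ = _ := by ring

end Oscillatory

section Branch

/-- The square of the spectral parameter as a function of the quasimomentum. -/
noncomputable def dispSq (m : ℝ) (ζ : ℂ) : ℂ := (m : ℂ) ^ 2 + 2 - 2 * Complex.cos ζ

/-- The branch `s * √(m² + 2 - 2 cos ζ)`, `s = ±1`, of the dispersion relation. -/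
noncomputable def branch (m s : ℝ) (ζ : ℂ) : ℂ := s * dispSq m ζ ^ (1 / 2 : ℂ)

noncomputable def realBranch (m s θ : ℝ) : ℝ := s * √(m ^ 2 + 2 - 2 * Real.cos θ)

theorem exists_strip_width {m : ℝ} (hm : 0 < m) :
    ∃ η : ℝ, 0 < η ∧ η ≤ 1 ∧ Real.cosh η < 1 + m ^ 2 / 2 := by
  have : ∀ᶠ η in 𝓝[>] (0 : ℝ), Real.cosh η < 1 + m ^ 2 / 2 := by
    refine Filter.Eventually.filter_mono nhdsWithin_le_nhds ?_
    refine Real.continuous_cosh.continuousAt.eventually (gt_mem_nhds ?_)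
    rw [Real.cosh_zero]; nlinarith
  have h1 : ∀ᶠ η in 𝓝[>] (0 : ℝ), η ≤ 1 :=
    Filter.Eventually.filter_mono nhdsWithin_le_nhds (Iic_mem_nhds zero_lt_one)
  obtain ⟨η, h2, h3, h4⟩ := (this.and (h1.and self_mem_nhdsWithin)).exists
  exact ⟨η, h4, h3, h2⟩

variable {m s η : ℝ}

theorem re_dispSq_pos (hη : Real.cosh η < 1 + m ^ 2 / 2) {ζ : ℂ} (hζ : ζ ∈ strip η) :
    0 < (dispSq m ζ).re := by
  have h1 : (Complex.cos ζ).re = Real.cos ζ.re * Real.cosh ζ.im := by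
    rw [Complex.cos_eq]
    simp [← Complex.ofReal_cos, ← Complex.ofReal_cosh, ← Complex.ofReal_sin, ← Complex.ofReal_sinh]
  have h2 : Real.cosh ζ.im ≤ Real.cosh η :=
    Real.cosh_le_cosh.mpr ((le_of_lt hζ).trans (le_abs_self η))
  have h3 : Real.cos ζ.re * Real.cosh ζ.im ≤ Real.cosh ζ.im :=
    mul_le_of_le_one_left (Real.cosh_pos _).le (Real.cos_le_one _)
  have e : (dispSq m ζ).re = m ^ 2 + 2 - 2 * (Complex.cos ζ).re := by
    simp [dispSq, ← Complex.ofReal_pow]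
  rw [e, h1]
  linarith

theorem branch_sq (hs : s ^ 2 = 1) (ζ : ℂ) : branch m s ζ ^ 2 = dispSq m ζ := by
  have : (s : ℂ) ^ 2 = 1 := by exact_mod_cast hs
  rw [branch, mul_pow, this, one_mul, ← Complex.cpow_nat_mul]
  norm_num

theorem branch_ne_zero (hs : s ^ 2 = 1) (hη : Real.cosh η < 1 + m ^ 2 / 2) {ζ : ℂ}
    (hζ : ζ ∈ strip η) : branch m s ζ ≠ 0 := fun h => by
  have h1 := branch_sq (m := m) hs ζ
  have h2 := re_dispSq_pos hη hζ
  rw [← h1, h] at h2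
  simp at h2

theorem hasDerivAt_branch (hs : s ^ 2 = 1) (hη : Real.cosh η < 1 + m ^ 2 / 2) {ζ : ℂ}
    (hζ : ζ ∈ strip η) : HasDerivAt (branch m s) (Complex.sin ζ / branch m s ζ) ζ := by
  have hd : HasDerivAt (dispSq m) (2 * Complex.sin ζ) ζ := by
    have := ((Complex.hasDerivAt_cos ζ).const_mul 2).const_sub ((m : ℂ) ^ 2 + 2)
    exact this.congr_deriv (by ring)
  have hslit : dispSq m ζ ∈ Complex.slitPlane := Or.inl (re_dispSq_pos hη hζ)
  have := (hd.cpow_const (c := 1 / 2) hslit).const_mul (s : ℂ)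
  refine this.congr_deriv ?_
  have h0 : dispSq m ζ ≠ 0 := Complex.slitPlane_ne_zero hslit
  have h1 := branch_sq (m := m) hs ζ
  have h2 := branch_ne_zero hs hη hζ
  rw [eq_div_iff h2, Complex.cpow_sub _ _ h0, Complex.cpow_one]
  rw [branch] at h1 ⊢
  field_simp
  linear_combination Complex.sin ζ * h1

theorem branch_differentiableOn (hs : s ^ 2 = 1) (hη : Real.cosh η < 1 + m ^ 2 / 2) :
    DifferentiableOn ℂ (branch m s) (strip η) := fun _ hζ =>
  (hasDerivAt_branch hs hη hζ).differentiableAt.differentiableWithinAt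

theorem norm_exp_I_le {ζ : ℂ} (hζ : ζ ∈ strip η) (hη : η ≤ 1) :
    ‖Complex.exp (Complex.I * ζ)‖ ≤ Real.exp 1 := by
  rw [Complex.norm_exp]
  refine Real.exp_le_exp.mpr ?_
  have : |ζ.im| < η := hζ
  simp only [Complex.mul_re, Complex.I_re, Complex.I_im]
  linarith [neg_abs_le ζ.im]

theorem norm_exp_neg_I_le {ζ : ℂ} (hζ : ζ ∈ strip η) (hη : η ≤ 1) :
    ‖Complex.exp (-(Complex.I * ζ))‖ ≤ Real.exp 1 := by
  have := norm_exp_I_le (ζ := -ζ) (η := η) (by simpa [strip] using hζ) hη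
  rwa [mul_neg] at this

theorem two_cos_eq (ζ : ℂ) :
    2 * Complex.cos ζ = Complex.exp (Complex.I * ζ) + Complex.exp (-(Complex.I * ζ)) := by
  rw [Complex.two_cos]
  ring_nf

theorem exists_norm_branch_le (m : ℝ) : ∃ Λ : ℝ, 0 ≤ Λ ∧ ∀ s η : ℝ, s ^ 2 = 1 → η ≤ 1 →
    ∀ ζ ∈ strip η, ‖branch m s ζ‖ ≤ Λ := by
  refine ⟨√(m ^ 2 + 2 + (Real.exp 1 + Real.exp 1)), by positivity, fun s η hs hη ζ hζ => ?_⟩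
  refine Real.le_sqrt_of_sq_le ?_
  rw [← norm_pow, branch_sq hs, dispSq, two_cos_eq]
  refine (norm_sub_le _ _).trans (add_le_add ((norm_add_le _ _).trans (by simp)) ?_)
  exact (norm_add_le _ _).trans (add_le_add (norm_exp_I_le hζ hη) (norm_exp_neg_I_le hζ hη))

theorem radicand_pos (hm : 0 < m) (θ : ℝ) : 0 < m ^ 2 + 2 - 2 * Real.cos θ := by
  have := Real.cos_le_one θ
  nlinarith

theorem branch_ofReal (hm : 0 < m) (s θ : ℝ) : branch m s θ = realBranch m s θ := by
  have e : dispSq m θ = ((m ^ 2 + 2 - 2 * Real.cos θ : ℝ) : ℂ) := by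
    simp [dispSq]
  rw [branch, realBranch, e, Real.sqrt_eq_rpow, Complex.ofReal_mul,
    Complex.ofReal_cpow (radicand_pos hm θ).le]
  norm_num

theorem branch_add_two_pi (m s : ℝ) (ζ : ℂ) : branch m s (ζ + 2 * Real.pi) = branch m s ζ := by
  rw [branch, branch, dispSq, dispSq, Complex.cos_add_two_pi]

theorem realBranch_sq (hm : 0 < m) (hs : s ^ 2 = 1) (θ : ℝ) :
    realBranch m s θ ^ 2 = m ^ 2 + 2 - 2 * Real.cos θ := by
  rw [realBranch, mul_pow, hs, one_mul, Real.sq_sqrt (radicand_pos hm θ).le]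

theorem realBranch_ne_zero (hm : 0 < m) (hs : s ^ 2 = 1) (θ : ℝ) : realBranch m s θ ≠ 0 := by
  intro h
  have := realBranch_sq hm hs θ
  rw [h] at this
  linarith [radicand_pos hm θ]

theorem hasDerivAt_realBranch (hm : 0 < m) (hs : s ^ 2 = 1) (θ : ℝ) :
    HasDerivAt (realBranch m s) (Real.sin θ / realBranch m s θ) θ := by
  have h0 := radicand_pos hm θ
  have hd : HasDerivAt (fun θ => m ^ 2 + 2 - 2 * Real.cos θ) (2 * Real.sin θ) θ := by
    have := ((Real.hasDerivAt_cos θ).const_mul 2).const_sub (m ^ 2 + 2)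
    exact this.congr_deriv (by ring)
  have := (hd.sqrt h0.ne').const_mul s
  refine this.congr_deriv ?_
  have h2 := realBranch_ne_zero hm hs θ
  have h3 : √(m ^ 2 + 2 - 2 * Real.cos θ) ≠ 0 := (Real.sqrt_pos.mpr h0).ne'
  rw [eq_div_iff h2, realBranch]
  field_simp
  linear_combination Real.sin θ * hs

theorem exists_oscillatory_bound (hm : 0 < m) (hs : s ^ 2 = 1) :
    ∃ C, 0 ≤ C ∧ ∀ (t N μ κ B : ℝ) (a : ℝ → ℂ), 1 ≤ t → 1 ≤ κ → κ ≤ μ → |N| ≤ 2 * μ → 0 ≤ B →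
      C2Bound a (B * κ) κ →
      Complex.exp (Complex.I * (N * (0 : ℝ) : ℝ)) * a 0 =
        Complex.exp (Complex.I * (N * (2 * Real.pi) : ℝ)) * a (2 * Real.pi) →
      ‖∫ x in (0 : ℝ)..2 * Real.pi, Complex.exp (-Complex.I * t * realBranch m s x) *
        (Real.sin x / realBranch m s x : ℝ) * (Complex.exp (Complex.I * (N * x : ℝ)) * a x)‖ ≤
        C * B * ((μ * κ) * √(μ * κ) / √t / t) := by
  have hne := realBranch_ne_zero hm hs
  have hc : Continuous (realBranch m s) :=
    continuous_iff_continuousAt.mpr fun x => (hasDerivAt_realBranch hm hs x).continuousAt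
  have hL₁ (x : ℝ) : HasDerivAt (fun θ => Real.sin θ / realBranch m s θ)
      ((Real.cos x * realBranch m s x - Real.sin x * (Real.sin x / realBranch m s x)) /
        realBranch m s x ^ 2) x :=
    (Real.hasDerivAt_sin x).div (hasDerivAt_realBranch hm hs x) (hne x)
  refine DecaysOn.norm_integral_deriv_mul_le (hasDerivAt_realBranch hm hs)
    (Real.continuous_sin.div hc hne) ?_ (by simp [realBranch])
  refine decaysOn_of_nondegenerate (hasDerivAt_realBranch hm hs) hL₁
    (Continuous.div ?_ (by fun_prop) fun x => pow_ne_zero 2 (hne x)) (fun x => ?_)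
    Real.two_pi_pos.le
  · have := Real.continuous_sin.div hc hne
    fun_prop
  · by_cases hx : Real.sin x = 0
    · right
      have h1 : Real.cos x ≠ 0 := fun h => by
        have := Real.sin_sq_add_cos_sq x
        rw [hx, h] at this
        norm_num at this
      rw [hx]
      simp [h1, hne x]
    · exact Or.inl (div_ne_zero hx (hne x))

end Branch

section

attribute [local instance] Matrix.linftyOpNormedRing Matrix.linftyOpNormedAlgebra

/-- Complex `2 × 2` matrices with the maximal row sum norm. -/
def Mat2 : Type := Matrix (Fin 2) (Fin 2) ℂ

namespace Mat2

noncomputable instance : NormedRing Mat2 :=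
  inferInstanceAs (NormedRing (Matrix (Fin 2) (Fin 2) ℂ))

noncomputable instance : NormedAlgebra ℂ Mat2 :=
  inferInstanceAs (NormedAlgebra ℂ (Matrix (Fin 2) (Fin 2) ℂ))

def entry (M : Mat2) (i j : Fin 2) : ℂ := (show Matrix (Fin 2) (Fin 2) ℂ from M) i j

def mk (a b c d : ℂ) : Mat2 := (!![a, b; c, d] : Matrix (Fin 2) (Fin 2) ℂ)

@[ext] theorem ext {M N : Mat2} (h : ∀ i j, M.entry i j = N.entry i j) : M = N :=
  Matrix.ext h

@[simp] theorem mk_00 (a b c d : ℂ) : (mk a b c d).entry 0 0 = a := rfl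
@[simp] theorem mk_01 (a b c d : ℂ) : (mk a b c d).entry 0 1 = b := rfl
@[simp] theorem mk_10 (a b c d : ℂ) : (mk a b c d).entry 1 0 = c := rfl
@[simp] theorem mk_11 (a b c d : ℂ) : (mk a b c d).entry 1 1 = d := rfl

@[simp] theorem add_entry (M N : Mat2) (i j : Fin 2) :
    (M + N).entry i j = M.entry i j + N.entry i j := rfl
@[simp] theorem sub_entry (M N : Mat2) (i j : Fin 2) :
    (M - N).entry i j = M.entry i j - N.entry i j := rfl
@[simp] theorem smul_entry (z : ℂ) (M : Mat2) (i j : Fin 2) :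
    (z • M).entry i j = z * M.entry i j := rfl
@[simp] theorem one_entry (i j : Fin 2) : (1 : Mat2).entry i j = if i = j then 1 else 0 := rfl
@[simp] theorem mul_entry (M N : Mat2) (i j : Fin 2) :
    (M * N).entry i j = M.entry i 0 * N.entry 0 j + M.entry i 1 * N.entry 1 j := by
  have := Matrix.mul_apply (M := (show Matrix (Fin 2) (Fin 2) ℂ from M)) (N := N) (i := i) (k := j)
  rw [Fin.sum_univ_two] at this
  exact this

theorem norm_le {M : Mat2} {c : ℝ} (h : ∀ i j, ‖M.entry i j‖ ≤ c) : ‖M‖ ≤ 2 * c := by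
  have hc : 0 ≤ c := (norm_nonneg _).trans (h 0 0)
  refine (Matrix.linfty_opNorm_def (show Matrix (Fin 2) (Fin 2) ℂ from M)).le.trans ?_
  lift c to NNReal using hc
  have : (Finset.univ : Finset (Fin 2)).sup
      (fun i => ∑ j, ‖(show Matrix (Fin 2) (Fin 2) ℂ from M) i j‖₊) ≤ 2 * c := by
    refine Finset.sup_le fun i _ => ?_
    rw [Fin.sum_univ_two, two_mul]
    exact add_le_add (by exact_mod_cast h i 0) (by exact_mod_cast h i 1)
  exact_mod_cast this

theorem norm_entry_le (M : Mat2) (i j : Fin 2) : ‖M.entry i j‖ ≤ ‖M‖ := by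
  refine le_trans ?_ (Matrix.linfty_opNorm_def (show Matrix (Fin 2) (Fin 2) ℂ from M)).ge
  have h1 : ‖M.entry i j‖₊ ≤ ∑ j, ‖(show Matrix (Fin 2) (Fin 2) ℂ from M) i j‖₊ :=
    Finset.single_le_sum (f := fun j => ‖(show Matrix (Fin 2) (Fin 2) ℂ from M) i j‖₊)
      (fun _ _ => zero_le) (Finset.mem_univ j)
  have h2 := Finset.le_sup
    (f := fun i => ∑ j, ‖(show Matrix (Fin 2) (Fin 2) ℂ from M) i j‖₊) (Finset.mem_univ i)
  exact_mod_cast h1.trans h2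

noncomputable instance : NormOneClass Mat2 where
  norm_one := by
    refine le_antisymm ?_ ?_
    · refine (Matrix.linfty_opNorm_def (1 : Matrix (Fin 2) (Fin 2) ℂ)).le.trans ?_
      have : (Finset.univ : Finset (Fin 2)).sup
          (fun i => ∑ j, ‖(1 : Matrix (Fin 2) (Fin 2) ℂ) i j‖₊) ≤ 1 := by
        refine Finset.sup_le fun i _ => ?_
        rw [Fin.sum_univ_two]
        fin_cases i <;> simp [Matrix.one_apply]
      exact_mod_cast this
    · simpa using norm_entry_le 1 0 0

instance : FiniteDimensional ℂ Mat2 :=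
  inferInstanceAs (FiniteDimensional ℂ (Matrix (Fin 2) (Fin 2) ℂ))

instance : CompleteSpace Mat2 := FiniteDimensional.complete ℂ _

/-- An entry of a matrix as a continuous linear functional. -/
noncomputable def entryCLM (i j : Fin 2) : Mat2 →L[ℂ] ℂ :=
  LinearMap.mkContinuous
    { toFun := fun M => M.entry i j, map_add' := fun _ _ => rfl, map_smul' := fun _ _ => rfl } 1
    fun M => by rw [one_mul]; exact norm_entry_le M i j

theorem norm_entryCLM_le (i j : Fin 2) : ‖entryCLM i j‖ ≤ 1 :=
  LinearMap.mkContinuous_norm_le _ zero_le_one _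

theorem differentiableOn {M : ℂ → Mat2} {S : Set ℂ}
    (h : ∀ i j, DifferentiableOn ℂ (fun ζ => (M ζ).entry i j) S) : DifferentiableOn ℂ M S := by
  have e : M = fun ζ => (M ζ).entry 0 0 • mk 1 0 0 0 + (M ζ).entry 0 1 • mk 0 1 0 0 +
      ((M ζ).entry 1 0 • mk 0 0 1 0 + (M ζ).entry 1 1 • mk 0 0 0 1) := by
    funext ζ
    ext i j
    fin_cases i <;> fin_cases j <;> simp
  rw [e]
  exact ((((h 0 0).smul_const _).add ((h 0 1).smul_const _))).add
    (((h 1 0).smul_const _).add ((h 1 1).smul_const _))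

end Mat2

end

/-- The difference equations `D w = lam w`, solved for the neighbouring values. -/
def IsSol (m : ℝ) (Q : ℤ → Matrix (Fin 2) (Fin 2) ℝ) (lam : ℂ) (w : ℤ → Spinor) : Prop :=
  ∀ n, w (n + 1) 1 = (1 + (Q n 1 0 : ℂ)) * w n 1 + (m + Q n 0 0 - lam) * w n 0 ∧
    w (n - 1) 0 = (1 + (Q n 1 0 : ℂ)) * w n 0 + (-m + Q n 1 1 - lam) * w n 1

theorem diracExpr_eq_smul_iff {m : ℝ} {Q : ℤ → Matrix (Fin 2) (Fin 2) ℝ}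
    (hsymm : ∀ n, Q n 0 1 = Q n 1 0) (lam : ℂ) (w : ℤ → Spinor) :
    diracExpr m Q w = lam • w ↔ IsSol m Q lam w := by
  constructor
  · intro h n
    have h0 := congrArg (fun f : ℤ → Spinor => f n 0) h
    have h1 := congrArg (fun f : ℤ → Spinor => f n 1) h
    simp only [diracExpr, LinearMap.coe_mk, AddHom.coe_mk, hsymm, Pi.smul_apply,
      PiLp.smul_apply, smul_eq_mul, PiLp.toLp_apply, Matrix.cons_val_zero,
      Matrix.cons_val_one] at h0 h1
    exact ⟨by linear_combination -h0, by linear_combination -h1⟩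
  · intro h
    funext n
    obtain ⟨h0, h1⟩ := h n
    ext i
    fin_cases i
    · simp [diracExpr, hsymm]
      linear_combination -h0
    · simp [diracExpr]
      linear_combination -h1

/-- Data of the spectral problem on one branch of the dispersion relation. -/
structure DiracData where
  m : ℝ
  s : ℝ
  η : ℝ
  Q : ℤ → Matrix (Fin 2) (Fin 2) ℝ
  m_pos : 0 < m
  s_sq : s ^ 2 = 1
  η_pos : 0 < η
  η_le : η ≤ 1
  cosh_lt : Real.cosh η < 1 + m ^ 2 / 2
  symm : ∀ n, Q n 0 1 = Q n 1 0
  ne : ∀ n, Q n 1 0 ≠ -1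
  summable : ∀ i j, Summable fun n : ℤ => (1 + |(n : ℝ)|) ^ 3 * |Q n i j|

namespace DiracData

variable (D : DiracData)

noncomputable def lam (ζ : ℂ) : ℂ := branch D.m D.s ζ

noncomputable def size (n : ℤ) : ℝ := |D.Q n 0 0| + |D.Q n 1 0| + |D.Q n 1 1|

noncomputable def al (n : ℤ) : ℂ := (1 + (D.Q n 1 0 : ℂ))⁻¹

/-- The transfer matrix `(u (n - 1), v n) ↦ (u n, v (n + 1))`. -/
noncomputable def fwd (n : ℤ) (l : ℂ) : Mat2 :=
  .mk (D.al n) (D.al n * (l + D.m - D.Q n 1 1)) ((D.m + D.Q n 0 0 - l) * D.al n)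
    (1 + D.Q n 1 0 + (D.m + D.Q n 0 0 - l) * D.al n * (l + D.m - D.Q n 1 1))

/-- The inverse of the transfer matrix. -/
noncomputable def bwd (n : ℤ) (l : ℂ) : Mat2 :=
  .mk (1 + D.Q n 1 0 + (D.m + D.Q n 0 0 - l) * D.al n * (l + D.m - D.Q n 1 1))
    (-(D.al n * (l + D.m - D.Q n 1 1))) (-((D.m + D.Q n 0 0 - l) * D.al n)) (D.al n)

noncomputable def fwdFree (l : ℂ) : Mat2 :=
  .mk 1 (l + D.m) (D.m - l) (1 + (D.m - l) * (l + D.m))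

noncomputable def bwdFree (l : ℂ) : Mat2 :=
  .mk (1 + (D.m - l) * (l + D.m)) (-(l + D.m)) (-(D.m - l)) 1

/-- The eigenvector of the free transfer matrix for the multiplier `w`, as a first column. -/
noncomputable def freeVec (l w : ℂ) : Mat2 := 
  .mk (l + D.m + 1 - w⁻¹) 0 (w - 1 + D.m - l) 0

theorem al_mul (n : ℤ) : D.al n * (1 + D.Q n 1 0) = 1 := by
  refine inv_mul_cancel₀ fun h => D.ne n ?_
  have : (1 + D.Q n 1 0 : ℝ) = 0 := by exact_mod_cast h
  linarith

theorem abs_le_size (n : ℤ) :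
    |D.Q n 0 0| ≤ D.size n ∧ |D.Q n 1 0| ≤ D.size n ∧ |D.Q n 1 1| ≤ D.size n := by
  unfold size
  have h0 := abs_nonneg (D.Q n 0 0)
  have h1 := abs_nonneg (D.Q n 1 0)
  have h2 := abs_nonneg (D.Q n 1 1)
  refine ⟨?_, ?_, ?_⟩ <;> linarith

theorem summable_size : Summable fun n : ℤ => (1 + |(n : ℝ)|) ^ 3 * D.size n := by
  refine (((D.summable 0 0).add (D.summable 1 0)).add (D.summable 1 1)).congr fun n => ?_
  rw [size]; ring

theorem size_nonneg (n : ℤ) : 0 ≤ D.size n := by unfold size; positivity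

theorem size_le_weighted (n : ℤ) : D.size n ≤ (1 + |(n : ℝ)|) ^ 3 * D.size n :=
  le_mul_of_one_le_left (D.size_nonneg n)
    (one_le_pow₀ (by linarith [abs_nonneg (n : ℝ)]))

theorem summable_size' : Summable D.size :=
  .of_nonneg_of_le D.size_nonneg D.size_le_weighted D.summable_size

theorem exists_norm_al_le : ∃ a : ℝ, 1 ≤ a ∧ ∀ n, ‖D.al n‖ ≤ a := by
  have h0 : Tendsto D.size cofinite (𝓝 0) := D.summable_size'.tendsto_cofinite_zero
  have h1 : ∀ᶠ n in cofinite, D.size n < 1 / 2 := h0.eventually (gt_mem_nhds (by norm_num))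
  have hfin : {n | ¬ D.size n < 1 / 2}.Finite := h1
  refine ⟨2 + ∑ n ∈ hfin.toFinset, ‖D.al n‖, ?_, fun n => ?_⟩
  · have : 0 ≤ ∑ n ∈ hfin.toFinset, ‖D.al n‖ := by positivity
    linarith
  · by_cases hn : D.size n < 1 / 2
    · have h2 : ‖D.al n‖ ≤ 2 := by
        rw [al, norm_inv]
        refine inv_le_of_inv_le₀ (by norm_num) ?_
        have : ‖(1 : ℂ)‖ - ‖-(D.Q n 1 0 : ℂ)‖ ≤ ‖(1 : ℂ) - -(D.Q n 1 0 : ℂ)‖ :=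
          norm_sub_norm_le _ _
        rw [sub_neg_eq_add, norm_neg, norm_one, Complex.norm_real, Real.norm_eq_abs] at this
        have := (D.abs_le_size n).2.1
        linarith
      have : 0 ≤ ∑ n ∈ hfin.toFinset, ‖D.al n‖ := by positivity
      linarith
    · have := Finset.single_le_sum (f := fun n => ‖D.al n‖) (fun _ _ => norm_nonneg _)
        (hfin.mem_toFinset.mpr hn)
      linarith

/-- The entries of the perturbation of the transfer matrices are controlled by the potential. -/
theorem exists_perturbation_le (B : ℝ) (hB : 0 ≤ B) : ∃ K : ℝ, 0 ≤ K ∧ ∀ n, ∀ l : ℂ,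
    ‖l + D.m‖ ≤ B → ‖(D.m : ℂ) - l‖ ≤ B → ∀ i j,
      ‖(D.fwd n l - D.fwdFree l).entry i j‖ ≤ K * D.size n ∧
      ‖(D.bwd n l - D.bwdFree l).entry i j‖ ≤ K * D.size n := by
  obtain ⟨a, ha1, ha⟩ := D.exists_norm_al_le
  set C₀ : ℝ := ∑' n, D.size n with hC₀
  have hC₀le (n : ℤ) : D.size n ≤ C₀ :=
    D.summable_size'.le_tsum n fun _ _ => D.size_nonneg _
  have hC₀0 : 0 ≤ C₀ := (D.size_nonneg 0).trans (hC₀le 0)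
  refine ⟨1 + a * (B + 1) + B * (a * (B + 1)) + a * (B + C₀), by positivity, ?_⟩
  intro n l hβ hγ i j
  obtain ⟨hp, hq, hc⟩ := D.abs_le_size n
  have hs := D.size_nonneg n
  have hal := ha n
  have hα : ‖D.al n - 1‖ ≤ a * D.size n := by
    have : D.al n - 1 = -(D.al n * D.Q n 1 0) := by linear_combination D.al_mul n
    rw [this, norm_neg, norm_mul, Complex.norm_real, Real.norm_eq_abs]
    gcongr
  have hαβ : ‖D.al n * (l + D.m - D.Q n 1 1) - (l + D.m)‖ ≤ a * (B + 1) * D.size n := by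
    have : D.al n * (l + D.m - D.Q n 1 1) - (l + D.m) =
      (D.al n - 1) * (l + D.m) - D.al n * D.Q n 1 1 := by ring
    rw [this]
    refine (norm_sub_le _ _).trans ?_
    rw [norm_mul, norm_mul, Complex.norm_real, Real.norm_eq_abs]
    calc _ ≤ (a * D.size n) * B + a * D.size n := by gcongr
      _ = _ := by ring
  have hγα : ‖(D.m + D.Q n 0 0 - l) * D.al n - (D.m - l)‖ ≤ a * (B + 1) * D.size n := by
    have : (D.m + D.Q n 0 0 - l) * D.al n - (D.m - l) =
      (D.al n - 1) * (D.m - l) + D.al n * D.Q n 0 0 := by ring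
    rw [this]
    refine (norm_add_le _ _).trans ?_
    rw [norm_mul, norm_mul, Complex.norm_real, Real.norm_eq_abs]
    calc _ ≤ (a * D.size n) * B + a * D.size n := by gcongr
      _ = _ := by ring
  have hγαβ : ‖1 + D.Q n 1 0 + (D.m + D.Q n 0 0 - l) * D.al n * (l + D.m - D.Q n 1 1) -
      (1 + (D.m - l) * (l + D.m))‖ ≤
      (1 + B * (a * (B + 1)) + a * (B + C₀)) * D.size n := by
    have : 1 + D.Q n 1 0 + (D.m + D.Q n 0 0 - l) * D.al n * (l + D.m - D.Q n 1 1) -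
      (1 + (D.m - l) * (l + D.m)) =
      D.Q n 1 0 + (D.m - l) * (D.al n * (l + D.m - D.Q n 1 1) - (l + D.m)) +
        D.Q n 0 0 * (D.al n * (l + D.m - D.Q n 1 1)) := by ring
    rw [this]
    refine (norm_add₃_le).trans ?_
    simp only [norm_mul, Complex.norm_real, Real.norm_eq_abs]
    have hβ' : ‖l + D.m - D.Q n 1 1‖ ≤ B + C₀ := by
      refine (norm_sub_le _ _).trans (add_le_add hβ ?_)
      rw [Complex.norm_real, Real.norm_eq_abs]
      exact hc.trans (hC₀le n)
    calc _ ≤ D.size n + B * (a * (B + 1) * D.size n) + D.size n * (a * (B + C₀)) := by gcongr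
      _ = _ := by ring
  have b1 : a * D.size n ≤
      (1 + a * (B + 1) + B * (a * (B + 1)) + a * (B + C₀)) * D.size n := by
    gcongr
    have : 0 ≤ a * B := by positivity
    have : 0 ≤ B * (a * (B + 1)) + a * (B + C₀) := by positivity
    nlinarith
  have b2 : a * (B + 1) * D.size n ≤
      (1 + a * (B + 1) + B * (a * (B + 1)) + a * (B + C₀)) * D.size n := by
    gcongr
    have : 0 ≤ B * (a * (B + 1)) + a * (B + C₀) := by positivity
    linarith
  have b3 : (1 + B * (a * (B + 1)) + a * (B + C₀)) * D.size n ≤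
      (1 + a * (B + 1) + B * (a * (B + 1)) + a * (B + C₀)) * D.size n := by
    gcongr
    have : 0 ≤ a * (B + 1) := by positivity
    linarith
  fin_cases i <;> fin_cases j <;> simp only [fwd, fwdFree, bwd, bwdFree, Mat2.sub_entry,
    Mat2.mk_00, Mat2.mk_01, Mat2.mk_10, Mat2.mk_11, Fin.zero_eta, Fin.mk_one, neg_sub_neg]
  · exact ⟨hα.trans b1, hγαβ.trans b3⟩
  · exact ⟨hαβ.trans b2, by rw [norm_sub_rev]; exact hαβ.trans b2⟩
  · exact ⟨hγα.trans b2, by rw [norm_sub_rev]; exact hγα.trans b2⟩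
  · exact ⟨hγαβ.trans b3, hα.trans b1⟩

/-- A common bound for the coefficients of the transfer matrices in the strip. -/
theorem exists_coeff_bound : ∃ B : ℝ, 0 ≤ B ∧ ∀ ζ ∈ strip D.η,
    ‖D.lam ζ + D.m‖ ≤ B ∧ ‖(D.m : ℂ) - D.lam ζ‖ ≤ B := by
  obtain ⟨Λ, h0, hΛ⟩ := exists_norm_branch_le D.m
  have hm := D.m_pos
  refine ⟨Λ + D.m, by positivity, fun ζ hζ => ?_⟩
  have h1 : ‖D.lam ζ‖ ≤ Λ := hΛ D.s D.η D.s_sq D.η_le ζ hζ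
  have h2 : ‖(D.m : ℂ)‖ = D.m := by rw [Complex.norm_real, Real.norm_eq_abs, abs_of_pos hm]
  refine ⟨(norm_add_le _ _).trans ?_, (norm_sub_le _ _).trans ?_⟩ <;> rw [h2] <;> linarith

noncomputable def multR (l w : ℂ) : Mat2 := w • D.bwdFree l

noncomputable def multL (l w : ℂ) : Mat2 := w • D.fwdFree l

noncomputable def pertR (n : ℤ) (l w : ℂ) : Mat2 := w • (D.bwd n l - D.bwdFree l)

noncomputable def pertL (k : ℤ) (l w : ℂ) : Mat2 := w • (D.fwd (-k - 1) l - D.fwdFree l)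

theorem lam_diff : DifferentiableOn ℂ D.lam (strip D.η) :=
  branch_differentiableOn D.s_sq D.cosh_lt

theorem lam_sq (ζ : ℂ) : D.lam ζ ^ 2 =
    D.m ^ 2 + 2 - (Complex.exp (Complex.I * ζ) + (Complex.exp (Complex.I * ζ))⁻¹) := by
  rw [lam, branch_sq D.s_sq, dispSq, two_cos_eq, Complex.exp_neg]

theorem mult_quad {l w : ℂ} (hw : w ≠ 0) (h : l ^ 2 = D.m ^ 2 + 2 - (w + w⁻¹)) :
    D.multR l w * D.multR l w = (1 + w ^ 2) • D.multR l w - w ^ 2 • 1 ∧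
    D.multL l w * D.multL l w = (1 + w ^ 2) • D.multL l w - w ^ 2 • 1 := by
  have hw' : w * w⁻¹ = 1 := mul_inv_cancel₀ hw
  have h2 : w * (D.m ^ 2 - l ^ 2 + 2) = w ^ 2 + 1 := by rw [h]; linear_combination hw'
  constructor <;> ext i j <;> fin_cases i <;> fin_cases j <;>
    simp [multR, multL, bwdFree, fwdFree]
  · linear_combination (w * (1 + (D.m - l) * (l + D.m))) * h2
  · linear_combination (-w * (l + D.m)) * h2
  · linear_combination (w * (l - D.m)) * h2
  · linear_combination w * h2
  · linear_combination w * h2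
  · linear_combination (w * (l + D.m)) * h2
  · linear_combination (w * (D.m - l)) * h2
  · linear_combination (w * (1 + (D.m - l) * (l + D.m))) * h2

theorem mult_mul_freeVec {l w : ℂ} (hw : w ≠ 0) (h : l ^ 2 = D.m ^ 2 + 2 - (w + w⁻¹)) :
    D.multR l w * D.freeVec l w = D.freeVec l w ∧
    D.multL l w * D.freeVec l w⁻¹ = D.freeVec l w⁻¹ := by
  have hw' : w * w⁻¹ = 1 := mul_inv_cancel₀ hw
  constructor <;> ext i j <;> fin_cases i <;> fin_cases j <;>
    simp [multR, multL, bwdFree, fwdFree, freeVec]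
  all_goals generalize w⁻¹ = v at *
  all_goals grind

end DiracData

namespace DiracData

variable (D : DiracData)

noncomputable def coeffBound : ℝ := D.exists_coeff_bound.choose

theorem coeffBound_nonneg : 0 ≤ D.coeffBound := D.exists_coeff_bound.choose_spec.1

theorem coeffBound_spec {ζ : ℂ} (hζ : ζ ∈ strip D.η) :
    ‖D.lam ζ + D.m‖ ≤ D.coeffBound ∧ ‖(D.m : ℂ) - D.lam ζ‖ ≤ D.coeffBound :=
  D.exists_coeff_bound.choose_spec.2 ζ hζ

noncomputable def pertBound : ℝ :=
  (D.exists_perturbation_le D.coeffBound D.coeffBound_nonneg).choose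

theorem norm_pert_le {ζ w : ℂ} (hζ : ζ ∈ strip D.η) (hw : ‖w‖ ≤ Real.exp 1) (n : ℤ) :
    ‖D.pertR n (D.lam ζ) w‖ ≤ 2 * (Real.exp 1 * (D.pertBound * D.size n)) ∧
    ‖D.pertL n (D.lam ζ) w‖ ≤ 2 * (Real.exp 1 * (D.pertBound * D.size (-n - 1))) := by
  have h := (D.exists_perturbation_le D.coeffBound D.coeffBound_nonneg).choose_spec.2
  obtain ⟨h1, h2⟩ := D.coeffBound_spec hζ
  constructor
  · refine Mat2.norm_le fun i j => ?_
    rw [pertR, Mat2.smul_entry, norm_mul]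
    exact mul_le_mul hw (h n _ h1 h2 i j).2 (norm_nonneg _) (Real.exp_pos _).le
  · refine Mat2.norm_le fun i j => ?_
    rw [pertL, Mat2.smul_entry, norm_mul]
    exact mul_le_mul hw (h _ _ h1 h2 i j).1 (norm_nonneg _) (Real.exp_pos _).le

noncomputable def jostBound : ℝ :=
  2 * (Real.exp 1 * (1 + D.coeffBound + D.coeffBound * D.coeffBound)) +
    2 * (D.coeffBound + 1 + Real.exp 1)

theorem norm_mult_le {ζ w : ℂ} (hζ : ζ ∈ strip D.η) (hw : ‖w‖ ≤ Real.exp 1) :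
    ‖D.multR (D.lam ζ) w‖ ≤ D.jostBound ∧ ‖D.multL (D.lam ζ) w‖ ≤ D.jostBound := by
  obtain ⟨h1, h2⟩ := D.coeffBound_spec hζ
  have hB := D.coeffBound_nonneg
  have hBB : 0 ≤ D.coeffBound * D.coeffBound := mul_nonneg hB hB
  have he := Real.exp_pos 1
  have hle : 2 * (Real.exp 1 * (1 + D.coeffBound + D.coeffBound * D.coeffBound)) ≤ D.jostBound :=
    le_add_of_nonneg_right (by positivity)
  have h3 : ‖1 + ((D.m : ℂ) - D.lam ζ) * (D.lam ζ + D.m)‖ ≤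
      1 + D.coeffBound + D.coeffBound * D.coeffBound := by
    refine (norm_add_le _ _).trans ?_
    rw [norm_one, norm_mul]
    have : ‖(D.m : ℂ) - D.lam ζ‖ * ‖D.lam ζ + D.m‖ ≤ D.coeffBound * D.coeffBound := by gcongr
    linarith
  have h4 : (1 : ℝ) ≤ 1 + D.coeffBound + D.coeffBound * D.coeffBound := by linarith
  have h5 := h1.trans (show D.coeffBound ≤ 1 + D.coeffBound + D.coeffBound * D.coeffBound by linarith)
  have h6 := h2.trans (show D.coeffBound ≤ 1 + D.coeffBound + D.coeffBound * D.coeffBound by linarith)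
  constructor <;> refine (Mat2.norm_le fun i j => ?_).trans hle
  · rw [multR, Mat2.smul_entry, norm_mul]
    refine mul_le_mul hw ?_ (norm_nonneg _) he.le
    fin_cases i <;> fin_cases j <;>
      simp only [bwdFree, Fin.zero_eta, Fin.mk_one, Mat2.mk_00, Mat2.mk_01, Mat2.mk_10,
        Mat2.mk_11, norm_neg, norm_one] <;> assumption
  · rw [multL, Mat2.smul_entry, norm_mul]
    refine mul_le_mul hw ?_ (norm_nonneg _) he.le
    fin_cases i <;> fin_cases j <;>
      simp only [fwdFree, Fin.zero_eta, Fin.mk_one, Mat2.mk_00, Mat2.mk_01, Mat2.mk_10,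
        Mat2.mk_11, norm_one] <;> assumption

theorem norm_freeVec_le {ζ w : ℂ} (hζ : ζ ∈ strip D.η) (hw : ‖w‖ ≤ Real.exp 1)
    (hw' : ‖w⁻¹‖ ≤ Real.exp 1) : ‖D.freeVec (D.lam ζ) w‖ ≤ D.jostBound := by
  obtain ⟨h1, h2⟩ := D.coeffBound_spec hζ
  have hB := D.coeffBound_nonneg
  have he := Real.exp_pos 1
  have hle : 2 * (D.coeffBound + 1 + Real.exp 1) ≤ D.jostBound :=
    le_add_of_nonneg_left (by have := mul_nonneg hB hB; positivity)
  refine (Mat2.norm_le fun i j => ?_).trans hle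
  fin_cases i <;> fin_cases j <;>
    simp only [freeVec, Fin.zero_eta, Fin.mk_one, Mat2.mk_00, Mat2.mk_01, Mat2.mk_10, Mat2.mk_11,
      norm_zero]
  · refine (norm_sub_le _ _).trans (add_le_add ((norm_add_le _ _).trans ?_) hw')
    rw [norm_one]; linarith
  · positivity
  · have : w - 1 + D.m - D.lam ζ = (D.m - D.lam ζ) - 1 + w := by ring
    rw [this]
    refine (norm_add_le _ _).trans (add_le_add ((norm_sub_le _ _).trans ?_) hw)
    rw [norm_one]; linarith
  · positivity

theorem summable_size_reflect :
    Summable fun k : ℤ => (1 + |(k : ℝ)|) ^ 3 * D.size (-k - 1) := by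
  have h : Summable fun k : ℤ => (1 + |((-k - 1 : ℤ) : ℝ)|) ^ 3 * D.size (-k - 1) :=
    D.summable_size.comp_injective (i := fun k : ℤ => -k - 1) fun a b h => by simpa using h
  refine .of_nonneg_of_le (fun k => mul_nonneg (by positivity) (D.size_nonneg _)) (fun k => ?_)
    (h.mul_left 8)
  have h1 : 1 + |(k : ℝ)| ≤ 2 * (1 + |((-k - 1 : ℤ) : ℝ)|) := by
    push_cast
    have : |(k : ℝ)| ≤ |-(k : ℝ) - 1| + 1 := by
      have := abs_sub_abs_le_abs_sub (k : ℝ) (-1)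
      rw [show |-(k : ℝ) - 1| = |(k : ℝ) - -1| by rw [← abs_neg]; congr 1; ring]
      simp only [abs_neg, abs_one] at this
      linarith
    linarith [abs_nonneg (-(k : ℝ) - 1)]
  calc _ ≤ (2 * (1 + |((-k - 1 : ℤ) : ℝ)|)) ^ 3 * D.size (-k - 1) := by
        gcongr; exact D.size_nonneg _
    _ = _ := by ring

/-- The multiplier `exp (i ζ)`. -/
noncomputable def mul (ζ : ℂ) : ℂ := Complex.exp (Complex.I * ζ)

theorem mul_ne_zero (ζ : ℂ) : mul ζ ≠ 0 := Complex.exp_ne_zero _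

theorem mul_sq (ζ : ℂ) : mul ζ ^ 2 = Complex.exp (2 * Complex.I * ζ) := by
  rw [mul, ← Complex.exp_nat_mul]; congr 1; push_cast; ring

theorem norm_mul_le {ζ : ℂ} (hζ : ζ ∈ strip D.η) : ‖mul ζ‖ ≤ Real.exp 1 :=
  norm_exp_I_le hζ D.η_le

theorem norm_mul_inv_le {ζ : ℂ} (hζ : ζ ∈ strip D.η) : ‖(mul ζ)⁻¹‖ ≤ Real.exp 1 := by
  rw [mul, ← Complex.exp_neg]; exact norm_exp_neg_I_le hζ D.η_le

theorem mul_diff (S : Set ℂ) : DifferentiableOn ℂ mul S := by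
  unfold mul; fun_prop

theorem mul_inv_diff (S : Set ℂ) : DifferentiableOn ℂ (fun ζ => (mul ζ)⁻¹) S :=
  (mul_diff S).inv fun ζ _ => mul_ne_zero ζ

/-- The data of the Jost solution normalized at `+∞`. -/
noncomputable def jostR : JostData Mat2 where
  η := D.η
  C := D.jostBound
  ρ n := 2 * (Real.exp 1 * (D.pertBound * D.size n))
  A ζ := D.multR (D.lam ζ) (mul ζ)
  r n ζ := D.pertR n (D.lam ζ) (mul ζ)
  x ζ := D.freeVec (D.lam ζ) (mul ζ)
  η_pos := D.η_pos
  η_le := D.η_le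
  A_diff := by
    have h1 := D.lam_diff
    have h2 := mul_diff (strip D.η)
    refine Mat2.differentiableOn fun i j => ?_
    fin_cases i <;> fin_cases j <;> simp [multR, bwdFree] <;> fun_prop
  r_diff n := by
    have h1 := D.lam_diff
    have h2 := mul_diff (strip D.η)
    refine Mat2.differentiableOn fun i j => ?_
    fin_cases i <;> fin_cases j <;> simp [pertR, bwd, bwdFree] <;> fun_prop
  x_diff := by
    have h1 := D.lam_diff
    have h2 := mul_diff (strip D.η)
    have h3 := mul_inv_diff (strip D.η)
    refine Mat2.differentiableOn fun i j => ?_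
    fin_cases i <;> fin_cases j <;> simp [freeVec] <;> fun_prop
  A_quad ζ _ := by
    rw [← mul_sq]; exact (D.mult_quad (mul_ne_zero ζ) (D.lam_sq ζ)).1
  A_mul_x ζ _ := (D.mult_mul_freeVec (mul_ne_zero ζ) (D.lam_sq ζ)).1
  A_le ζ hζ := (D.norm_mult_le hζ (D.norm_mul_le hζ)).1
  x_le ζ hζ := D.norm_freeVec_le hζ (D.norm_mul_le hζ) (D.norm_mul_inv_le hζ)
  r_le n ζ hζ := (D.norm_pert_le hζ (D.norm_mul_le hζ) n).1
  summable := (D.summable_size.mul_left (2 * (Real.exp 1 * D.pertBound))).congr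
    fun n => by ring

/-- The data of the Jost solution normalized at `-∞`, indexed by reflected sites. -/
noncomputable def jostL : JostData Mat2 where
  η := D.η
  C := D.jostBound
  ρ n := 2 * (Real.exp 1 * (D.pertBound * D.size (-n - 1)))
  A ζ := D.multL (D.lam ζ) (mul ζ)
  r n ζ := D.pertL n (D.lam ζ) (mul ζ)
  x ζ := D.freeVec (D.lam ζ) (mul ζ)⁻¹
  η_pos := D.η_pos
  η_le := D.η_le
  A_diff := by
    have h1 := D.lam_diff
    have h2 := mul_diff (strip D.η)
    refine Mat2.differentiableOn fun i j => ?_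
    fin_cases i <;> fin_cases j <;> simp [multL, fwdFree] <;> fun_prop
  r_diff n := by
    have h1 := D.lam_diff
    have h2 := mul_diff (strip D.η)
    refine Mat2.differentiableOn fun i j => ?_
    fin_cases i <;> fin_cases j <;> simp [pertL, fwd, fwdFree] <;> fun_prop
  x_diff := by
    have h1 := D.lam_diff
    have h2 := mul_diff (strip D.η)
    have h3 := mul_inv_diff (strip D.η)
    refine Mat2.differentiableOn fun i j => ?_
    fin_cases i <;> fin_cases j <;> simp [freeVec] <;> fun_prop
  A_quad ζ _ := by
    rw [← mul_sq]; exact (D.mult_quad (mul_ne_zero ζ) (D.lam_sq ζ)).2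
  A_mul_x ζ _ := (D.mult_mul_freeVec (mul_ne_zero ζ) (D.lam_sq ζ)).2
  A_le ζ hζ := (D.norm_mult_le hζ (D.norm_mul_le hζ)).2
  x_le ζ hζ := D.norm_freeVec_le hζ (D.norm_mul_inv_le hζ)
    (by rw [inv_inv]; exact D.norm_mul_le hζ)
  r_le n ζ hζ := (D.norm_pert_le hζ (D.norm_mul_le hζ) n).2
  summable := (D.summable_size_reflect.mul_left (2 * (Real.exp 1 * D.pertBound))).congr
    fun n => by ring

/-- The closed upper half of the strip. -/
def upper : Set ℂ := {ζ | 0 ≤ ζ.im ∧ ζ.im < D.η}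

theorem ofReal_mem_upper (θ : ℝ) : (θ : ℂ) ∈ D.upper := by simpa [upper] using D.η_pos

noncomputable def hR (ζ : ℂ) (n : ℤ) (i : Fin 2) : ℂ :=
  if i = 0 then mul ζ * (D.jostR.sol (n + 1) ζ).entry 0 0 else (D.jostR.sol n ζ).entry 1 0

noncomputable def hL (ζ : ℂ) (n : ℤ) (i : Fin 2) : ℂ :=
  if i = 0 then (mul ζ)⁻¹ * (D.jostL.sol (-n - 1) ζ).entry 0 0
    else (D.jostL.sol (-n) ζ).entry 1 0

/-- The Jost solution decaying (for `Im ζ > 0`) at `+∞`. -/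
noncomputable def psiR (ζ : ℂ) (n : ℤ) : Spinor :=
  !₂[mul ζ ^ n * D.hR ζ n 0, mul ζ ^ n * D.hR ζ n 1]

/-- The Jost solution decaying (for `Im ζ > 0`) at `-∞`. -/
noncomputable def psiL (ζ : ℂ) (n : ℤ) : Spinor :=
  !₂[mul ζ ^ (-n) * D.hL ζ n 0, mul ζ ^ (-n) * D.hL ζ n 1]

theorem psiR_apply (ζ : ℂ) (n : ℤ) (i : Fin 2) : D.psiR ζ n i = mul ζ ^ n * D.hR ζ n i := by
  fin_cases i <;> rfl

theorem psiL_apply (ζ : ℂ) (n : ℤ) (i : Fin 2) : D.psiL ζ n i = mul ζ ^ (-n) * D.hL ζ n i := by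
  fin_cases i <;> rfl

theorem psiR_zero (ζ : ℂ) (n : ℤ) :
    D.psiR ζ n 0 = mul ζ ^ (n + 1) * (D.jostR.sol (n + 1) ζ).entry 0 0 := by
  rw [psiR_apply, hR, if_pos rfl, zpow_add_one₀ (mul_ne_zero ζ), mul_assoc]

theorem psiR_one (ζ : ℂ) (n : ℤ) : D.psiR ζ n 1 = mul ζ ^ n * (D.jostR.sol n ζ).entry 1 0 := by
  rw [psiR_apply, hR, if_neg (by simp)]

theorem psiL_zero (ζ : ℂ) (n : ℤ) :
    D.psiL ζ n 0 = mul ζ ^ (-n - 1) * (D.jostL.sol (-n - 1) ζ).entry 0 0 := by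
  rw [psiL_apply, hL, if_pos rfl, zpow_sub_one₀ (mul_ne_zero ζ), mul_assoc]

theorem psiL_one (ζ : ℂ) (n : ℤ) :
    D.psiL ζ n 1 = mul ζ ^ (-n) * (D.jostL.sol (-n) ζ).entry 1 0 := by
  rw [psiL_apply, hL, if_neg (by simp)]

theorem psiR_isSol {ζ : ℂ} (hζ : ζ ∈ D.upper) : IsSol D.m D.Q (D.lam ζ) (D.psiR ζ) := by
  intro n
  have h := D.jostR.sol_eq_mul hζ n
  have hAr : D.jostR.A ζ + D.jostR.r n ζ = mul ζ • D.bwd n (D.lam ζ) := by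
    change D.multR _ _ + D.pertR n _ _ = _
    rw [multR, pertR, ← smul_add, add_sub_cancel]
  rw [hAr] at h
  have h0 := congrArg (fun M => Mat2.entry M 0 0) h
  have h1 := congrArg (fun M => Mat2.entry M 1 0) h
  simp only [Mat2.mul_entry, Mat2.smul_entry, bwd, Mat2.mk_00, Mat2.mk_01, Mat2.mk_10,
    Mat2.mk_11] at h0 h1
  have hal := D.al_mul n
  rw [psiR_one, psiR_one, psiR_zero, psiR_zero, sub_add_cancel, zpow_add_one₀ (mul_ne_zero ζ),
    h0, h1]
  generalize (D.jostR.sol (n + 1) ζ).entry 0 0 = a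
  generalize (D.jostR.sol (n + 1) ζ).entry 1 0 = b
  generalize mul ζ ^ n = z
  constructor
  · linear_combination (-(z * mul ζ * (b - (D.m + D.Q n 0 0 - D.lam ζ) * a))) * hal
  · ring

theorem psiL_isSol {ζ : ℂ} (hζ : ζ ∈ D.upper) : IsSol D.m D.Q (D.lam ζ) (D.psiL ζ) := by
  intro n
  have h := D.jostL.sol_eq_mul hζ (-n - 1)
  have hAr : D.jostL.A ζ + D.jostL.r (-n - 1) ζ = mul ζ • D.fwd n (D.lam ζ) := by
    change D.multL _ _ + D.pertL (-n - 1) _ _ = _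
    rw [multL, pertL, ← smul_add, add_sub_cancel]
    congr 2
    ring
  rw [hAr, sub_add_cancel] at h
  have h0 := congrArg (fun M => Mat2.entry M 0 0) h
  have h1 := congrArg (fun M => Mat2.entry M 1 0) h
  simp only [Mat2.mul_entry, Mat2.smul_entry, fwd, Mat2.mk_00, Mat2.mk_01, Mat2.mk_10,
    Mat2.mk_11] at h0 h1
  have hal := D.al_mul n
  have hmul := mul_inv_cancel₀ (mul_ne_zero ζ)
  rw [psiL_one, psiL_one, psiL_zero, psiL_zero, show -(n - 1) - 1 = -n by ring,
    show -(n + 1) = -n - 1 by ring, zpow_sub_one₀ (mul_ne_zero ζ), h0, h1]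
  generalize (D.jostL.sol (-n) ζ).entry 0 0 = a
  generalize (D.jostL.sol (-n) ζ).entry 1 0 = b
  generalize mul ζ ^ (-n) = z
  generalize mul ζ = w at *
  generalize w⁻¹ = v at *
  constructor
  · linear_combination ((1 + (D.Q n 1 0 : ℂ)) * z * b) * hmul
  · linear_combination (-(z * (a + (D.lam ζ + D.m - D.Q n 1 1) * b)) * w * v) * hal -
      (z * (a + (D.lam ζ + D.m - D.Q n 1 1) * b)) * hmul

end DiracData

section Wronskian

variable {m : ℝ} {Q : ℤ → Matrix (Fin 2) (Fin 2) ℝ} {l : ℂ} {w z : ℤ → Spinor}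

/-- The Wronskian of two sequences. -/
def wronskian (w z : ℤ → Spinor) (n : ℤ) : ℂ := w (n - 1) 0 * z n 1 - w n 1 * z (n - 1) 0

theorem wronskian_succ (hw : IsSol m Q l w) (hz : IsSol m Q l z) (n : ℤ) :
    wronskian w z (n + 1) = wronskian w z n := by
  obtain ⟨w1, w2⟩ := hw n
  obtain ⟨z1, z2⟩ := hz n
  rw [wronskian, wronskian, add_sub_cancel_right, w1, z1, w2, z2]
  ring

theorem wronskian_eq (hw : IsSol m Q l w) (hz : IsSol m Q l z) (n k : ℤ) :
    wronskian w z n = wronskian w z k := by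
  have h (n : ℤ) : wronskian w z n = wronskian w z 0 := by
    induction n with
    | zero => rfl
    | succ i ih => rw [wronskian_succ hw hz, ih]
    | pred i ih => rw [← ih, ← wronskian_succ hw hz (-i - 1), sub_add_cancel]
  rw [h n, h k]

theorem IsSol.sub_smul (hw : IsSol m Q l w) (hz : IsSol m Q l z) (c : ℂ) :
    IsSol m Q l (w - c • z) := by
  intro n
  obtain ⟨w1, w2⟩ := hw n
  obtain ⟨z1, z2⟩ := hz n
  simp only [Pi.sub_apply, Pi.smul_apply, PiLp.sub_apply, PiLp.smul_apply, smul_eq_mul]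
  rw [w1, z1, w2, z2]
  constructor <;> ring

theorem IsSol.eq_zero (hne : ∀ n, Q n 1 0 ≠ -1) (hw : IsSol m Q l w) (h0 : w (-1) 0 = 0)
    (h1 : w 0 1 = 0) : w = 0 := by
  have hq (n : ℤ) : (1 + (Q n 1 0 : ℂ)) ≠ 0 := fun h => hne n (by
    have : (1 + Q n 1 0 : ℝ) = 0 := by exact_mod_cast h
    linarith)
  have key (n : ℤ) : w (n - 1) 0 = 0 ∧ w n 1 = 0 := by
    induction n with
    | zero => exact ⟨by simpa using h0, h1⟩
    | succ i ih =>
      obtain ⟨a, b⟩ := hw i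
      rw [ih.1, ih.2, mul_zero, add_zero] at b
      have hu : w i 0 = 0 := (mul_eq_zero.mp b.symm).resolve_left (hq i)
      rw [ih.2, hu, mul_zero, mul_zero, add_zero] at a
      exact ⟨by rw [add_sub_cancel_right]; exact hu, a⟩
    | pred i ih =>
      obtain ⟨a, b⟩ := hw (-i - 1)
      rw [sub_add_cancel, ih.2, ih.1, mul_zero, add_zero] at a
      have hv : w (-i - 1) 1 = 0 := (mul_eq_zero.mp a.symm).resolve_left (hq _)
      rw [ih.1, hv, mul_zero, mul_zero, add_zero] at b
      exact ⟨b, hv⟩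
  funext n
  ext i
  fin_cases i
  · simpa using (key (n + 1)).1
  · exact (key n).2

/-- A solution with vanishing Wronskian against a nonzero solution is a multiple of it. -/
theorem IsSol.exists_eq_smul (hne : ∀ n, Q n 1 0 ≠ -1) (hw : IsSol m Q l w) (hz : IsSol m Q l z)
    (hw0 : w ≠ 0) (h : wronskian w z 0 = 0) : ∃ c : ℂ, z = c • w := by
  rw [wronskian, zero_sub] at h
  have aux (c : ℂ) (e0 : z (-1) 0 = c * w (-1) 0) (e1 : z 0 1 = c * w 0 1) : z = c • w :=
    sub_eq_zero.mp ((hz.sub_smul hw c).eq_zero hne (by simp [e0]) (by simp [e1]))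
  by_cases h0 : w (-1) 0 = 0
  · have h1 : w 0 1 ≠ 0 := fun h1 => hw0 (hw.eq_zero hne h0 h1)
    refine ⟨z 0 1 / w 0 1, aux _ ?_ (by field_simp)⟩
    rw [h0, mul_zero]
    rw [h0, zero_mul, zero_sub, neg_eq_zero] at h
    exact (mul_eq_zero.mp h).resolve_left h1
  · refine ⟨z (-1) 0 / w (-1) 0, aux _ (by field_simp) ?_⟩
    field_simp
    linear_combination h

/-- Complex conjugation of a sequence. -/
noncomputable def conjSeq (w : ℤ → Spinor) (n : ℤ) : Spinor := !₂[star (w n 0), star (w n 1)]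

theorem conjSeq_zero (w : ℤ → Spinor) (n : ℤ) : conjSeq w n 0 = star (w n 0) := rfl

theorem conjSeq_one (w : ℤ → Spinor) (n : ℤ) : conjSeq w n 1 = star (w n 1) := rfl

theorem IsSol.conj (hw : IsSol m Q l w) (hl : star l = l) : IsSol m Q l (conjSeq w) := by
  intro n
  obtain ⟨w1, w2⟩ := hw n
  simp only [conjSeq_zero, conjSeq_one, w1, w2]
  have hr (a : ℝ) : star (a : ℂ) = a := Complex.conj_ofReal a
  constructor <;> simp only [star_add, star_mul', star_sub, star_neg, star_one, hr, hl]

end Wronskian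

namespace DiracData

variable (D : DiracData)

/-- The Wronskian of the two Jost solutions. -/
noncomputable def W (ζ : ℂ) : ℂ := wronskian (D.psiR ζ) (D.psiL ζ) 0

theorem lam_ofReal (θ : ℝ) : D.lam θ = realBranch D.m D.s θ := branch_ofReal D.m_pos D.s θ

theorem star_lam_ofReal (θ : ℝ) : star (D.lam θ) = D.lam θ := by
  rw [lam_ofReal]; exact Complex.conj_ofReal _

theorem norm_mul_ofReal (θ : ℝ) : ‖mul θ‖ = 1 := by
  rw [mul, mul_comm]; exact Complex.norm_exp_ofReal_mul_I θ

theorem star_mul_ofReal (θ : ℝ) : star (mul θ) = (mul θ)⁻¹ :=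
  (Complex.inv_eq_conj (norm_mul_ofReal θ)).symm

/-- The Wronskian of a first column with its conjugate. -/
def selfWronskian (M : Mat2) : ℂ := M.entry 0 0 * star (M.entry 1 0) - M.entry 1 0 * star (M.entry 0 0)

theorem continuous_entry (i j : Fin 2) : Continuous fun M : Mat2 => M.entry i j :=
  (Mat2.entryCLM i j).continuous

theorem continuous_selfWronskian : Continuous selfWronskian := by
  have h0 := continuous_entry 0 0
  have h1 := continuous_entry 1 0
  unfold selfWronskian
  fun_prop

theorem zpow_mul_star (θ : ℝ) (n : ℤ) : mul θ ^ n * star (mul θ ^ n) = 1 := by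
  rw [Complex.star_def, Complex.mul_conj, Complex.normSq_eq_norm_sq, norm_zpow, norm_mul_ofReal]
  simp

theorem wronskian_psiR_conj (θ : ℝ) :
    wronskian (D.psiR θ) (conjSeq (D.psiR θ)) 0 =
      selfWronskian (D.freeVec (D.lam θ) (mul θ)) := by
  have hsol := D.psiR_isSol (D.ofReal_mem_upper θ)
  have hconst (n : ℕ) : wronskian (D.psiR θ) (conjSeq (D.psiR θ)) 0 =
      selfWronskian (D.jostR.sol n θ) := by
    rw [wronskian_eq hsol (hsol.conj (D.star_lam_ofReal θ)) 0 n, wronskian, conjSeq_one,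
      conjSeq_zero, psiR_zero, psiR_one, sub_add_cancel, star_mul', star_mul', selfWronskian]
    linear_combination ((D.jostR.sol n θ).entry 0 0 * star ((D.jostR.sol n θ).entry 1 0) -
      (D.jostR.sol n θ).entry 1 0 * star ((D.jostR.sol n θ).entry 0 0)) * zpow_mul_star θ n
  have hlim := (continuous_selfWronskian.tendsto _).comp (D.jostR.tendsto_sol (D.ofReal_mem_upper θ))
  exact tendsto_nhds_unique (tendsto_const_nhds.congr hconst) hlim

theorem wronskian_psiL_conj (θ : ℝ) :
    wronskian (D.psiL θ) (conjSeq (D.psiL θ)) 0 =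
      selfWronskian (D.freeVec (D.lam θ) (mul θ)⁻¹) := by
  have hsol := D.psiL_isSol (D.ofReal_mem_upper θ)
  have hconst (n : ℕ) : wronskian (D.psiL θ) (conjSeq (D.psiL θ)) 0 =
      selfWronskian (D.jostL.sol n θ) := by
    rw [wronskian_eq hsol (hsol.conj (D.star_lam_ofReal θ)) 0 (-n), wronskian, conjSeq_one,
      conjSeq_zero, psiL_zero, psiL_one, star_mul', star_mul', selfWronskian,
      show -(-(n : ℤ) - 1) - 1 = n by ring, neg_neg]
    linear_combination ((D.jostL.sol n θ).entry 0 0 * star ((D.jostL.sol n θ).entry 1 0) -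
      (D.jostL.sol n θ).entry 1 0 * star ((D.jostL.sol n θ).entry 0 0)) * zpow_mul_star θ n
  have hlim := (continuous_selfWronskian.tendsto _).comp (D.jostL.tendsto_sol (D.ofReal_mem_upper θ))
  exact tendsto_nhds_unique (tendsto_const_nhds.congr hconst) hlim

theorem selfWronskian_freeVec {l w : ℂ} (hl : star l = l) (hw : star w = w⁻¹) (hw0 : w ≠ 0) :
    selfWronskian (D.freeVec l w) = (w⁻¹ - w) * (2 * l + 2 - (w + w⁻¹)) := by
  have hr : star (D.m : ℂ) = D.m := Complex.conj_ofReal _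
  have hinv : star w⁻¹ = w := by rw [← hw, star_star]
  have hww : w * w⁻¹ = 1 := mul_inv_cancel₀ hw0
  simp only [selfWronskian, freeVec, Mat2.mk_00, Mat2.mk_10, star_add, star_sub, star_one, hr, hl,
    hw, hinv]
  ring

theorem mul_ofReal_add (θ : ℝ) : mul θ + (mul θ)⁻¹ = 2 * Real.cos θ := by
  rw [mul, ← Complex.exp_neg, ← two_cos_eq, Complex.ofReal_cos]

theorem mul_ofReal_sub (θ : ℝ) : (mul θ)⁻¹ - mul θ = -(2 * Complex.I * Real.sin θ) := by
  rw [mul, ← Complex.exp_neg, Complex.ofReal_sin, Complex.sin]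
  rw [show -(θ : ℂ) * Complex.I = -(Complex.I * θ) by ring, mul_comm (θ : ℂ) Complex.I]
  linear_combination (Complex.exp (-(Complex.I * θ)) - Complex.exp (Complex.I * θ)) * Complex.I_sq

theorem band_factor_ne_zero (θ : ℝ) :
    2 * realBranch D.m D.s θ + 2 - 2 * Real.cos θ ≠ 0 := by
  intro h
  have h1 := realBranch_sq D.m_pos D.s_sq θ
  have h2 : realBranch D.m D.s θ = Real.cos θ - 1 := by linarith
  rw [h2] at h1
  have hm := D.m_pos
  nlinarith [Real.neg_one_le_cos θ, Real.cos_le_one θ, sq_pos_of_pos hm]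

theorem selfWronskian_ne_zero {θ : ℝ} (hθ : Real.sin θ ≠ 0) :
    selfWronskian (D.freeVec (D.lam θ) (mul θ)) ≠ 0 := by
  rw [D.selfWronskian_freeVec (D.star_lam_ofReal θ) (star_mul_ofReal θ) (mul_ne_zero _),
    mul_ofReal_sub, mul_ofReal_add, lam_ofReal]
  have h1 := D.band_factor_ne_zero θ
  refine _root_.mul_ne_zero ?_ (by exact_mod_cast h1)
  rw [neg_ne_zero]
  exact _root_.mul_ne_zero (_root_.mul_ne_zero two_ne_zero Complex.I_ne_zero) (by exact_mod_cast hθ)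

theorem selfWronskian_inv (θ : ℝ) : selfWronskian (D.freeVec (D.lam θ) (mul θ)⁻¹) =
    -selfWronskian (D.freeVec (D.lam θ) (mul θ)) := by
  rw [D.selfWronskian_freeVec (D.star_lam_ofReal θ) (star_mul_ofReal θ) (mul_ne_zero _),
    D.selfWronskian_freeVec (D.star_lam_ofReal θ) (by rw [← star_mul_ofReal, star_star, star_mul_ofReal, inv_inv])
      (inv_ne_zero (mul_ne_zero _)), inv_inv]
  ring

theorem freeVec_ne_zero (θ : ℝ) (v : ℂ) (hv : v = mul θ ∨ v = (mul θ)⁻¹) :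
    ¬((D.freeVec (D.lam θ) v).entry 0 0 = 0 ∧ (D.freeVec (D.lam θ) v).entry 1 0 = 0) := by
  rintro ⟨h0, h1⟩
  by_cases hθ : Real.sin θ = 0
  · have hinv : (mul θ)⁻¹ = mul θ := by
      have := mul_ofReal_sub θ
      rw [hθ] at this
      exact sub_eq_zero.mp (by simpa using this)
    have hvv : v⁻¹ = v := by
      rcases hv with rfl | rfl
      · exact hinv
      · rw [inv_inv, hinv]
    simp only [freeVec, Mat2.mk_00, Mat2.mk_10, hvv] at h0 h1
    have : (2 * D.m : ℂ) = 0 := by linear_combination h0 + h1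
    have hm := D.m_pos.ne'
    norm_num at this
    exact hm this
  · have hz : selfWronskian (D.freeVec (D.lam θ) v) = 0 := by
      rw [selfWronskian, h0, h1]; simp
    have h2 := D.selfWronskian_ne_zero hθ
    rcases hv with rfl | rfl
    · exact h2 hz
    · rw [selfWronskian_inv, neg_eq_zero] at hz
      exact h2 hz

theorem psiR_ne_zero (θ : ℝ) : D.psiR θ ≠ 0 := by
  intro h
  refine D.freeVec_ne_zero θ _ (Or.inl rfl) ?_
  have hlim := D.jostR.tendsto_sol (D.ofReal_mem_upper θ)
  have hz (n : ℤ) : mul (θ : ℂ) ^ n ≠ 0 := zpow_ne_zero _ (mul_ne_zero _)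
  refine ⟨tendsto_nhds_unique (((continuous_entry 0 0).tendsto _).comp hlim)
    (tendsto_const_nhds.congr fun n => ?_), tendsto_nhds_unique
    (((continuous_entry 1 0).tendsto _).comp hlim) (tendsto_const_nhds.congr fun n => ?_)⟩
  · have := congrArg (fun f : ℤ → Spinor => f ((n : ℤ) - 1) 0) h
    simp only [psiR_zero, sub_add_cancel] at this
    exact ((mul_eq_zero.mp this).resolve_left (hz _)).symm
  · have := congrArg (fun f : ℤ → Spinor => f n 1) h
    simp only [psiR_one] at this
    exact ((mul_eq_zero.mp this).resolve_left (hz _)).symm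

theorem psiL_ne_zero (θ : ℝ) : D.psiL θ ≠ 0 := by
  intro h
  refine D.freeVec_ne_zero θ _ (Or.inr rfl) ?_
  have hlim := D.jostL.tendsto_sol (D.ofReal_mem_upper θ)
  have hz (n : ℤ) : mul (θ : ℂ) ^ n ≠ 0 := zpow_ne_zero _ (mul_ne_zero _)
  refine ⟨tendsto_nhds_unique (((continuous_entry 0 0).tendsto _).comp hlim)
    (tendsto_const_nhds.congr fun n => ?_), tendsto_nhds_unique
    (((continuous_entry 1 0).tendsto _).comp hlim) (tendsto_const_nhds.congr fun n => ?_)⟩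
  · have := congrArg (fun f : ℤ → Spinor => f (-(n : ℤ) - 1) 0) h
    simp only [psiL_zero, show -(-(n : ℤ) - 1) - 1 = n by ring] at this
    exact ((mul_eq_zero.mp this).resolve_left (hz _)).symm
  · have := congrArg (fun f : ℤ → Spinor => f (-(n : ℤ)) 1) h
    simp only [psiL_one, neg_neg] at this
    exact ((mul_eq_zero.mp this).resolve_left (hz _)).symm

/-- Boundedness of the Jost solutions, stripped of their exponential factors, on the side of their
normalization. -/
theorem exists_norm_h_le : ∃ C : ℝ, 0 ≤ C ∧ ∀ ζ ∈ D.upper,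
    (∀ n : ℤ, 0 ≤ n → ∀ i, ‖D.hR ζ n i‖ ≤ C) ∧ (∀ n : ℤ, n ≤ -1 → ∀ i, ‖D.hL ζ n i‖ ≤ C) := by
  have hsub (ζ : ℂ) (hζ : ζ ∈ D.upper) : ζ ∈ strip D.η := D.jostR.upper_subset hζ
  have hR0 : 0 ≤ D.jostR.solBound := (norm_nonneg _).trans
    (D.jostR.norm_sol_le (D.ofReal_mem_upper 0) le_rfl)
  have hL0 : 0 ≤ D.jostL.solBound := (norm_nonneg _).trans
    (D.jostL.norm_sol_le (D.ofReal_mem_upper 0) le_rfl)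
  have he : 1 ≤ Real.exp 1 := Real.one_le_exp zero_le_one
  refine ⟨Real.exp 1 * (D.jostR.solBound + D.jostL.solBound), by positivity, fun ζ hζ => ⟨?_, ?_⟩⟩
  · intro n hn i
    have bd (k : ℤ) (hk : 0 ≤ k) (i j : Fin 2) :
        ‖(D.jostR.sol k ζ).entry i j‖ ≤ D.jostR.solBound + D.jostL.solBound :=
      ((Mat2.norm_entry_le _ i j).trans (D.jostR.norm_sol_le hζ hk)).trans
        (le_add_of_nonneg_right hL0)
    fin_cases i
    · simp only [hR, Fin.zero_eta, if_true]
      rw [norm_mul]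
      exact mul_le_mul (D.norm_mul_le (hsub ζ hζ)) (bd _ (by omega) 0 0) (norm_nonneg _)
        (by positivity)
    · simp only [hR, Fin.mk_one, one_ne_zero, if_false]
      exact (bd n hn 1 0).trans (le_mul_of_one_le_left (by positivity) he)
  · intro n hn i
    have bd (k : ℤ) (hk : 0 ≤ k) (i j : Fin 2) :
        ‖(D.jostL.sol k ζ).entry i j‖ ≤ D.jostR.solBound + D.jostL.solBound :=
      ((Mat2.norm_entry_le _ i j).trans (D.jostL.norm_sol_le hζ hk)).trans
        (le_add_of_nonneg_left hR0)
    fin_cases i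
    · simp only [hL, Fin.zero_eta, if_true]
      rw [norm_mul]
      exact mul_le_mul (D.norm_mul_inv_le (hsub ζ hζ)) (bd _ (by omega) 0 0) (norm_nonneg _)
        (by positivity)
    · simp only [hL, Fin.mk_one, one_ne_zero, if_false]
      exact (bd _ (by omega) 1 0).trans (le_mul_of_one_le_left (by positivity) he)

theorem spinor_norm_le (x : Spinor) : ‖x‖ ≤ ‖x 0‖ + ‖x 1‖ := by
  rw [EuclideanSpace.norm_eq, Fin.sum_univ_two]
  refine Real.sqrt_le_iff.mpr ⟨by positivity, ?_⟩
  nlinarith [norm_nonneg (x 0), norm_nonneg (x 1)]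

theorem W_ofReal_ne_zero (hres : NonResonant D.m D.Q) (θ : ℝ) : D.W θ ≠ 0 := by
  intro hW
  have hsolR := D.psiR_isSol (D.ofReal_mem_upper θ)
  have hsolL := D.psiL_isSol (D.ofReal_mem_upper θ)
  obtain ⟨c, hc⟩ := hsolR.exists_eq_smul D.ne hsolL (D.psiR_ne_zero θ) hW
  by_cases hθ : Real.sin θ = 0
  · have hsq := realBranch_sq D.m_pos D.s_sq θ
    have hedge : realBranch D.m D.s θ = D.m ∨ realBranch D.m D.s θ = -D.m ∨
        realBranch D.m D.s θ = √(D.m ^ 2 + 4) ∨ realBranch D.m D.s θ = -√(D.m ^ 2 + 4) := by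
      rcases Real.sin_eq_zero_iff_cos_eq.mp hθ with h | h
      · rw [h] at hsq
        have : realBranch D.m D.s θ ^ 2 = D.m ^ 2 := by linarith
        rcases sq_eq_sq_iff_eq_or_eq_neg.mp this with h | h
        · exact Or.inl h
        · exact Or.inr (Or.inl h)
      · rw [h] at hsq
        have : realBranch D.m D.s θ ^ 2 = √(D.m ^ 2 + 4) ^ 2 := by
          rw [Real.sq_sqrt (by positivity)]; linarith
        rcases sq_eq_sq_iff_eq_or_eq_neg.mp this with h | h
        · exact Or.inr (Or.inr (Or.inl h))
        · exact Or.inr (Or.inr (Or.inr h))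
    refine hres _ hedge ⟨D.psiL θ, D.psiL_ne_zero θ, ?_, ?_⟩
    · obtain ⟨C, hC, hb⟩ := D.exists_norm_h_le
      obtain ⟨hbR, hbL⟩ := hb θ (D.ofReal_mem_upper θ)
      refine ⟨2 * C + ‖c‖ * (2 * C), fun n => ?_⟩
      rcases le_or_gt 0 n with hn | hn
      · have hR (i : Fin 2) : ‖D.psiR θ n i‖ ≤ C := by
          rw [psiR_apply, norm_mul, norm_zpow, norm_mul_ofReal, one_zpow, one_mul]
          exact hbR n hn i
        have h1 := (spinor_norm_le (D.psiR θ n)).trans (add_le_add (hR 0) (hR 1))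
        rw [hc, Pi.smul_apply, norm_smul]
        have : ‖c‖ * ‖D.psiR θ n‖ ≤ ‖c‖ * (2 * C) := by gcongr; linarith
        linarith
      · have hL (i : Fin 2) : ‖D.psiL θ n i‖ ≤ C := by
          rw [psiL_apply, norm_mul, norm_zpow, norm_mul_ofReal, one_zpow, one_mul]
          exact hbL n (by omega) i
        have h1 := (spinor_norm_le (D.psiL θ n)).trans (add_le_add (hL 0) (hL 1))
        have : 0 ≤ ‖c‖ * (2 * C) := by positivity
        linarith
    · rw [← lam_ofReal]
      exact (diracExpr_eq_smul_iff D.symm _ _).mpr hsolL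
  · have h1 : wronskian (D.psiL θ) (conjSeq (D.psiL θ)) 0 =
        (Complex.normSq c) * wronskian (D.psiR θ) (conjSeq (D.psiR θ)) 0 := by
      rw [hc]
      simp only [wronskian, conjSeq_zero, conjSeq_one, Pi.smul_apply, PiLp.smul_apply, smul_eq_mul,
        star_mul', Complex.normSq_eq_conj_mul_self, Complex.star_def]
      ring
    rw [wronskian_psiL_conj, wronskian_psiR_conj, selfWronskian_inv] at h1
    have h2 := D.selfWronskian_ne_zero hθ
    have h3 : (1 + (Complex.normSq c : ℂ)) * selfWronskian (D.freeVec (D.lam θ) (mul θ)) = 0 := by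
      linear_combination -h1
    rcases mul_eq_zero.mp h3 with h | h
    · have : (1 + Complex.normSq c : ℝ) = 0 := by exact_mod_cast h
      linarith [Complex.normSq_nonneg c]
    · exact h2 h

theorem continuousOn_hR (n : ℤ) (i : Fin 2) : ContinuousOn (fun ζ => D.hR ζ n i) D.upper := by
  have h (k : ℤ) (i j : Fin 2) : ContinuousOn (fun ζ => (D.jostR.sol k ζ).entry i j) D.upper :=
    (continuous_entry i j).comp_continuousOn (D.jostR.continuousOn_sol k)
  have h1 := (mul_diff D.upper).continuousOn
  fin_cases i
  · exact h1.mul (h (n + 1) 0 0)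
  · exact h n 1 0

theorem continuousOn_hL (n : ℤ) (i : Fin 2) : ContinuousOn (fun ζ => D.hL ζ n i) D.upper := by
  have h (k : ℤ) (i j : Fin 2) : ContinuousOn (fun ζ => (D.jostL.sol k ζ).entry i j) D.upper :=
    (continuous_entry i j).comp_continuousOn (D.jostL.continuousOn_sol k)
  have h1 := (mul_inv_diff D.upper).continuousOn
  fin_cases i
  · exact h1.mul (h (-n - 1) 0 0)
  · exact h (-n) 1 0

theorem continuousOn_psiR (n : ℤ) (i : Fin 2) : ContinuousOn (fun ζ => D.psiR ζ n i) D.upper := by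
  simp only [psiR_apply]
  exact ((mul_diff D.upper).continuousOn.zpow₀ n fun ζ _ => Or.inl (mul_ne_zero ζ)).mul
    (D.continuousOn_hR n i)

theorem continuousOn_psiL (n : ℤ) (i : Fin 2) : ContinuousOn (fun ζ => D.psiL ζ n i) D.upper := by
  simp only [psiL_apply]
  exact ((mul_diff D.upper).continuousOn.zpow₀ (-n) fun ζ _ => Or.inl (mul_ne_zero ζ)).mul
    (D.continuousOn_hL n i)

theorem continuousOn_W : ContinuousOn D.W D.upper := by
  unfold W wronskian
  exact ((D.continuousOn_psiR _ _).mul (D.continuousOn_psiL _ _)).sub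
    ((D.continuousOn_psiR _ _).mul (D.continuousOn_psiL _ _))

/-- The Wronskian has no zeros near the real axis. -/
theorem exists_W_ne_zero (hres : NonResonant D.m D.Q) : ∃ δ : ℝ, 0 < δ ∧ δ < D.η ∧
    ∀ ζ : ℂ, |ζ.re| ≤ 10 → 0 ≤ ζ.im → ζ.im ≤ δ → D.W ζ ≠ 0 := by
  have hη := D.η_pos
  set K : Set ℂ := Set.Icc (-10) 10 ×ℂ Set.Icc 0 (D.η / 2) with hK
  have hKc : IsCompact K := isCompact_Icc.reProdIm isCompact_Icc
  have hKsub : K ⊆ D.upper := fun ζ hζ => by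
    rw [hK, Complex.mem_reProdIm] at hζ
    exact ⟨hζ.2.1, by linarith [hζ.2.2]⟩
  have hmem (ζ : ℂ) (h1 : |ζ.re| ≤ 10) (h2 : 0 ≤ ζ.im) (h3 : ζ.im ≤ D.η / 2) : ζ ∈ K := by
    rw [hK, Complex.mem_reProdIm]; exact ⟨abs_le.mp h1, h2, h3⟩
  set Z : Set ℂ := K ∩ D.W ⁻¹' {0} with hZ
  have hZc : IsCompact Z := hKc.of_isClosed_subset
    ((D.continuousOn_W.mono hKsub).preimage_isClosed_of_isClosed hKc.isClosed isClosed_singleton)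
    Set.inter_subset_left
  rcases Z.eq_empty_or_nonempty with he | hne
  · refine ⟨D.η / 2, by positivity, by linarith, fun ζ h1 h2 h3 hW => ?_⟩
    have : ζ ∈ Z := ⟨hmem ζ h1 h2 h3, hW⟩
    rw [he] at this
    exact this
  · obtain ⟨ζ₀, hζ₀, hmin⟩ := hZc.exists_isMinOn hne Complex.continuous_im.continuousOn
    have hK₀ := hζ₀.1
    rw [hK, Complex.mem_reProdIm] at hK₀
    have hpos : 0 < ζ₀.im := by
      refine lt_of_le_of_ne hK₀.2.1 fun h => ?_
      have e : ζ₀ = ((ζ₀.re : ℝ) : ℂ) := Complex.ext (by simp) (by simp [← h])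
      have := hζ₀.2
      rw [e] at this
      exact D.W_ofReal_ne_zero hres ζ₀.re this
    refine ⟨ζ₀.im / 2, by positivity, by linarith [hK₀.2.2], fun ζ h1 h2 h3 hW => ?_⟩
    have := hmin (show ζ ∈ Z from ⟨hmem ζ h1 h2 (by linarith [hK₀.2.2]), hW⟩)
    simp only [Set.mem_ofPred_eq] at this
    linarith

end DiracData

section Operator

theorem SpinorL2.norm_sq_eq_tsum (f : SpinorL2) : ‖f‖ ^ 2 = ∑' n, ‖f n‖ ^ 2 := by
  have := lp.norm_rpow_eq_tsum (p := 2) (by norm_num) f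
  simpa using this

theorem SpinorL2.summable_sq (f : SpinorL2) : Summable fun n => ‖f n‖ ^ 2 := by
  have := (lp.hasSum_norm (p := 2) (by norm_num) f).summable
  simpa using this

theorem SpinorL2.norm_le_mul {f g : SpinorL2} {c : ℝ} (hc : 0 ≤ c)
    (h : ∀ n, ‖f n‖ ≤ c * ‖g n‖) : ‖f‖ ≤ c * ‖g‖ := by
  refine le_of_sq_le_sq ?_ (by positivity)
  rw [mul_pow, norm_sq_eq_tsum, norm_sq_eq_tsum, ← tsum_mul_left]
  refine f.summable_sq.tsum_le_tsum (fun n => ?_) (g.summable_sq.mul_left _)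
  rw [← mul_pow]
  exact pow_le_pow_left₀ (norm_nonneg _) (h n) 2

/-- The shift of a square summable sequence. -/
def SpinorL2.shift (k : ℤ) (w : SpinorL2) : SpinorL2 :=
  ⟨fun n => w (n + k), by
    have hw := lp.memℓp w
    rw [memℓp_gen_iff (by norm_num)] at hw
    exact (memℓp_gen_iff (by norm_num)).mpr ((Equiv.addRight k).summable_iff.mpr hw)⟩

theorem SpinorL2.shift_apply (k : ℤ) (w : SpinorL2) (n : ℤ) : w.shift k n = w (n + k) := rfl

theorem SpinorL2.norm_shift (k : ℤ) (w : SpinorL2) : ‖w.shift k‖ = ‖w‖ := by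
  refine (pow_left_inj₀ (norm_nonneg _) (norm_nonneg _) two_ne_zero).mp ?_
  rw [norm_sq_eq_tsum, norm_sq_eq_tsum]
  exact (Equiv.addRight k).tsum_eq fun n => ‖w n‖ ^ 2

/-- Restriction of a sequence to the sites `|n| ≤ N`. -/
noncomputable def SpinorL2.trunc (N : ℕ) (w : SpinorL2) : SpinorL2 :=
  ∑ n ∈ Finset.Icc (-N : ℤ) N, lp.single 2 n (w n)

theorem SpinorL2.trunc_apply (N : ℕ) (w : SpinorL2) (n : ℤ) :
    w.trunc N n = if |n| ≤ N then w n else 0 := by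
  rw [trunc, lp.coeFn_sum, Finset.sum_apply]
  have : ∀ k : ℤ, (lp.single (E := fun _ : ℤ => Spinor) 2 k (w k) : ℤ → Spinor) n = if n = k then w n else 0 := by
    intro k
    split_ifs with h
    · subst h; exact lp.single_apply_self 2 _ _
    · exact lp.single_apply_ne 2 _ _ h
  simp only [this, Finset.sum_ite_eq, Finset.mem_Icc, abs_le]

theorem SpinorL2.norm_sub_trunc_le (N : ℕ) (w : SpinorL2) : ‖w - w.trunc N‖ ≤ ‖w‖ := by
  have := norm_le_mul (f := w - w.trunc N) (g := w) zero_le_one fun n => by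
    rw [lp.coeFn_sub, Pi.sub_apply, trunc_apply]
    split_ifs <;> simp
  simpa using this

theorem SpinorL2.tendsto_trunc {w : ℕ → SpinorL2} (h : ∀ n, Tendsto (fun k => w k n) atTop (𝓝 0))
    (N : ℕ) : Tendsto (fun k => (w k).trunc N) atTop (𝓝 0) := by
  have : (0 : SpinorL2) = ∑ n ∈ Finset.Icc (-N : ℤ) N, (0 : SpinorL2) := by simp
  rw [this]
  refine tendsto_finsetSum _ fun n _ => ?_
  rw [tendsto_zero_iff_norm_tendsto_zero]
  refine (tendsto_zero_iff_norm_tendsto_zero.mp (h n)).congr fun k => ?_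
  exact (lp.norm_single (E := fun _ : ℤ => Spinor) (p := 2) (by norm_num) n _).symm

variable {m : ℝ} {Q : ℤ → Matrix (Fin 2) (Fin 2) ℝ} {hQ : ∃ C : ℝ, ∀ n i j, |Q n i j| ≤ C}

theorem diracOp_apply (w : SpinorL2) (n : ℤ) : diracOp m Q hQ w n = diracExpr m Q w n := rfl

theorem diracExpr_zero (w : ℤ → Spinor) (n : ℤ) : diracExpr m Q w n 0 =
    (m : ℂ) * w n 0 + (w n 1 - w (n + 1) 1) + ((Q n 0 0 : ℂ) * w n 0 + (Q n 0 1 : ℂ) * w n 1) := rfl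

theorem diracExpr_one (w : ℤ → Spinor) (n : ℤ) : diracExpr m Q w n 1 =
    (w n 0 - w (n - 1) 0) - (m : ℂ) * w n 1 + ((Q n 1 0 : ℂ) * w n 0 + (Q n 1 1 : ℂ) * w n 1) := rfl

theorem spinor_inner (x y : Spinor) :
    inner ℂ x y = star (x 0) * y 0 + star (x 1) * y 1 := by
  rw [PiLp.inner_apply, Fin.sum_univ_two]
  simp [mul_comm]

theorem isSelfAdjoint_diracOp (hsymm : ∀ n, Q n 0 1 = Q n 1 0) :
    IsSelfAdjoint (diracOp m Q hQ) := by
  rw [ContinuousLinearMap.isSelfAdjoint_iff_isSymmetric]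
  intro w z
  change inner ℂ (diracOp m Q hQ w) z = inner ℂ w (diracOp m Q hQ z)
  set c : ℤ → ℂ := fun n => star (w (n - 1) 0) * z n 1 - star (w n 1) * z (n - 1) 0 with hc
  have hr (a : ℝ) : star (a : ℂ) = a := Complex.conj_ofReal a
  have hdiff (n : ℤ) : inner ℂ (diracOp m Q hQ w n) (z n) - inner ℂ (w n) (diracOp m Q hQ z n) =
      c (n + 1) - c n := by
    simp only [hc, diracOp_apply, spinor_inner, diracExpr_zero, diracExpr_one, star_add, star_sub,
      star_mul', hr, add_sub_cancel_right, hsymm]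
    ring
  have hsum : Summable c := by
    have hb := ((w.shift (-1)).summable_sq.add (z.shift (-1)).summable_sq).add
      (w.summable_sq.add z.summable_sq)
    refine hb.of_norm_bounded fun n => ?_
    simp only [hc, SpinorL2.shift_apply, ← sub_eq_add_neg]
    refine (norm_sub_le _ _).trans ?_
    rw [norm_mul, norm_mul, norm_star, norm_star]
    have h1 := PiLp.norm_apply_le (w (n - 1)) 0
    have h2 := PiLp.norm_apply_le (z n) 1
    have h3 := PiLp.norm_apply_le (w n) 1
    have h4 := PiLp.norm_apply_le (z (n - 1)) 0
    have h5 : ‖w (n - 1) 0‖ * ‖z n 1‖ ≤ ‖w (n - 1)‖ * ‖z n‖ := by gcongr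
    have h6 : ‖w n 1‖ * ‖z (n - 1) 0‖ ≤ ‖w n‖ * ‖z (n - 1)‖ := by gcongr
    nlinarith [sq_nonneg (‖w (n - 1)‖ - ‖z n‖), sq_nonneg (‖w n‖ - ‖z (n - 1)‖),
      sq_nonneg ‖w (n - 1)‖, sq_nonneg ‖z n‖, sq_nonneg ‖w n‖, sq_nonneg ‖z (n - 1)‖]
  have h1 := (lp.hasSum_inner (𝕜 := ℂ) (diracOp m Q hQ w) z).sub
    (lp.hasSum_inner (𝕜 := ℂ) w (diracOp m Q hQ z))
  have h2 : HasSum (fun n => c (n + 1) - c n) (∑' n, c n - ∑' n, c n) :=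
    ((Equiv.addRight (1 : ℤ)).hasSum_iff.mpr hsum.hasSum).sub hsum.hasSum
  rw [sub_self] at h2
  simp only [hdiff] at h1
  exact sub_eq_zero.mp (h1.unique h2)

/-- The free operator. -/
noncomputable def freeOp (m : ℝ) : SpinorL2 →L[ℂ] SpinorL2 :=
  diracOp m (fun _ => 0) ⟨0, by simp⟩

theorem freeOp_freeOp (w : SpinorL2) : freeOp m (freeOp m w) =
    ((m ^ 2 + 2 : ℝ) : ℂ) • w - w.shift 1 - w.shift (-1) := by
  ext n i
  have h0 (w : SpinorL2) (n : ℤ) : freeOp m w n 0 = (m : ℂ) * w n 0 + (w n 1 - w (n + 1) 1) := by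
    rw [freeOp, diracOp_apply, diracExpr_zero]; simp
  have h1 (w : SpinorL2) (n : ℤ) : freeOp m w n 1 = (w n 0 - w (n - 1) 0) - (m : ℂ) * w n 1 := by
    rw [freeOp, diracOp_apply, diracExpr_one]; simp
  simp only [lp.coeFn_sub, Pi.sub_apply, PiLp.sub_apply, lp.coeFn_smul, Pi.smul_apply,
    PiLp.smul_apply, SpinorL2.shift_apply, smul_eq_mul, ← sub_eq_add_neg]
  fin_cases i
  · simp only [Fin.zero_eta, h0, h1, add_sub_cancel_right]; push_cast; ring
  · simp only [Fin.mk_one, h0, h1, sub_add_cancel]; push_cast; ring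

theorem norm_freeOp_sq_le (w : SpinorL2) :
    ‖freeOp m (freeOp m w) - ((m ^ 2 + 2 : ℝ) : ℂ) • w‖ ≤ 2 * ‖w‖ := by
  have : freeOp m (freeOp m w) - ((m ^ 2 + 2 : ℝ) : ℂ) • w = -(w.shift 1 + w.shift (-1)) := by
    rw [freeOp_freeOp]; abel
  rw [this, norm_neg]
  refine (norm_add_le _ _).trans ?_
  rw [SpinorL2.norm_shift, SpinorL2.norm_shift]
  linarith

theorem diracOp_sub_freeOp_apply (w : SpinorL2) (n : ℤ) : (diracOp m Q hQ - freeOp m) w n =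
    !₂[(Q n 0 0 : ℂ) * w n 0 + (Q n 0 1 : ℂ) * w n 1, (Q n 1 0 : ℂ) * w n 0 + (Q n 1 1 : ℂ) * w n 1] := by
  rw [sub_apply, lp.coeFn_sub, Pi.sub_apply]
  ext i
  rw [PiLp.sub_apply]
  fin_cases i
  · simp only [Fin.zero_eta, freeOp, diracOp_apply, diracExpr_zero]; simp
  · simp only [Fin.mk_one, freeOp, diracOp_apply, diracExpr_one]; simp

theorem norm_diracOp_sub_freeOp_le {N : ℤ} {ε : ℝ} (hε : 0 ≤ ε)
    (hN : ∀ n, N < |n| → ∀ i j, |Q n i j| ≤ ε) (w : SpinorL2) (hw : ∀ n, |n| ≤ N → w n = 0) :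
    ‖(diracOp m Q hQ - freeOp m) w‖ ≤ 4 * ε * ‖w‖ := by
  refine SpinorL2.norm_le_mul (by positivity) fun n => ?_
  rw [diracOp_sub_freeOp_apply]
  rcases le_or_gt |n| N with hn | hn
  · have hz : !₂[(Q n 0 0 : ℂ) * w n 0 + (Q n 0 1 : ℂ) * w n 1,
        (Q n 1 0 : ℂ) * w n 0 + (Q n 1 1 : ℂ) * w n 1] = 0 := by
      rw [hw n hn]; ext i; fin_cases i <;> simp
    rw [hz, norm_zero]; positivity
  · refine (DiracData.spinor_norm_le _).trans ?_
    have hb (i : Fin 2) : ‖(Q n i 0 : ℂ) * w n 0 + (Q n i 1 : ℂ) * w n 1‖ ≤ 2 * ε * ‖w n‖ := by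
      refine (norm_add_le _ _).trans ?_
      rw [norm_mul, norm_mul, Complex.norm_real, Complex.norm_real, Real.norm_eq_abs,
        Real.norm_eq_abs]
      have h1 := mul_le_mul (hN n hn i 0) (PiLp.norm_apply_le (w n) 0) (norm_nonneg _) hε
      have h2 := mul_le_mul (hN n hn i 1) (PiLp.norm_apply_le (w n) 1) (norm_nonneg _) hε
      linarith
    have h0 := hb 0
    have h1 := hb 1
    refine (add_le_add h0 h1).trans (by linarith)

/-- The difference of the squares of the perturbed and the free operator vanishes at infinity. -/
theorem exists_norm_sq_sub_le (hQ0 : ∀ ε > 0, ∃ N : ℕ, ∀ n : ℤ, N < |n| → ∀ i j, |Q n i j| ≤ ε)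
    {ε : ℝ} (hε : 0 < ε) : ∃ N : ℕ, ∀ w : SpinorL2, (∀ n : ℤ, |n| ≤ N → w n = 0) →
      ‖diracOp m Q hQ (diracOp m Q hQ w) - freeOp m (freeOp m w)‖ ≤ ε * ‖w‖ := by
  set T := diracOp m Q hQ
  set F := freeOp m
  have hpos : 0 < ε / (4 * (‖T‖ + ‖F‖ + 1)) := by positivity
  obtain ⟨N, hN⟩ := hQ0 _ hpos
  refine ⟨N + 1, fun w hw => ?_⟩
  have h1 := norm_diracOp_sub_freeOp_le (m := m) (hQ := hQ) hpos.le hN w fun n hn => hw n (by push_cast; omega)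
  have h2 := norm_diracOp_sub_freeOp_le (m := m) (hQ := hQ) hpos.le hN (F w) fun n hn => by
    have e0 := hw n (by push_cast; omega)
    have e1 := hw (n + 1) (by push_cast; rw [abs_le] at *; omega)
    have e2 := hw (n - 1) (by push_cast; rw [abs_le] at *; omega)
    ext i
    fin_cases i
    · simp only [F, freeOp, Fin.zero_eta, diracOp_apply, diracExpr_zero, e0, e1]; simp
    · simp only [F, freeOp, Fin.mk_one, diracOp_apply, diracExpr_one, e0, e2]; simp
  have e : T (T w) - F (F w) = T ((T - F) w) + (T - F) (F w) := by
    simp only [sub_apply, map_sub]; abel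
  rw [e]
  refine (norm_add_le _ _).trans ?_
  have h3 := (T.le_opNorm ((T - F) w)).trans (mul_le_mul_of_nonneg_left h1 (norm_nonneg _))
  have h4 := h2.trans (mul_le_mul_of_nonneg_left (F.le_opNorm w) (by positivity))
  refine (add_le_add h3 h4).trans ?_
  have : ‖T‖ * (4 * (ε / (4 * (‖T‖ + ‖F‖ + 1))) * ‖w‖) + 4 * (ε / (4 * (‖T‖ + ‖F‖ + 1))) * (‖F‖ * ‖w‖)
      = ε * ‖w‖ * ((‖T‖ + ‖F‖) / (‖T‖ + ‖F‖ + 1)) := by field_simp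
  rw [this]
  refine mul_le_of_le_one_right (by positivity) ?_
  rw [div_le_one (by positivity)]
  linarith

/-- A singular sequence sees only the free operator. -/
theorem tendsto_sq_sub (hQ0 : ∀ ε > 0, ∃ N : ℕ, ∀ n : ℤ, N < |n| → ∀ i j, |Q n i j| ≤ ε)
    {w : ℕ → SpinorL2} (hw : ∀ k, ‖w k‖ ≤ 1) (h0 : ∀ n, Tendsto (fun k => w k n) atTop (𝓝 0)) :
    Tendsto (fun k => diracOp m Q hQ (diracOp m Q hQ (w k)) - freeOp m (freeOp m (w k))) atTop
      (𝓝 0) := by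
  set K := diracOp m Q hQ * diracOp m Q hQ - freeOp m * freeOp m
  change Tendsto (fun k => K (w k)) atTop (𝓝 0)
  rw [Metric.tendsto_nhds]
  intro ε hε
  obtain ⟨N, hN⟩ := exists_norm_sq_sub_le (m := m) (hQ := hQ) hQ0 (half_pos hε)
  have h1 : Tendsto (fun k => K ((w k).trunc N)) atTop (𝓝 0) := by
    have := (K.continuous.tendsto 0).comp (SpinorL2.tendsto_trunc h0 N)
    rwa [map_zero] at this
  filter_upwards [Metric.tendsto_nhds.mp h1 (ε / 2) (half_pos hε)] with k hk
  rw [dist_zero_right] at hk ⊢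
  have h2 : ‖K (w k - (w k).trunc N)‖ ≤ ε / 2 := by
    refine (hN _ fun n hn => ?_).trans ?_
    · rw [lp.coeFn_sub, Pi.sub_apply, SpinorL2.trunc_apply, if_pos hn, sub_self]
    · exact mul_le_of_le_one_right (by positivity) (((w k).norm_sub_trunc_le N).trans (hw k))
  calc ‖K (w k)‖ = ‖K ((w k).trunc N) + K (w k - (w k).trunc N)‖ := by
        rw [← map_add, add_sub_cancel]
    _ ≤ _ := norm_add_le _ _
    _ < ε := by linarith

theorem finiteDimensional_of_sq_bound
    (hQ0 : ∀ ε > 0, ∃ N : ℕ, ∀ n : ℤ, N < |n| → ∀ i j, |Q n i j| ≤ ε)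
    (V : Submodule ℂ SpinorL2) {ε : ℝ} (hε : 0 < ε)
    (hV : ∀ w ∈ V, (2 + ε) * ‖w‖ ≤
      ‖diracOp m Q hQ (diracOp m Q hQ w) - ((m ^ 2 + 2 : ℝ) : ℂ) • w‖) :
    FiniteDimensional ℂ V := by
  obtain ⟨N, hN⟩ := exists_norm_sq_sub_le (m := m) (hQ := hQ) hQ0 (half_pos hε)
  let φ : V →ₗ[ℂ] (Finset.Icc (-N : ℤ) N → Spinor) :=
    { toFun := fun w n => (w : SpinorL2) n
      map_add' := fun w z => rfl
      map_smul' := fun c w => rfl }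
  refine FiniteDimensional.of_injective φ ?_
  rw [← LinearMap.ker_eq_bot, LinearMap.ker_eq_bot']
  rintro ⟨w, hw⟩ h
  have hz (n : ℤ) (hn : |n| ≤ N) : w n = 0 :=
    congrFun h ⟨n, Finset.mem_Icc.mpr (abs_le.mp hn)⟩
  have h1 := hV w hw
  have h2 := hN w hz
  have h3 := norm_freeOp_sq_le (m := m) w
  have h4 := norm_add_le (diracOp m Q hQ (diracOp m Q hQ w) - freeOp m (freeOp m w))
    (freeOp m (freeOp m w) - ((m ^ 2 + 2 : ℝ) : ℂ) • w)
  rw [sub_add_sub_cancel] at h4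
  have h5 : ‖w‖ ≤ 0 := by nlinarith
  exact Subtype.ext (norm_le_zero_iff.mp h5)

theorem IsSelfAdjoint.isUnit_of_bound {E : Type*} [NormedAddCommGroup E] [InnerProductSpace ℂ E]
    [CompleteSpace E] {A : E →L[ℂ] E} (hA : IsSelfAdjoint A) {c : ℝ} (hc : 0 < c)
    (h : ∀ x, c * ‖x‖ ≤ ‖A x‖) : IsUnit A := by
  have hker : A.ker = ⊥ := by
    rw [LinearMap.ker_eq_bot']
    intro x hx
    have := h x
    rw [show A x = 0 from hx, norm_zero] at this
    exact norm_le_zero_iff.mp (by nlinarith)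
  have hanti : AntilipschitzWith (Real.toNNReal c⁻¹) A := by
    refine AddMonoidHomClass.antilipschitz_of_bound A fun x => ?_
    rw [Real.coe_toNNReal _ (by positivity), inv_mul_eq_div, le_div_iff₀ hc]
    linarith [h x]
  refine ContinuousLinearMap.isUnit_iff_bijective.mpr ⟨hanti.injective, ?_⟩
  have hcl : IsClosed (A.range : Set E) := by
    rw [LinearMap.coe_range]
    exact hanti.isClosed_range A.uniformContinuous
  have hd : A.range.topologicalClosure = ⊤ := by
    rw [Submodule.topologicalClosure_eq_top_iff, ContinuousLinearMap.orthogonal_range, hA.adjoint_eq,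
      hker]
  rw [IsClosed.submodule_topologicalClosure_eq hcl] at hd
  exact LinearMap.range_eq_top.mp hd

/-- A real point away from the free spectrum at which all point sources have square summable
responses is in the resolvent set. -/
theorem notMem_spectrum_of_green (hsymm : ∀ n, Q n 0 1 = Q n 1 0)
    (hQ0 : ∀ ε > 0, ∃ N : ℕ, ∀ n : ℤ, N < |n| → ∀ i j, |Q n i j| ≤ ε)
    {μ : ℝ} (hμ : 2 < |μ ^ 2 - (m ^ 2 + 2)|)
    (hg : ∀ (k : ℤ) (j : Fin 2), ∃ g : SpinorL2,
      diracOp m Q hQ g - (μ : ℂ) • g = lp.single 2 k (EuclideanSpace.single j 1)) :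
    (μ : ℂ) ∉ spectrum ℂ (diracOp m Q hQ) := by
  set T := diracOp m Q hQ with hT
  have hTs : IsSelfAdjoint T := isSelfAdjoint_diracOp hsymm
  set A : SpinorL2 →L[ℂ] SpinorL2 := T - algebraMap ℂ _ (μ : ℂ) with hA
  have hAs : IsSelfAdjoint A := by
    refine hTs.sub ?_
    rw [IsSelfAdjoint, ← algebraMap_star_comm]
    congr 1
    exact Complex.conj_ofReal μ
  have hAapp (x : SpinorL2) : A x = T x - (μ : ℂ) • x := by
    rw [hA, sub_apply, Algebra.algebraMap_eq_smul_one]; rfl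
  rw [spectrum.notMem_iff]
  suffices h : IsUnit A by
    rw [hA] at h
    rw [← neg_sub]
    exact h.neg
  by_contra hu
  have hnb (k : ℕ) : ∃ w : SpinorL2, ‖w‖ = 1 ∧ ‖A w‖ < 1 / ((k : ℝ) + 1) := by
    by_contra! hcon
    refine hu (hAs.isUnit_of_bound (c := 1 / ((k : ℝ) + 1)) (by positivity) fun x => ?_)
    rcases eq_or_ne x 0 with rfl | hx
    · simp
    · have hx' : ‖x‖ ≠ 0 := norm_ne_zero_iff.mpr hx
      have h1 := hcon ((‖x‖⁻¹ : ℂ) • x) (by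
        rw [norm_smul, norm_inv, Complex.norm_real, norm_norm, inv_mul_cancel₀ hx'])
      rw [map_smul, norm_smul, norm_inv, Complex.norm_real, norm_norm, inv_mul_eq_div,
        le_div_iff₀ (by positivity)] at h1
      exact h1
  choose w hw1 hw2 using hnb
  have hA0 : Tendsto (fun k => A (w k)) atTop (𝓝 0) :=
    squeeze_zero_norm (fun k => (hw2 k).le) tendsto_one_div_add_atTop_nhds_zero_nat
  have hpt (n : ℤ) : Tendsto (fun k => w k n) atTop (𝓝 0) := by
    have hcoord (j : Fin 2) : Tendsto (fun k => w k n j) atTop (𝓝 0) := by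
      obtain ⟨g, hgn⟩ := hg n j
      have e (k : ℕ) : inner ℂ g (A (w k)) = w k n j := by
        rw [← ContinuousLinearMap.adjoint_inner_left, hAs.adjoint_eq, hAapp, hgn,
          lp.inner_single_left, spinor_inner]
        fin_cases j <;> simp
      have := (tendsto_const_nhds (x := g)).inner (𝕜 := ℂ) hA0
      rw [inner_zero_right] at this
      exact this.congr e
    rw [tendsto_zero_iff_norm_tendsto_zero]
    refine squeeze_zero (fun k => norm_nonneg _) (fun k => DiracData.spinor_norm_le _) ?_
    simpa using (hcoord 0).norm.add (hcoord 1).norm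
  have hsq := tendsto_sq_sub (m := m) (hQ := hQ) hQ0 (fun k => (hw1 k).le) hpt
  have hfac : Tendsto (fun k => T (A (w k)) + (μ : ℂ) • A (w k)) atTop (𝓝 0) := by
    simpa using ((T.continuous.tendsto 0).comp hA0).add (hA0.const_smul (μ : ℂ))
  have hlim : Tendsto (fun k => ‖T (A (w k)) + (μ : ℂ) • A (w k)‖ +
      ‖T (T (w k)) - freeOp m (freeOp m (w k))‖) atTop (𝓝 0) := by
    simpa using hfac.norm.add hsq.norm
  have hge (k : ℕ) : |μ ^ 2 - (m ^ 2 + 2)| - 2 ≤ ‖T (A (w k)) + (μ : ℂ) • A (w k)‖ +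
      ‖T (T (w k)) - freeOp m (freeOp m (w k))‖ := by
    have h1 := norm_freeOp_sq_le (m := m) (w k)
    have e : ((μ ^ 2 - (m ^ 2 + 2) : ℝ) : ℂ) • w k = (T (T (w k)) - freeOp m (freeOp m (w k))) +
        (freeOp m (freeOp m (w k)) - ((m ^ 2 + 2 : ℝ) : ℂ) • w k) -
        (T (A (w k)) + (μ : ℂ) • A (w k)) := by
      simp only [hAapp, map_sub, map_smul, smul_sub, smul_smul]
      push_cast
      rw [sub_smul, pow_two]
      abel
    have h2 : ‖((μ ^ 2 - (m ^ 2 + 2) : ℝ) : ℂ) • w k‖ = |μ ^ 2 - (m ^ 2 + 2)| := by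
      rw [norm_smul, hw1, mul_one, Complex.norm_real, Real.norm_eq_abs]
    rw [e] at h2
    have h3 := norm_sub_le ((T (T (w k)) - freeOp m (freeOp m (w k))) +
        (freeOp m (freeOp m (w k)) - ((m ^ 2 + 2 : ℝ) : ℂ) • w k)) (T (A (w k)) + (μ : ℂ) • A (w k))
    have h4 := norm_add_le (T (T (w k)) - freeOp m (freeOp m (w k)))
        (freeOp m (freeOp m (w k)) - ((m ^ 2 + 2 : ℝ) : ℂ) • w k)
    rw [hw1 k] at h1
    linarith
  have := ge_of_tendsto' hlim hge
  linarith

end Operator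

section Contour

/-- The density `exp (-i t λ) dλ/dζ` along a branch `λ` of the dispersion relation. -/
noncomputable def branchDensity (m s t : ℝ) (ζ : ℂ) : ℂ :=
  Complex.exp (-Complex.I * t * branch m s ζ) * (Complex.sin ζ / branch m s ζ)

theorem branch_neg (m s : ℝ) (ζ : ℂ) : branch m (-s) ζ = -branch m s ζ := by
  rw [branch, branch, Complex.ofReal_neg, neg_mul]

theorem horizontal_mem_strip {η b : ℝ} (hb : 0 < b) (hbη : b < η) (θ : ℝ) :
    (θ + b * Complex.I : ℂ) ∈ strip η := by
  simp [strip, abs_of_pos hb, hbη]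

variable {m η b : ℝ}

theorem hasDerivAt_horizontal (b θ : ℝ) :
    HasDerivAt (fun x : ℝ => (x + b * Complex.I : ℂ)) 1 θ :=
  (Complex.ofRealCLM.hasDerivAt (x := θ)).add_const _

theorem continuous_branch_horizontal {s : ℝ} (hs : s ^ 2 = 1) (hη : Real.cosh η < 1 + m ^ 2 / 2)
    (hb : 0 < b) (hbη : b < η) : Continuous fun θ : ℝ => branch m s (θ + b * Complex.I) :=
  (branch_differentiableOn hs hη).continuousOn.comp_continuous (by fun_prop)
    fun θ => horizontal_mem_strip hb hbη θ

theorem continuous_branchDensity_horizontal {s : ℝ} (hs : s ^ 2 = 1)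
    (hη : Real.cosh η < 1 + m ^ 2 / 2) (hb : 0 < b) (hbη : b < η) (t : ℝ) :
    Continuous fun θ : ℝ => branchDensity m s t (θ + b * Complex.I) := by
  have h := continuous_branch_horizontal hs hη hb hbη
  unfold branchDensity
  refine Continuous.mul (by fun_prop) (Continuous.div (by fun_prop) h fun θ => ?_)
  exact branch_ne_zero hs hη (horizontal_mem_strip hb hbη θ)

/-- In a Cauchy integral along a closed contour, a holomorphic weight may be evaluated at the
pole. -/
theorem integral_branchDensity_div {s : ℝ} (hs : s ^ 2 = 1) (hη : Real.cosh η < 1 + m ^ 2 / 2)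
    (hb : 0 < b) (hbη : b < η) (t : ℝ) {μ : ℂ}
    (hne : ∀ θ : ℝ, branch m s (θ + b * Complex.I) ≠ μ) :
    ∫ θ : ℝ in 0..2 * Real.pi, branchDensity m s t (θ + b * Complex.I) *
        (branch m s (θ + b * Complex.I) - μ)⁻¹ =
      Complex.exp (-Complex.I * t * μ) * ∫ θ : ℝ in 0..2 * Real.pi,
        branchDensity m s 0 (θ + b * Complex.I) * (branch m s (θ + b * Complex.I) - μ)⁻¹ := by
  set f : ℂ → ℂ := fun z => Complex.exp (-Complex.I * t * z) with hf
  have hfd : Differentiable ℂ f := by fun_prop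
  have hds : DifferentiableOn ℂ (dslope f μ) Set.univ :=
    (Complex.differentiableOn_dslope Filter.univ_mem).mpr hfd.differentiableOn
  obtain ⟨G, hG⟩ := Complex.IsConservativeOn.isExactOn_univ
    (continuousOn_univ.mp hds.continuousOn) hds.isConservativeOn
  have hcb := continuous_branch_horizontal hs hη hb hbη
  have hcd (t : ℝ) := continuous_branchDensity_horizontal hs hη hb hbη t
  have hci : Continuous fun θ : ℝ => (branch m s (θ + b * Complex.I) - μ)⁻¹ :=
    (hcb.sub continuous_const).inv₀ fun θ => sub_ne_zero.mpr (hne θ)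
  have hder (θ : ℝ) : HasDerivAt (fun x : ℝ => G (branch m s (x + b * Complex.I)))
      (branchDensity m s 0 (θ + b * Complex.I) * dslope f μ (branch m s (θ + b * Complex.I))) θ := by
    have h1 := (hG (branch m s (θ + b * Complex.I)) trivial).comp (θ + b * Complex.I)
      (hasDerivAt_branch hs hη (horizontal_mem_strip hb hbη θ))
    refine (h1.comp θ (hasDerivAt_horizontal b θ)).congr_deriv ?_
    rw [branchDensity]
    simp [mul_comm]
  have hzero := intervalIntegral.integral_eq_sub_of_hasDerivAt (a := 0) (b := 2 * Real.pi)
    (fun θ _ => hder θ) (((hcd 0).mul ((continuousOn_univ.mp hds.continuousOn).comp hcb)).intervalIntegrable _ _)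
  have hper : branch m s ((2 * Real.pi : ℝ) + b * Complex.I) = branch m s ((0 : ℝ) + b * Complex.I) := by
    rw [← branch_add_two_pi m s ((0 : ℝ) + b * Complex.I)]
    congr 1; push_cast; ring
  rw [hper, sub_self] at hzero
  rw [← intervalIntegral.integral_const_mul, ← sub_eq_zero, ← intervalIntegral.integral_sub]
  · rw [← hzero]
    refine intervalIntegral.integral_congr fun θ _ => ?_
    have h1 := sub_smul_dslope f μ (branch m s (θ + b * Complex.I))
    have h2 : branch m s (θ + b * Complex.I) - μ ≠ 0 := sub_ne_zero.mpr (hne θ)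
    rw [smul_eq_mul, mul_comm, ← eq_div_iff h2] at h1
    rw [h1]
    simp only [hf, branchDensity, Complex.ofReal_zero, mul_zero, zero_mul, Complex.exp_zero]
    field_simp
  · exact ((hcd t).mul hci).intervalIntegrable _ _
  · exact (continuous_const.mul ((hcd 0).mul hci)).intervalIntegrable _ _

theorem circleIntegral_inv_sub_add {R : ℝ} (hR : 0 < R) (hR1 : R < 1) {z₀ : ℂ} (h0 : z₀ ≠ 0)
    (hz : ‖z₀‖ = 1 ∨ ‖z₀‖ < R) :
    (∮ z in C(0, R), (-(z - 0)⁻¹ + (z - z₀)⁻¹ + (z - z₀⁻¹)⁻¹)) =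
      if ‖z₀‖ = 1 then -(2 * Real.pi * Complex.I) else 0 := by
  have hci (w : ℂ) (hw : ‖w‖ ≠ R) : CircleIntegrable (fun z => (z - w)⁻¹) 0 R := by
    refine circleIntegrable_sub_inv_iff.mpr (Or.inr ?_)
    rwa [mem_sphere_zero_iff_norm, abs_of_pos hR]
  have hout (w : ℂ) (hw : R < ‖w‖) : (∮ z in C(0, R), (z - w)⁻¹) = 0 := by
    have hne (z : ℂ) (hz : z ∈ Metric.closedBall (0 : ℂ) R) : z - w ≠ 0 := fun h => by
      rw [mem_closedBall_zero_iff, sub_eq_zero.mp h] at hz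
      linarith
    refine Complex.circleIntegral_eq_zero_of_differentiable_on_off_countable hR.le
      Set.countable_empty (ContinuousOn.inv₀ (by fun_prop) hne) fun z hz => ?_
    exact (differentiableAt_id.sub_const w).inv (hne z (Metric.ball_subset_closedBall hz.1))
  have hin (w : ℂ) (hw : ‖w‖ < R) : (∮ z in C(0, R), (z - w)⁻¹) = 2 * Real.pi * Complex.I :=
    circleIntegral.integral_sub_inv_of_mem_ball (by simpa using hw)
  have h1 : ‖(0 : ℂ)‖ ≠ R := by rw [norm_zero]; exact hR.ne
  have hinv : R < ‖z₀⁻¹‖ := by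
    rw [norm_inv]
    refine hR1.trans_le ((one_le_inv₀ (norm_pos_iff.mpr h0)).mpr ?_)
    rcases hz with h | h <;> linarith
  have h2 : ‖z₀‖ ≠ R := by rcases hz with h | h <;> linarith
  have hneg : (∮ z in C(0, R), -(z - (0 : ℂ))⁻¹) = -(2 * Real.pi * Complex.I) := by
    have := circleIntegral.integral_const_mul (-1 : ℂ) (fun z : ℂ => (z - 0)⁻¹) 0 R
    simp only [neg_one_mul] at this
    rw [this, hin 0 (by rwa [norm_zero])]
  rw [circleIntegral.integral_add (f := fun z => -(z - 0)⁻¹ + (z - z₀)⁻¹)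
      ((hci 0 h1).neg.add (hci _ h2)) (hci _ hinv.ne'),
    circleIntegral.integral_add (f := fun z => -(z - 0)⁻¹) (hci 0 h1).neg (hci _ h2), hneg,
    hout _ hinv]
  split_ifs with h
  · rw [hout _ (by rw [h]; exact hR1)]; ring
  · rw [hin _ (hz.resolve_left h)]; ring

theorem sum_branchDensity_div (hη : Real.cosh η < 1 + m ^ 2 / 2) {ζ μ z₀ : ℂ} (hζ : ζ ∈ strip η)
    (h0 : z₀ ≠ 0) (hz : (m : ℂ) ^ 2 + 2 - μ ^ 2 = z₀ + z₀⁻¹)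
    (h1 : branch m 1 ζ ≠ μ) (h2 : branch m (-1) ζ ≠ μ) (h3 : Complex.exp (Complex.I * ζ) ≠ z₀)
    (h4 : Complex.exp (Complex.I * ζ) ≠ z₀⁻¹) :
    branchDensity m 1 0 ζ * (branch m 1 ζ - μ)⁻¹ +
        branchDensity m (-1) 0 ζ * (branch m (-1) ζ - μ)⁻¹ =
      Complex.exp (Complex.I * ζ) * Complex.I * (-(Complex.exp (Complex.I * ζ) - 0)⁻¹ +
        (Complex.exp (Complex.I * ζ) - z₀)⁻¹ + (Complex.exp (Complex.I * ζ) - z₀⁻¹)⁻¹) := by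
  set z := Complex.exp (Complex.I * ζ) with hzdef
  have hz0 : z ≠ 0 := Complex.exp_ne_zero _
  have hsq := branch_sq (m := m) (s := 1) (by norm_num) ζ
  have hb0 := branch_ne_zero (m := m) (s := 1) (by norm_num) hη hζ
  rw [branch_neg] at h2 ⊢
  set l := branch m 1 ζ
  have hcos : 2 * Complex.cos ζ = z + z⁻¹ := by rw [two_cos_eq, Complex.exp_neg]
  have hsin : 2 * Complex.sin ζ = -Complex.I * (z - z⁻¹) := by
    rw [Complex.two_sin, hzdef, ← Complex.exp_neg]
    ring_nf
  have e1 : l - μ ≠ 0 := sub_ne_zero.mpr h1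
  have e2 : -l - μ ≠ 0 := sub_ne_zero.mpr h2
  have e3 : z - z₀ ≠ 0 := sub_ne_zero.mpr h3
  have e4 : z - z₀⁻¹ ≠ 0 := sub_ne_zero.mpr h4
  have hl : branchDensity m 1 0 ζ * (l - μ)⁻¹ + branchDensity m (-1) 0 ζ * (-l - μ)⁻¹ =
      2 * Complex.sin ζ / (l ^ 2 - μ ^ 2) := by
    have e5 : l ^ 2 - μ ^ 2 ≠ 0 := by
      have : l ^ 2 - μ ^ 2 = -((l - μ) * (-l - μ)) := by ring
      rw [this]; exact neg_ne_zero.mpr (mul_ne_zero e1 e2)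
    simp only [branchDensity, branch_neg, Complex.ofReal_zero, mul_zero, zero_mul,
      Complex.exp_zero, one_mul]
    change Complex.sin ζ / l * (l - μ)⁻¹ + Complex.sin ζ / -l * (-l - μ)⁻¹ = _
    rw [eq_div_iff e5]
    field_simp
    ring
  have hden : l ^ 2 - μ ^ 2 = -((z - z₀) * (z - z₀⁻¹)) / z := by
    rw [eq_div_iff hz0, hsq, dispSq]
    have : (z - z₀) * (z - z₀⁻¹) = z ^ 2 - (z₀ + z₀⁻¹) * z + 1 := by field_simp; ring
    rw [this, ← hz]
    have hzz : z⁻¹ * z = 1 := inv_mul_cancel₀ hz0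
    linear_combination (-z) * hcos - hzz
  rw [hl, hden, hsin, sub_zero, div_div_eq_mul_div, div_eq_iff (neg_ne_zero.mpr (mul_ne_zero e3 e4))]
  have e6 : z * z₀ - 1 ≠ 0 := fun h => e4 (by field_simp; linear_combination h)
  have e7 : z - z₀⁻¹ = (z * z₀ - 1) / z₀ := by field_simp
  rw [e7]
  field_simp
  ring

/-- The Cauchy integral over both branches is the spectral density of the bands. -/
theorem integral_sum_branchDensity_div (hη : Real.cosh η < 1 + m ^ 2 / 2)
    (hb : 0 < b) (hbη : b < η) (t : ℝ) {μ z₀ : ℂ} (h0 : z₀ ≠ 0)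
    (hz : (m : ℂ) ^ 2 + 2 - μ ^ 2 = z₀ + z₀⁻¹) (hcase : ‖z₀‖ = 1 ∨ ‖z₀‖ < Real.exp (-b))
    (h1 : ∀ θ : ℝ, branch m 1 (θ + b * Complex.I) ≠ μ)
    (h2 : ∀ θ : ℝ, branch m (-1) (θ + b * Complex.I) ≠ μ) :
    ∫ θ : ℝ in 0..2 * Real.pi,
      (branchDensity m 1 t (θ + b * Complex.I) * (branch m 1 (θ + b * Complex.I) - μ)⁻¹ +
      branchDensity m (-1) t (θ + b * Complex.I) * (branch m (-1) (θ + b * Complex.I) - μ)⁻¹) =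
      if ‖z₀‖ = 1 then -(2 * Real.pi * Complex.I) * Complex.exp (-Complex.I * t * μ) else 0 := by
  have hci (s : ℝ) (hs : s ^ 2 = 1) (h : ∀ θ : ℝ, branch m s (θ + b * Complex.I) ≠ μ) (t : ℝ) :
      IntervalIntegrable (fun θ : ℝ => branchDensity m s t (θ + b * Complex.I) *
        (branch m s (θ + b * Complex.I) - μ)⁻¹) volume 0 (2 * Real.pi) :=
    ((continuous_branchDensity_horizontal hs hη hb hbη t).mul
      (((continuous_branch_horizontal hs hη hb hbη).sub continuous_const).inv₀
        fun θ => sub_ne_zero.mpr (h θ))).intervalIntegrable _ _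
  rw [intervalIntegral.integral_add (hci 1 (by norm_num) h1 t) (hci (-1) (by norm_num) h2 t),
    integral_branchDensity_div (by norm_num) hη hb hbη t h1,
    integral_branchDensity_div (by norm_num) hη hb hbη t h2, ← mul_add,
    ← intervalIntegral.integral_add (hci 1 (by norm_num) h1 0) (hci (-1) (by norm_num) h2 0)]
  have hR1 : Real.exp (-b) < 1 := (Real.exp_lt_exp.mpr (neg_lt_zero.mpr hb)).trans_eq Real.exp_zero
  have hcirc := circleIntegral_inv_sub_add (Real.exp_pos (-b)) hR1 h0 hcase
  have hexp (θ : ℝ) : Complex.exp (Complex.I * (θ + b * Complex.I)) =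
      circleMap 0 (Real.exp (-b)) θ := by
    rw [circleMap, zero_add, Complex.ofReal_exp, ← Complex.exp_add]
    congr 1
    push_cast
    linear_combination (b : ℂ) * Complex.I_sq
  have hnorm (θ : ℝ) : ‖circleMap 0 (Real.exp (-b)) θ‖ = Real.exp (-b) := by
    rw [norm_circleMap_zero, abs_of_pos (Real.exp_pos _)]
  have hint : ∫ θ : ℝ in 0..2 * Real.pi,
      (branchDensity m 1 0 (θ + b * Complex.I) * (branch m 1 (θ + b * Complex.I) - μ)⁻¹ +
      branchDensity m (-1) 0 (θ + b * Complex.I) * (branch m (-1) (θ + b * Complex.I) - μ)⁻¹) =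
      ∮ z in C(0, Real.exp (-b)), (-(z - 0)⁻¹ + (z - z₀)⁻¹ + (z - z₀⁻¹)⁻¹) := by
    rw [circleIntegral]
    refine intervalIntegral.integral_congr fun θ _ => ?_
    have hn0 : 0 < ‖z₀‖ := norm_pos_iff.mpr h0
    have := sum_branchDensity_div hη (horizontal_mem_strip hb hbη θ) h0 hz (h1 θ) (h2 θ)
      (fun h => by
        rw [hexp] at h
        have := hnorm θ
        rw [h] at this
        rcases hcase with h | h <;> linarith)
      (fun h => by
        rw [hexp] at h
        have := hnorm θ
        rw [h, norm_inv] at this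
        have h1 : 1 ≤ ‖z₀‖⁻¹ := (one_le_inv₀ hn0).mpr (by rcases hcase with h | h <;> linarith)
        linarith)
    simp only [this, hexp, deriv_circleMap, smul_eq_mul]
  rw [hint, hcirc]
  split_ifs <;> ring

end Contour

/-- The indicator of the bands `|μ² - m² - 2| ≤ 2`. -/
noncomputable def bandInd (m : ℝ) (μ : ℂ) : ℂ := if ‖(m : ℂ) ^ 2 + 2 - μ ^ 2‖ ≤ 2 then 1 else 0

theorem bandInd_mul_self (m : ℝ) (μ : ℂ) : bandInd m μ * bandInd m μ = bandInd m μ := by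
  unfold bandInd; split_ifs <;> simp

theorem star_bandInd (m : ℝ) (μ : ℂ) : star (bandInd m μ) = bandInd m μ := by
  unfold bandInd; split_ifs <;> simp

theorem exists_joukowski_root (c : ℝ) : ∃ z : ℂ, z ≠ 0 ∧ (c : ℂ) = z + z⁻¹ ∧
    (‖z‖ = 1 ↔ |c| ≤ 2) ∧ ‖z‖ ≤ 1 := by
  rcases le_or_gt |c| 2 with hc | hc
  · obtain ⟨h1, h2⟩ := abs_le.mp hc
    refine ⟨Complex.exp (Complex.I * (Real.arccos (c / 2) : ℝ)), Complex.exp_ne_zero _, ?_, ?_, ?_⟩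
    · rw [← Complex.exp_neg, ← two_cos_eq, ← Complex.ofReal_cos, Real.cos_arccos] <;> first | linarith | (push_cast; ring)
    · rw [mul_comm, Complex.norm_exp_ofReal_mul_I]; simp [hc]
    · rw [mul_comm, Complex.norm_exp_ofReal_mul_I]
  · have hc2 : 4 < c ^ 2 := by
      have := sq_lt_sq' (by linarith) hc
      rw [sq_abs] at this
      linarith
    have key (x : ℝ) (hx : x ^ 2 - c * x + 1 = 0) (hx1 : |x| ≤ 1) : ∃ z : ℂ, z ≠ 0 ∧
        (c : ℂ) = z + z⁻¹ ∧ (‖z‖ = 1 ↔ |c| ≤ 2) ∧ ‖z‖ ≤ 1 := by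
      have hx0 : x ≠ 0 := by rintro rfl; norm_num at hx
      refine ⟨x, by exact_mod_cast hx0, ?_, ?_, by simpa using hx1⟩
      · have : c = x + x⁻¹ := by field_simp; linarith
        exact_mod_cast this
      · refine iff_of_false (fun h => ?_) (not_le.mpr hc)
        rw [Complex.norm_real, Real.norm_eq_abs] at h
        have h2 : x ^ 2 = 1 := by rw [← sq_abs, h, one_pow]
        nlinarith
    have hr := Real.sq_sqrt (show 0 ≤ c ^ 2 - 4 by linarith)
    set r := √(c ^ 2 - 4)
    rcases le_total |(c + r) / 2| 1 with h | h
    · exact key _ (by nlinarith) h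
    · refine key ((c - r) / 2) (by nlinarith) ?_
      have : |(c + r) / 2| * |(c - r) / 2| = 1 := by
        rw [← abs_mul, show (c + r) / 2 * ((c - r) / 2) = 1 by nlinarith, abs_one]
      nlinarith [abs_nonneg ((c - r) / 2)]

section Spectral

variable {H : Type*} [NormedAddCommGroup H] [InnerProductSpace ℂ H] [CompleteSpace H]
  {T : H →L[ℂ] H} {m η b : ℝ}

theorem cfc_resolvent_apply (hT : IsSelfAdjoint T) {l : ℂ} (hl : l ∉ spectrum ℂ T) {x y : H}
    (h : l • x - T x = y) : cfc (fun μ => (l - μ)⁻¹) T y = x := by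
  have hne (μ : ℂ) (hμ : μ ∈ spectrum ℂ T) : l - μ ≠ 0 := fun h => hl (sub_eq_zero.mp h ▸ hμ)
  have hc : ContinuousOn (fun μ => l - μ) (spectrum ℂ T) := by fun_prop
  have hT' : IsStarNormal T := hT.isStarNormal
  have h1 : cfc (fun μ => (l - μ)⁻¹) T * cfc (fun μ => l - μ) T = 1 := by
    rw [← cfc_mul (fun μ => (l - μ)⁻¹) (fun μ => l - μ) T (hc.inv₀ hne) hc, ← cfc_one (R := ℂ) T]
    exact cfc_congr fun μ hμ => inv_mul_cancel₀ (hne μ hμ)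
  have h2 : cfc (fun μ => l - μ) T = algebraMap ℂ _ l - T := by
    rw [cfc_sub _ _ T (by fun_prop) (by fun_prop), cfc_const l T, cfc_id' ℂ T]
  rw [h2] at h1
  have h3 := congrArg (fun A : H →L[ℂ] H => A x) h1
  rw [← h]
  rw [Algebra.algebraMap_eq_smul_one] at h3
  exact h3

/-- The Cauchy kernel of the contour surrounding the bands at height `b`. -/
noncomputable def contourKernel (m b t θ : ℝ) (μ : ℂ) : ℂ :=
  branchDensity m 1 t (θ + b * Complex.I) * (branch m 1 (θ + b * Complex.I) - μ)⁻¹ +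
    branchDensity m (-1) t (θ + b * Complex.I) * (branch m (-1) (θ + b * Complex.I) - μ)⁻¹

/-- The contour at height `b` separates the bands from the rest of the spectrum. -/
structure IsSeparatingHeight (T : H →L[ℂ] H) (m η b : ℝ) : Prop where
  cosh_lt : Real.cosh η < 1 + m ^ 2 / 2
  pos : 0 < b
  lt : b < η
  notMem : ∀ s : ℝ, s ^ 2 = 1 → ∀ θ : ℝ, branch m s (θ + b * Complex.I) ∉ spectrum ℂ T
  root : ∀ μ ∈ spectrum ℂ T, ∃ z : ℂ, z ≠ 0 ∧ (m : ℂ) ^ 2 + 2 - μ ^ 2 = z + z⁻¹ ∧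
    (‖z‖ = 1 ↔ ‖(m : ℂ) ^ 2 + 2 - μ ^ 2‖ ≤ 2) ∧ (‖z‖ = 1 ∨ ‖z‖ < Real.exp (-b))

namespace IsSeparatingHeight

theorem ne (h : IsSeparatingHeight T m η b) {s : ℝ} (hs : s ^ 2 = 1) {μ : ℂ}
    (hμ : μ ∈ spectrum ℂ T) (θ : ℝ) : branch m s (θ + b * Complex.I) ≠ μ :=
  fun e => h.notMem s hs θ (e ▸ hμ)

theorem integral_contourKernel (h : IsSeparatingHeight T m η b) (t : ℝ) {μ : ℂ}
    (hμ : μ ∈ spectrum ℂ T) : ∫ θ : ℝ in 0..2 * Real.pi, contourKernel m b t θ μ =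
      -(2 * Real.pi * Complex.I) * (Complex.exp (-Complex.I * t * μ) * bandInd m μ) := by
  obtain ⟨z, h0, hz, hiff, hcase⟩ := h.root μ hμ
  unfold contourKernel
  rw [integral_sum_branchDensity_div h.cosh_lt h.pos h.lt t h0 hz hcase
    (h.ne (by norm_num) hμ) (h.ne (by norm_num) hμ), bandInd]
  by_cases hb : ‖(m : ℂ) ^ 2 + 2 - μ ^ 2‖ ≤ 2
  · rw [if_pos (hiff.mpr hb), if_pos hb]; ring
  · rw [if_neg fun h => hb (hiff.mp h), if_neg hb]; ring

theorem continuous_contourKernel (h : IsSeparatingHeight T m η b) (t : ℝ) :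
    ContinuousOn (Function.uncurry (contourKernel m b t)) (Set.univ ×ˢ spectrum ℂ T) := by
  have hterm (s : ℝ) (hs : s ^ 2 = 1) : ContinuousOn (fun p : ℝ × ℂ =>
      branchDensity m s t (p.1 + b * Complex.I) * (branch m s (p.1 + b * Complex.I) - p.2)⁻¹)
      (Set.univ ×ˢ spectrum ℂ T) := by
    have h1 := (continuous_branchDensity_horizontal hs h.cosh_lt h.pos h.lt t).comp
      (continuous_fst (X := ℝ) (Y := ℂ))
    have h2 := ((continuous_branch_horizontal hs h.cosh_lt h.pos h.lt).comp
      (continuous_fst (X := ℝ) (Y := ℂ))).sub continuous_snd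
    exact h1.continuousOn.mul (h2.continuousOn.inv₀ fun p hp => sub_ne_zero.mpr (h.ne hs hp.2 p.1))
  exact (hterm 1 (by norm_num)).add (hterm (-1) (by norm_num))

theorem continuousOn_integral (h : IsSeparatingHeight T m η b) (t : ℝ) :
    ContinuousOn (fun μ => ∫ θ : ℝ in 0..2 * Real.pi, contourKernel m b t θ μ) (spectrum ℂ T) := by
  rw [continuousOn_iff_continuous_domRestrict]
  refine intervalIntegral.continuous_parametric_intervalIntegral_of_continuous'
    (f := fun (μ : spectrum ℂ T) θ => contourKernel m b t θ μ) ?_ _ _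
  exact (h.continuous_contourKernel t).comp_continuous
    (f := fun p : spectrum ℂ T × ℝ => (p.2, (p.1 : ℂ))) (by fun_prop) fun p => ⟨trivial, p.1.2⟩

theorem two_pi_I_ne_zero : -(2 * Real.pi * Complex.I) ≠ 0 := by
  simp [Real.pi_ne_zero]

theorem continuousOn_bandInd (h : IsSeparatingHeight T m η b) :
    ContinuousOn (bandInd m) (spectrum ℂ T) := by
  refine (((h.continuousOn_integral 0).const_smul (-(2 * Real.pi * Complex.I))⁻¹)).congr
    fun μ hμ => ?_
  rw [Pi.smul_apply, h.integral_contourKernel 0 hμ, smul_eq_mul, ← mul_assoc,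
    inv_mul_cancel₀ two_pi_I_ne_zero]
  simp

theorem exp_eq_cfc (hT : IsSelfAdjoint T) (t : ℝ) :
    NormedSpace.exp ((-Complex.I * (t : ℂ)) • T) = cfc (fun μ => Complex.exp (-Complex.I * t * μ)) T := by
  have hT' : IsStarNormal T := hT.isStarNormal
  have hn : IsStarNormal ((-Complex.I * (t : ℂ)) • T) := by
    have := cfc_predicate (p := IsStarNormal) (fun μ : ℂ => (-Complex.I * (t : ℂ)) • μ) T
    rwa [cfc_smul_id (R := ℂ) (-Complex.I * (t : ℂ)) T] at this
  rw [← CFC.complex_exp_eq_normedSpace_exp hn, ← cfc_comp_smul (-Complex.I * (t : ℂ)) Complex.exp T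
    (by fun_prop)]
  rfl

theorem exists_bound (h : IsSeparatingHeight T m η b) (t : ℝ) :
    ∃ C : ℝ, ∀ θ ∈ Set.Ioc 0 (2 * Real.pi), ∀ μ ∈ spectrum ℂ T, ‖contourKernel m b t θ μ‖ ≤ C := by
  have hK : IsCompact (Set.Icc 0 (2 * Real.pi) ×ˢ spectrum ℂ T) :=
    isCompact_Icc.prod (spectrum.isCompact T)
  obtain ⟨C, hC⟩ := hK.exists_bound_of_continuousOn
    ((h.continuous_contourKernel t).mono (Set.prod_mono (Set.subset_univ _) subset_rfl))
  exact ⟨C, fun θ hθ μ hμ => hC (θ, μ) ⟨Set.Ioc_subset_Icc_self hθ, hμ⟩⟩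

/-- Stone's formula for the propagator on the bands. -/
theorem exp_mul_cfc_bandInd (h : IsSeparatingHeight T m η b) (hT : IsSelfAdjoint T) (t : ℝ) :
    IntegrableOn (fun θ => cfc (contourKernel m b t θ) T) (Set.Ioc 0 (2 * Real.pi)) ∧
    NormedSpace.exp ((-Complex.I * (t : ℂ)) • T) * cfc (bandInd m) T =
      (Complex.I / (2 * Real.pi)) • ∫ θ in Set.Ioc 0 (2 * Real.pi), cfc (contourKernel m b t θ) T := by
  have hT' : IsStarNormal T := hT.isStarNormal
  obtain ⟨C, hC⟩ := h.exists_bound t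
  have hcont := (h.continuous_contourKernel t).mono
    (Set.prod_mono (Set.subset_univ (Set.Ioc 0 (2 * Real.pi))) subset_rfl)
  have hbd : ∀ᵐ θ ∂volume.restrict (Set.Ioc 0 (2 * Real.pi)), ∀ μ ∈ spectrum ℂ T,
      ‖contourKernel m b t θ μ‖ ≤ C := ae_restrict_of_forall_mem measurableSet_Ioc hC
  have hfin : HasFiniteIntegral (fun _ : ℝ => C) (volume.restrict (Set.Ioc 0 (2 * Real.pi))) :=
    (integrable_const C).2
  refine ⟨integrableOn_cfc measurableSet_Ioc _ (fun _ => C) T hcont hbd hfin, ?_⟩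
  rw [← cfc_setIntegral measurableSet_Ioc _ (fun _ => C) T hcont hbd hfin, exp_eq_cfc hT,
    ← cfc_mul _ _ T (by fun_prop) h.continuousOn_bandInd]
  have hci := h.continuousOn_integral t
  simp only [intervalIntegral.integral_of_le Real.two_pi_pos.le] at hci
  rw [← cfc_smul (Complex.I / (2 * Real.pi)) _ T hci]
  refine cfc_congr fun μ hμ => ?_
  have h1 := h.integral_contourKernel t hμ
  rw [intervalIntegral.integral_of_le Real.two_pi_pos.le] at h1
  rw [h1, smul_eq_mul]
  have hpi : (Real.pi : ℂ) ≠ 0 := by exact_mod_cast Real.pi_ne_zero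
  have h2 : Complex.I / (2 * Real.pi) * -(2 * Real.pi * Complex.I) = 1 := by
    rw [div_mul_eq_mul_div, div_eq_iff (mul_ne_zero two_ne_zero hpi)]
    linear_combination (-2 * (Real.pi : ℂ)) * Complex.I_sq
  rw [← mul_assoc, h2, one_mul]

theorem inner_exp_mul_cfc_bandInd (h : IsSeparatingHeight T m η b) (hT : IsSelfAdjoint T) (t : ℝ)
    (x y : H) (r₁ r₂ : ℝ → H)
    (h₁ : ∀ θ : ℝ, branch m 1 (θ + b * Complex.I) • r₁ θ - T (r₁ θ) = y)
    (h₂ : ∀ θ : ℝ, branch m (-1) (θ + b * Complex.I) • r₂ θ - T (r₂ θ) = y) :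
    inner ℂ x ((NormedSpace.exp ((-Complex.I * (t : ℂ)) • T) * cfc (bandInd m) T) y) =
      Complex.I / (2 * Real.pi) * ∫ θ : ℝ in 0..2 * Real.pi,
        (branchDensity m 1 t (θ + b * Complex.I) * inner ℂ x (r₁ θ) +
          branchDensity m (-1) t (θ + b * Complex.I) * inner ℂ x (r₂ θ)) := by
  obtain ⟨hint, heq⟩ := h.exp_mul_cfc_bandInd hT t
  set L : (H →L[ℂ] H) →L[ℂ] ℂ := (innerSL ℂ x).comp (ContinuousLinearMap.apply ℂ H y)
  have hL (A : H →L[ℂ] H) : L A = inner ℂ x (A y) := rfl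
  rw [← hL, heq, map_smul, ← L.integral_comp_comm hint, smul_eq_mul,
    intervalIntegral.integral_of_le Real.two_pi_pos.le]
  congr 1
  refine setIntegral_congr_fun measurableSet_Ioc fun θ _ => ?_
  have hci (s : ℝ) (hs : s ^ 2 = 1) : ContinuousOn
      (fun μ => (branch m s (θ + b * Complex.I) - μ)⁻¹) (spectrum ℂ T) :=
    ContinuousOn.inv₀ (by fun_prop) fun μ hμ => sub_ne_zero.mpr (h.ne hs hμ θ)
  have h1 := hci 1 (by norm_num)
  have h2 := hci (-1) (by norm_num)
  have e : cfc (contourKernel m b t θ) T =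
      branchDensity m 1 t (θ + b * Complex.I) • cfc (fun μ => (branch m 1 (θ + b * Complex.I) - μ)⁻¹) T +
      branchDensity m (-1) t (θ + b * Complex.I) •
        cfc (fun μ => (branch m (-1) (θ + b * Complex.I) - μ)⁻¹) T := by
    have h3 (c : ℂ) : ContinuousOn
        (fun μ => c * (branch m 1 (θ + b * Complex.I) - μ)⁻¹) (spectrum ℂ T) := continuousOn_const.mul h1
    have h4 (c : ℂ) : ContinuousOn
        (fun μ => c * (branch m (-1) (θ + b * Complex.I) - μ)⁻¹) (spectrum ℂ T) := continuousOn_const.mul h2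
    rw [← cfc_const_mul _ _ T h1, ← cfc_const_mul _ _ T h2, ← cfc_add T _ _ (h3 _) (h4 _)]
    rfl
  rw [e, map_add, map_smul, map_smul, hL, hL,
    cfc_resolvent_apply hT (h.notMem 1 (by norm_num) θ) (h₁ θ),
    cfc_resolvent_apply hT (h.notMem (-1) (by norm_num) θ) (h₂ θ)]
  rfl

end IsSeparatingHeight

theorem cfc_quadratic (hT : IsSelfAdjoint T) (w : H) :
    cfc (fun μ : ℂ => (m : ℂ) ^ 2 + 2 - μ ^ 2) T w = ((m ^ 2 + 2 : ℝ) : ℂ) • w - T (T w) := by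
  have hT' : IsStarNormal T := hT.isStarNormal
  rw [cfc_sub _ _ T (by fun_prop) (by fun_prop), cfc_const _ T, cfc_pow_id T 2,
    Algebra.algebraMap_eq_smul_one, pow_two T]
  push_cast
  rfl

theorem cfc_bandInd_mul_self (hc : ContinuousOn (bandInd m) (spectrum ℂ T)) :
    cfc (bandInd m) T * cfc (bandInd m) T = cfc (bandInd m) T := by
  rw [← cfc_mul _ _ T hc hc]
  exact cfc_congr fun μ _ => bandInd_mul_self m μ

theorem isSelfAdjoint_cfc_bandInd (T : H →L[ℂ] H) (m : ℝ) : IsSelfAdjoint (cfc (bandInd m) T) := by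
  rw [IsSelfAdjoint, ← cfc_star]
  exact cfc_congr fun μ _ => star_bandInd m μ

theorem cfc_bandInd_apply_self (hc : ContinuousOn (bandInd m) (spectrum ℂ T)) (w : H) :
    cfc (bandInd m) T (cfc (bandInd m) T w) = cfc (bandInd m) T w :=
  congrArg (fun A : H →L[ℂ] H => A w) (cfc_bandInd_mul_self hc)

theorem cfc_bandInd_comm (hT : IsSelfAdjoint T) (m : ℝ) (w : H) :
    T (cfc (bandInd m) T w) = cfc (bandInd m) T (T w) := by
  have hT' : IsStarNormal T := hT.isStarNormal
  have h := cfc_commute_cfc (id : ℂ → ℂ) (bandInd m) T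
  rw [cfc_id ℂ T] at h
  exact congrArg (fun A : H →L[ℂ] H => A w) h.eq

/-- On the band subspace the operator satisfies the band inequality. -/
theorem norm_quadratic_le_of_band (hT : IsSelfAdjoint T)
    (hc : ContinuousOn (bandInd m) (spectrum ℂ T)) {w : H} (hw : cfc (bandInd m) T w = w) :
    ‖((m ^ 2 + 2 : ℝ) : ℂ) • w - T (T w)‖ ≤ 2 * ‖w‖ := by
  have hT' : IsStarNormal T := hT.isStarNormal
  have h1 : cfc (fun μ => ((m : ℂ) ^ 2 + 2 - μ ^ 2) * bandInd m μ) T =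
      cfc (fun μ : ℂ => (m : ℂ) ^ 2 + 2 - μ ^ 2) T * cfc (bandInd m) T :=
    cfc_mul _ _ T (by fun_prop) hc
  have h2 : ‖cfc (fun μ => ((m : ℂ) ^ 2 + 2 - μ ^ 2) * bandInd m μ) T‖ ≤ 2 :=
    norm_cfc_le zero_le_two fun μ _ => by
      unfold bandInd
      split_ifs with h
      · simpa using h
      · simp
  have h3 : ((m ^ 2 + 2 : ℝ) : ℂ) • w - T (T w) =
      cfc (fun μ => ((m : ℂ) ^ 2 + 2 - μ ^ 2) * bandInd m μ) T w := by
    rw [h1]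
    change _ = cfc (fun μ : ℂ => (m : ℂ) ^ 2 + 2 - μ ^ 2) T (cfc (bandInd m) T w)
    rw [hw, cfc_quadratic hT]
  rw [h3]
  exact ContinuousLinearMap.le_of_opNorm_le _ h2 w

/-- Off the band subspace the operator is uniformly separated from the bands. -/
theorem exists_norm_quadratic_ge (hT : IsSelfAdjoint T)
    (hc : ContinuousOn (bandInd m) (spectrum ℂ T)) : ∃ ε : ℝ, 0 < ε ∧
    ∀ w : H, cfc (bandInd m) T w = 0 →
      (2 + ε) * ‖w‖ ≤ ‖T (T w) - ((m ^ 2 + 2 : ℝ) : ℂ) • w‖ := by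
  have hT' : IsStarNormal T := hT.isStarNormal
  set a : ℂ → ℂ := fun μ => (m : ℂ) ^ 2 + 2 - μ ^ 2 with ha
  have hac : ContinuousOn a (spectrum ℂ T) := by fun_prop
  set d : ℂ → ℂ := fun μ => (1 - bandInd m μ) * a μ + 3 * bandInd m μ with hd
  have h1c : ContinuousOn (fun μ => 1 - bandInd m μ) (spectrum ℂ T) := continuousOn_const.sub hc
  have hdc : ContinuousOn d (spectrum ℂ T) := (h1c.mul hac).add (continuousOn_const.mul hc)
  have hd2 (μ : ℂ) : 2 < ‖d μ‖ := by
    by_cases h : ‖a μ‖ ≤ 2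
    · have : bandInd m μ = 1 := if_pos h
      simp only [hd, this]; norm_num
    · have : bandInd m μ = 0 := if_neg h
      simp only [hd, this]; simpa using h
  have hd0 (μ : ℂ) : d μ ≠ 0 := norm_pos_iff.mp (two_pos.trans (hd2 μ))
  obtain ⟨ε, hε, hdε⟩ : ∃ ε : ℝ, 0 < ε ∧ ∀ μ ∈ spectrum ℂ T, 2 + ε ≤ ‖d μ‖ := by
    rcases (spectrum ℂ T).eq_empty_or_nonempty with he | hne
    · exact ⟨1, one_pos, fun μ hμ => by rw [he] at hμ; exact hμ.elim⟩
    · obtain ⟨μ₀, _, hmin⟩ := (spectrum.isCompact T).exists_isMinOn hne hdc.norm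
      exact ⟨‖d μ₀‖ - 2, sub_pos.mpr (hd2 μ₀), fun μ hμ => by
        have : ‖d μ₀‖ ≤ ‖d μ‖ := hmin hμ
        linarith⟩
  refine ⟨ε, hε, fun w hw => ?_⟩
  have hkc : ContinuousOn (fun μ => (1 - bandInd m μ) * (d μ)⁻¹) (spectrum ℂ T) :=
    h1c.mul (hdc.inv₀ fun μ _ => hd0 μ)
  have hk : ‖cfc (fun μ => (1 - bandInd m μ) * (d μ)⁻¹) T‖ ≤ (2 + ε)⁻¹ := by
    refine norm_cfc_le (by positivity) fun μ hμ => ?_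
    rw [norm_mul, norm_inv]
    have h1 : ‖1 - bandInd m μ‖ ≤ 1 := by unfold bandInd; split_ifs <;> simp
    have h2 := inv_anti₀ (by positivity) (hdε μ hμ)
    exact (mul_le_mul h1 h2 (by positivity) zero_le_one).trans_eq (one_mul _)
  have hmul : cfc (fun μ => (1 - bandInd m μ) * (d μ)⁻¹) T * cfc a T =
      1 - cfc (bandInd m) T := by
    rw [← cfc_mul _ _ T hkc hac, ← cfc_const_one ℂ T,
      ← cfc_sub _ _ T continuousOn_const hc]
    refine cfc_congr fun μ _ => ?_
    have h0 := hd0 μ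
    by_cases h : ‖a μ‖ ≤ 2
    · have : bandInd m μ = 1 := if_pos h
      simp [this]
    · have hz : bandInd m μ = 0 := if_neg h
      have hda : d μ = a μ := by simp [hd, hz]
      rw [hda] at h0
      simp [hz, hda, inv_mul_cancel₀ h0]
  have hw' : cfc (fun μ => (1 - bandInd m μ) * (d μ)⁻¹) T (cfc a T w) = w := by
    have := congrArg (fun A : H →L[ℂ] H => A w) hmul
    simp only [sub_apply, hw, sub_zero, one_apply_eq_self] at this
    exact this
  have := ContinuousLinearMap.le_of_opNorm_le _ hk (cfc a T w)
  rw [hw', inv_mul_eq_div, le_div_iff₀ (by positivity), ha, cfc_quadratic hT, norm_sub_rev] at this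
  linarith

end Spectral

theorem mem_iSup_eigenspace_of_finiteDimensional {H : Type*} [NormedAddCommGroup H]
    [InnerProductSpace ℂ H] {T : H →ₗ[ℂ] H} (hT : T.IsSymmetric) (V : Submodule ℂ H)
    [FiniteDimensional ℂ V] (hV : ∀ v ∈ V, T v ∈ V) :
    V ≤ ⨆ μ : ℂ, Module.End.eigenspace T μ := by
  have h1 := (hT.restrict_invariant hV).orthogonalComplement_iSup_eigenspaces_eq_bot
  rw [Submodule.orthogonal_eq_bot_iff] at h1
  have h2 := congrArg (Submodule.map V.subtype) h1
  rw [Submodule.map_top, Submodule.range_subtype, Submodule.map_iSup] at h2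
  rw [← h2]
  refine iSup_mono fun μ => ?_
  rintro _ ⟨v, hv, rfl⟩
  rw [SetLike.mem_coe, Module.End.mem_eigenspace_iff] at hv
  exact Module.End.mem_eigenspace_iff.mpr (congrArg Subtype.val hv)

/-- The continuous spectral subspace is the band subspace. -/
theorem contProj_eq_cfc {T : SpinorL2 →L[ℂ] SpinorL2} {m : ℝ} (hT : IsSelfAdjoint T)
    (hc : ContinuousOn (bandInd m) (spectrum ℂ T))
    (hfin : ∀ (V : Submodule ℂ SpinorL2) (ε : ℝ), 0 < ε → (∀ w ∈ V, (2 + ε) * ‖w‖ ≤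
      ‖T (T w) - ((m ^ 2 + 2 : ℝ) : ℂ) • w‖) → FiniteDimensional ℂ V)
    (hno : ∀ (μ : ℝ) (w : SpinorL2), |m ^ 2 + 2 - μ ^ 2| ≤ 2 → T w = (μ : ℂ) • w → w = 0) :
    contProj T = cfc (bandInd m) T := by
  set P := cfc (bandInd m) T with hP
  have hsym : (T : SpinorL2 →ₗ[ℂ] SpinorL2).IsSymmetric :=
    ContinuousLinearMap.isSelfAdjoint_iff_isSymmetric.mp hT
  have hPs : IsSelfAdjoint P := isSelfAdjoint_cfc_bandInd T m
  have hPP (w : SpinorL2) : P (P w) = P w := cfc_bandInd_apply_self hc w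
  have hPT (w : SpinorL2) : T (P w) = P (T w) := cfc_bandInd_comm hT m w
  have hPi (x y : SpinorL2) : inner ℂ (P x) y = inner ℂ x (P y) := by
    rw [← ContinuousLinearMap.adjoint_inner_left, hPs.adjoint_eq]
  obtain ⟨ε, hε, hge⟩ := exists_norm_quadratic_ge hT hc
  set V : Submodule ℂ SpinorL2 := P.ker with hV
  have hVmem (w : SpinorL2) : w ∈ V ↔ P w = 0 := Iff.rfl
  have hVfin : FiniteDimensional ℂ V := hfin V ε hε hge
  have hVle := mem_iSup_eigenspace_of_finiteDimensional hsym V fun v hv => by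
    rw [hVmem] at hv ⊢
    rw [ContinuousLinearMap.coe_coe, ← hPT, hv, map_zero]
  have hkill (μ : ℂ) (v : SpinorL2) (hv : T v = μ • v) : P v = 0 := by
    by_contra hne
    have hTP : T (P v) = μ • P v := by rw [hPT, hv, map_smul]
    have hreal : (starRingEnd ℂ) μ = μ := hsym.conj_eigenvalue_eq_self
      (Module.End.hasEigenvalue_of_hasEigenvector (x := P v)
        ⟨Module.End.mem_eigenspace_iff.mpr hTP, hne⟩)
    obtain ⟨r, rfl⟩ := Complex.conj_eq_iff_real.mp hreal
    refine hne (hno r (P v) ?_ hTP)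
    have h1 := norm_quadratic_le_of_band hT hc (hPP v)
    have h2 : ((m ^ 2 + 2 : ℝ) : ℂ) • P v - T (T (P v)) = ((m ^ 2 + 2 - r ^ 2 : ℝ) : ℂ) • P v := by
      rw [hTP, map_smul, hTP, smul_smul, ← sub_smul]
      congr 1
      push_cast
      ring
    rw [h2, norm_smul, Complex.norm_real, Real.norm_eq_abs] at h1
    exact le_of_mul_le_mul_right h1 (norm_pos_iff.mpr hne)
  have hmem (x : SpinorL2) : P x ∈ continuousSubspace T := by
    rw [continuousSubspace, Submodule.orthogonal_closure, Submodule.mem_orthogonal]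
    intro u hu
    induction hu using Submodule.iSup_induction' with
    | mem μ u hu =>
      rw [← hPi, hkill μ u (Module.End.mem_eigenspace_iff.mp hu), inner_zero_left]
    | zero => exact inner_zero_left _
    | add u v _ _ h1 h2 => rw [inner_add_left, h1, h2, add_zero]
  ext1 x
  refine Submodule.eq_starProjection_of_mem_of_inner_eq_zero (hmem x) fun w hw => ?_
  refine Submodule.inner_right_of_mem_orthogonal (K :=
    (⨆ μ : ℂ, Module.End.eigenspace (T : SpinorL2 →ₗ[ℂ] SpinorL2) μ).topologicalClosure)
    (Submodule.le_topologicalClosure _ (hVle ?_)) hw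
  rw [hVmem, map_sub, hPP, sub_self]

theorem JostData.sol_congr {𝔅 : Type*} [NormedRing 𝔅] [NormedAlgebra ℂ 𝔅] [CompleteSpace 𝔅]
    (J : JostData 𝔅) {ζ ξ : ℂ} (hA : J.A ζ = J.A ξ) (hr : ∀ n, J.r n ζ = J.r n ξ)
    (hx : J.x ζ = J.x ξ) (n : ℤ) : J.sol n ζ = J.sol n ξ := by
  simp only [sol, term, prod, hA, hr, hx]

namespace DiracData

variable (D : DiracData)

theorem hR_congr {ζ ξ : ℂ} (h : D.lam ζ = D.lam ξ) (h' : mul ζ = mul ξ) : D.hR ζ = D.hR ξ := by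
  have (n : ℤ) : D.jostR.sol n ζ = D.jostR.sol n ξ := by
    apply D.jostR.sol_congr <;> simp only [jostR, h, h', implies_true]
  funext n i
  simp only [hR, this, h']

theorem hL_congr {ζ ξ : ℂ} (h : D.lam ζ = D.lam ξ) (h' : mul ζ = mul ξ) : D.hL ζ = D.hL ξ := by
  have (n : ℤ) : D.jostL.sol n ζ = D.jostL.sol n ξ := by
    apply D.jostL.sol_congr <;> simp only [jostL, h, h', implies_true]
  funext n i
  simp only [hL, this, h']

theorem W_congr {ζ ξ : ℂ} (h : D.lam ζ = D.lam ξ) (h' : mul ζ = mul ξ) : D.W ζ = D.W ξ := by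
  simp only [W, wronskian, psiR_apply, psiL_apply, D.hR_congr h h', D.hL_congr h h', h']

theorem lam_periodic : Function.Periodic D.lam (2 * Real.pi) := fun ζ => branch_add_two_pi _ _ ζ

theorem mul_periodic : Function.Periodic mul (2 * Real.pi) := fun ζ => by
  rw [mul, mul, mul_add, show Complex.I * (2 * Real.pi) = 2 * Real.pi * Complex.I by ring,
    Complex.exp_periodic]

theorem exists_W_ne_zero_of_im (hres : NonResonant D.m D.Q) : ∃ δ : ℝ, 0 < δ ∧ δ < D.η ∧
    ∀ ζ : ℂ, 0 ≤ ζ.im → ζ.im ≤ δ → D.W ζ ≠ 0 := by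
  obtain ⟨δ, h0, hη, h⟩ := D.exists_W_ne_zero hres
  refine ⟨δ, h0, hη, fun ζ h1 h2 => ?_⟩
  set k := ⌊ζ.re / (2 * Real.pi)⌋
  have hpi := Real.two_pi_pos
  rw [← D.W_congr (D.lam_periodic.sub_int_mul_eq k) (mul_periodic.sub_int_mul_eq k)]
  have him : (ζ - k * (2 * Real.pi)).im = ζ.im := by simp
  have hre : (ζ - k * (2 * Real.pi)).re = ζ.re - k * (2 * Real.pi) := by simp
  refine h _ ?_ (by rwa [him]) (by rwa [him])
  have e1 := Int.floor_le (ζ.re / (2 * Real.pi))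
  have e2 := Int.lt_floor_add_one (ζ.re / (2 * Real.pi))
  rw [le_div_iff₀ hpi] at e1
  rw [div_lt_iff₀ hpi] at e2
  have := Real.pi_le_four
  rw [hre, abs_le]
  constructor
  · linarith
  · have : ((k : ℝ) + 1) * (2 * Real.pi) = k * (2 * Real.pi) + 2 * Real.pi := by ring
    linarith

theorem potential_small (ε : ℝ) (hε : 0 < ε) :
    ∃ N : ℕ, ∀ n : ℤ, N < |n| → ∀ i j, |D.Q n i j| ≤ ε := by
  have h : ∀ᶠ n : ℤ in cofinite, ∀ i j, |D.Q n i j| ≤ ε := by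
    rw [eventually_all]
    intro i
    rw [eventually_all]
    intro j
    filter_upwards [(D.summable i j).tendsto_cofinite_zero.eventually (gt_mem_nhds hε)] with n hn
    refine le_trans (le_mul_of_one_le_left (abs_nonneg _) ?_) hn.le
    exact one_le_pow₀ (by linarith [abs_nonneg (n : ℝ)])
  rw [eventually_cofinite] at h
  refine ⟨h.toFinset.sup Int.natAbs, fun n hn => ?_⟩
  by_contra hcon
  have := Finset.le_sup (f := Int.natAbs) (h.mem_toFinset.mpr hcon)
  rw [Int.abs_eq_natAbs] at hn
  omega

/-- The numerator of Green's function. -/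
noncomputable def greenEntry (ζ : ℂ) (n : ℤ) (i : Fin 2) (k : ℤ) (j : Fin 2) : ℂ :=
  if 2 * k - (j : ℕ) ≤ 2 * n - (i : ℕ) then D.psiR ζ n i * D.psiL ζ k j
  else D.psiL ζ n i * D.psiR ζ k j

noncomputable def green (ζ : ℂ) (k : ℤ) (j : Fin 2) (n : ℤ) : Spinor :=
  !₂[D.greenEntry ζ n 0 k j, D.greenEntry ζ n 1 k j]

theorem green_apply (ζ : ℂ) (k : ℤ) (j : Fin 2) (n : ℤ) (i : Fin 2) :
    D.green ζ k j n i = D.greenEntry ζ n i k j := by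
  fin_cases i <;> rfl

theorem greenEntry_of_ge {ζ : ℂ} {n k : ℤ} {i j : Fin 2} (h : 2 * k - (j : ℕ) ≤ 2 * n - (i : ℕ)) :
    D.greenEntry ζ n i k j = D.psiR ζ n i * D.psiL ζ k j := if_pos h

theorem greenEntry_of_le {ζ : ℂ} {n k : ℤ} {i j : Fin 2} (h : 2 * n - (i : ℕ) ≤ 2 * k - (j : ℕ)) :
    D.greenEntry ζ n i k j = D.psiL ζ n i * D.psiR ζ k j := by
  rcases h.lt_or_eq with h | h
  · exact if_neg (not_le.mpr h)
  · have hi := i.2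
    have hj := j.2
    have hij : i = j := Fin.ext (by omega)
    subst hij
    have : n = k := by omega
    subst this
    rw [D.greenEntry_of_ge h.ge, mul_comm]

theorem diracExpr_green {ζ : ℂ} (hζ : ζ ∈ D.upper) (k : ℤ) (j : Fin 2) :
    diracExpr D.m D.Q (D.green ζ k j) =
      D.lam ζ • D.green ζ k j +
        D.W ζ • (Pi.single k (EuclideanSpace.single j (1 : ℂ)) : ℤ → Spinor) := by
  have hR := D.psiR_isSol hζ
  have hL := D.psiL_isSol hζ
  have hW (n : ℤ) : D.W ζ = wronskian (D.psiR ζ) (D.psiL ζ) n := wronskian_eq hR hL 0 n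
  rw [← diracExpr_eq_smul_iff D.symm] at hR hL
  have hR0 (n : ℤ) := congrArg (fun f : ℤ → Spinor => f n 0) hR
  have hR1 (n : ℤ) := congrArg (fun f : ℤ → Spinor => f n 1) hR
  have hL0 (n : ℤ) := congrArg (fun f : ℤ → Spinor => f n 0) hL
  have hL1 (n : ℤ) := congrArg (fun f : ℤ → Spinor => f n 1) hL
  simp only [diracExpr_zero, diracExpr_one, Pi.smul_apply, PiLp.smul_apply, smul_eq_mul]
    at hR0 hR1 hL0 hL1
  have hj := j.2
  funext n
  ext i
  rw [Pi.add_apply, PiLp.add_apply, Pi.smul_apply, Pi.smul_apply, PiLp.smul_apply,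
    PiLp.smul_apply, smul_eq_mul, smul_eq_mul]
  rcases lt_trichotomy n k with hn | rfl | hn
  · rw [Pi.single_eq_of_ne hn.ne, PiLp.zero_apply, mul_zero, add_zero]
    fin_cases i
    · simp only [Fin.zero_eta, diracExpr_zero, green_apply]
      rw [D.greenEntry_of_le (n := n) (i := 0) (by simp; omega),
        D.greenEntry_of_le (n := n) (i := 1) (by simp; omega),
        D.greenEntry_of_le (n := n + 1) (i := 1) (by simp; omega)]
      linear_combination (D.psiR ζ k j) * hL0 n
    · simp only [Fin.mk_one, diracExpr_one, green_apply]
      rw [D.greenEntry_of_le (n := n) (i := 0) (by simp; omega),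
        D.greenEntry_of_le (n := n) (i := 1) (by simp; omega),
        D.greenEntry_of_le (n := n - 1) (i := 0) (by simp; omega)]
      linear_combination (D.psiR ζ k j) * hL1 n
  · rw [Pi.single_eq_same, PiLp.single_apply]
    fin_cases i <;> fin_cases j
    · simp only [Fin.zero_eta, diracExpr_zero, green_apply, if_true, mul_one]
      rw [D.greenEntry_of_le (n := n) (i := 0) (by simp),
        D.greenEntry_of_le (n := n) (i := 1) (by simp),
        D.greenEntry_of_ge (n := n + 1) (i := 1) (by simp), hW (n + 1), wronskian,
        add_sub_cancel_right]
      linear_combination (D.psiR ζ n 0) * hL0 n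
    · simp only [Fin.zero_eta, Fin.mk_one, diracExpr_zero, green_apply, zero_ne_one, if_false,
        mul_zero, add_zero]
      rw [D.greenEntry_of_ge (n := n) (i := 0) (by simp),
        D.greenEntry_of_ge (n := n) (i := 1) (by simp),
        D.greenEntry_of_ge (n := n + 1) (i := 1) (by simp)]
      linear_combination (D.psiL ζ n 1) * hR0 n
    · simp only [Fin.zero_eta, Fin.mk_one, diracExpr_one, green_apply, one_ne_zero, if_false,
        mul_zero, add_zero]
      rw [D.greenEntry_of_le (n := n) (i := 0) (by simp),
        D.greenEntry_of_le (n := n) (i := 1) (by simp),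
        D.greenEntry_of_le (n := n - 1) (i := 0) (by simp)]
      linear_combination (D.psiR ζ n 0) * hL1 n
    · simp only [Fin.mk_one, diracExpr_one, green_apply, if_true, mul_one]
      rw [D.greenEntry_of_ge (n := n) (i := 0) (by simp),
        D.greenEntry_of_ge (n := n) (i := 1) (by simp),
        D.greenEntry_of_le (n := n - 1) (i := 0) (by simp), hW n, wronskian]
      linear_combination (D.psiL ζ n 1) * hR1 n
  · rw [Pi.single_eq_of_ne hn.ne', PiLp.zero_apply, mul_zero, add_zero]
    fin_cases i
    · simp only [Fin.zero_eta, diracExpr_zero, green_apply]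
      rw [D.greenEntry_of_ge (n := n) (i := 0) (by simp; omega),
        D.greenEntry_of_ge (n := n) (i := 1) (by simp; omega),
        D.greenEntry_of_ge (n := n + 1) (i := 1) (by simp; omega)]
      linear_combination (D.psiL ζ k j) * hR0 n
    · simp only [Fin.mk_one, diracExpr_one, green_apply]
      rw [D.greenEntry_of_ge (n := n) (i := 0) (by simp; omega),
        D.greenEntry_of_ge (n := n) (i := 1) (by simp; omega),
        D.greenEntry_of_ge (n := n - 1) (i := 0) (by simp; omega)]
      linear_combination (D.psiL ζ k j) * hR1 n

theorem norm_mul_eq (ζ : ℂ) : ‖mul ζ‖ = Real.exp (-ζ.im) := by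
  rw [mul, Complex.norm_exp]; simp

theorem memℓp_green {ζ : ℂ} (hζ : ζ ∈ D.upper) (hpos : 0 < ζ.im) (k : ℤ) (j : Fin 2) :
    Memℓp (D.green ζ k j) 2 := by
  obtain ⟨C, hC, hb⟩ := D.exists_norm_h_le
  obtain ⟨hbR, hbL⟩ := hb ζ hζ
  set r := ‖mul ζ‖ with hr
  have hr0 : 0 < r := norm_pos_iff.mpr (mul_ne_zero ζ)
  have hr1 : r < 1 := by rw [hr, norm_mul_eq]; exact (Real.exp_lt_exp.mpr (neg_lt_zero.mpr hpos)).trans_eq Real.exp_zero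
  have hgeom (A : ℝ) : Summable fun n : ℕ => (2 * (C * A)) ^ 2 * (r ^ 2) ^ n :=
    (summable_geometric_of_lt_one (by positivity) (pow_lt_one₀ hr0.le hr1 two_ne_zero)).mul_left _
  have key (z : Spinor) (A : ℝ) (n : ℕ) (h : ∀ i, ‖z i‖ ≤ r ^ n * C * A) :
      ‖z‖ ^ 2 ≤ (2 * (C * A)) ^ 2 * (r ^ 2) ^ n := by
    have h1 := (spinor_norm_le z).trans (add_le_add (h 0) (h 1))
    calc ‖z‖ ^ 2 ≤ (r ^ n * C * A + r ^ n * C * A) ^ 2 := pow_le_pow_left₀ (norm_nonneg _) h1 2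
      _ = _ := by rw [← pow_mul, mul_comm 2 n, pow_mul]; ring
  rw [memℓp_gen_iff (by norm_num)]
  simp only [ENNReal.toReal_ofNat, Real.rpow_ofNat]
  have hj := j.2
  refine Summable.of_nat_of_neg ?_ ?_
  · refine Summable.of_norm_bounded_eventually_nat (hgeom ‖D.psiL ζ k j‖) ?_
    filter_upwards [eventually_ge_atTop (k.natAbs + 1)] with n hn
    rw [Real.norm_of_nonneg (by positivity)]
    refine key _ _ n fun i => ?_
    have hi := i.2
    rw [green_apply, D.greenEntry_of_ge (by omega), norm_mul, psiR_apply, norm_mul, norm_zpow,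
      zpow_natCast]
    gcongr
    exact (hbR n (by omega) i)
  · refine Summable.of_norm_bounded_eventually_nat (hgeom ‖D.psiR ζ k j‖) ?_
    filter_upwards [eventually_ge_atTop (k.natAbs + 1)] with n hn
    rw [Real.norm_of_nonneg (by positivity)]
    refine key _ _ n fun i => ?_
    have hi := i.2
    rw [green_apply, D.greenEntry_of_le (by omega), norm_mul, psiL_apply, norm_mul, norm_zpow,
      neg_neg, zpow_natCast]
    gcongr
    exact (hbL (-n) (by omega) i)

variable (hQ : ∃ C : ℝ, ∀ n i j, |D.Q n i j| ≤ C)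

theorem diracOp_green {ζ : ℂ} (hζ : ζ ∈ D.upper) (hpos : 0 < ζ.im) (k : ℤ) (j : Fin 2)
    (hW : D.W ζ ≠ 0) : ∃ g : SpinorL2,
      (∀ n i, g n i = (D.W ζ)⁻¹ * D.greenEntry ζ n i k j) ∧
      diracOp D.m D.Q hQ g - D.lam ζ • g = lp.single 2 k (EuclideanSpace.single j 1) := by
  let g : SpinorL2 := ⟨D.green ζ k j, D.memℓp_green hζ hpos k j⟩
  have hg : diracOp D.m D.Q hQ g = D.lam ζ • g +
      D.W ζ • (lp.single 2 k (EuclideanSpace.single j (1 : ℂ)) : SpinorL2) :=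
    Subtype.ext (D.diracExpr_green hζ k j)
  refine ⟨(D.W ζ)⁻¹ • g, fun n i => ?_, ?_⟩
  · rw [lp.coeFn_smul, Pi.smul_apply, PiLp.smul_apply, smul_eq_mul, ← green_apply]
  · rw [map_smul, hg, smul_add, smul_smul _ (D.W ζ), inv_mul_cancel₀ hW, one_smul, smul_comm,
      add_sub_cancel_left]

theorem norm_quadratic_lam (ζ : ℂ) :
    (D.m : ℂ) ^ 2 + 2 - D.lam ζ ^ 2 = 2 * Complex.cos ζ := by
  rw [lam, branch_sq D.s_sq, dispSq]; ring

/-- Off the real axis, the dispersion relation avoids the spectrum as long as the Wronskian does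
not vanish. -/
theorem lam_notMem_spectrum {ζ : ℂ} (hζ : ζ ∈ D.upper) (hpos : 0 < ζ.im) (hW : D.W ζ ≠ 0) :
    D.lam ζ ∉ spectrum ℂ (diracOp D.m D.Q hQ) := by
  intro hmem
  have hreal := (isSelfAdjoint_diracOp (m := D.m) (hQ := hQ) D.symm).mem_spectrum_eq_re hmem
  set μ := (D.lam ζ).re
  have hq := D.norm_quadratic_lam ζ
  rw [hreal] at hq
  have hcos : Complex.cos ζ = ((Real.cos ζ.re * Real.cosh ζ.im : ℝ) : ℂ) -
      ((Real.sin ζ.re * Real.sinh ζ.im : ℝ) : ℂ) * Complex.I := by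
    rw [Complex.cos_eq]; push_cast; ring
  have hq' : ((D.m ^ 2 + 2 - μ ^ 2 : ℝ) : ℂ) = ((2 * (Real.cos ζ.re * Real.cosh ζ.im) : ℝ) : ℂ) -
      ((2 * (Real.sin ζ.re * Real.sinh ζ.im) : ℝ) : ℂ) * Complex.I := by
    rw [hcos] at hq
    push_cast at hq ⊢
    rw [hq]
    ring
  have him : Real.sin ζ.re * Real.sinh ζ.im = 0 := by
    have := congrArg Complex.im hq'
    simp only [Complex.ofReal_im, Complex.sub_im, Complex.im_ofReal_mul,
      Complex.I_im] at this
    linarith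
  have hre : D.m ^ 2 + 2 - μ ^ 2 = 2 * (Real.cos ζ.re * Real.cosh ζ.im) := by
    have := congrArg Complex.re hq'
    simpa only [Complex.ofReal_re, Complex.sub_re, Complex.re_ofReal_mul, Complex.I_re, mul_zero,
      sub_zero] using this
  have hsin : Real.sin ζ.re = 0 :=
    (mul_eq_zero.mp him).resolve_right (Real.sinh_pos_iff.mpr hpos).ne'
  have hcosh : 1 < Real.cosh ζ.im := Real.one_lt_cosh.mpr hpos.ne'
  have habs : 2 < |μ ^ 2 - (D.m ^ 2 + 2)| := by
    rw [abs_sub_comm, hre, abs_mul, abs_mul, abs_of_pos (Real.cosh_pos _), abs_two]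
    have : |Real.cos ζ.re| = 1 := by
      rcases Real.sin_eq_zero_iff_cos_eq.mp hsin with h | h <;> rw [h] <;> simp
    rw [this]
    linarith
  rw [hreal] at hmem
  refine notMem_spectrum_of_green D.symm D.potential_small habs (fun k j => ?_) hmem
  obtain ⟨g, _, hg⟩ := D.diracOp_green hQ hζ hpos k j hW
  rw [hreal] at hg
  exact ⟨g, hg⟩

theorem tendsto_apply_cofinite (w : SpinorL2) (i : Fin 2) :
    Tendsto (fun n => w n i) cofinite (𝓝 0) := by
  have h := w.summable_sq.tendsto_cofinite_zero
  have h1 : Tendsto (fun n => ‖w n‖) cofinite (𝓝 0) := by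
    have := (Real.continuous_sqrt.tendsto 0).comp h
    rw [Real.sqrt_zero] at this
    exact this.congr fun n => Real.sqrt_sq (norm_nonneg _)
  exact squeeze_zero_norm (fun n => PiLp.norm_apply_le (w n) i) h1

/-- There are no square summable solutions inside the bands. -/
theorem eq_zero_of_diracOp_eq (hres : NonResonant D.m D.Q) (θ : ℝ) {w : SpinorL2}
    (hw : diracOp D.m D.Q hQ w = D.lam θ • w) : w = 0 := by
  have hsol : IsSol D.m D.Q (D.lam θ) w :=
    (diracExpr_eq_smul_iff D.symm _ _).mp (congrArg (fun f : SpinorL2 => (f : ℤ → Spinor)) hw)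
  have hR := D.psiR_isSol (D.ofReal_mem_upper θ)
  have hL := D.psiL_isSol (D.ofReal_mem_upper θ)
  obtain ⟨C, hC, hb⟩ := D.exists_norm_h_le
  obtain ⟨hbR, hbL⟩ := hb θ (D.ofReal_mem_upper θ)
  have hnR (n : ℤ) (i : Fin 2) : ‖D.psiR θ n i‖ = ‖D.hR θ n i‖ := by
    rw [psiR_apply, norm_mul, norm_zpow, norm_mul_ofReal, one_zpow, one_mul]
  have hnL (n : ℤ) (i : Fin 2) : ‖D.psiL θ n i‖ = ‖D.hL θ n i‖ := by
    rw [psiL_apply, norm_mul, norm_zpow, norm_mul_ofReal, one_zpow, one_mul]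
  have hbound (z : ℤ → Spinor) (n : ℤ) (h0 : ‖z (n - 1) 0‖ ≤ C) (h1 : ‖z n 1‖ ≤ C) :
      ‖wronskian z w n‖ ≤ C * ‖w n 1‖ + C * ‖w (n - 1) 0‖ := by
    refine (norm_sub_le _ _).trans ?_
    rw [norm_mul, norm_mul]
    gcongr
  have hlim : Tendsto (fun n : ℤ => C * ‖w n 1‖ + C * ‖w (n - 1) 0‖) cofinite (𝓝 0) := by
    have h0 := (tendsto_apply_cofinite w 0).comp (sub_left_injective (b := (1 : ℤ))).tendsto_cofinite
    have := ((tendsto_apply_cofinite w 1).norm.const_mul C).add (h0.norm.const_mul C)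
    simpa using this
  have hWR : wronskian (D.psiR θ) w 0 = 0 := by
    have h1 := hlim.comp (Nat.cast_injective (R := ℤ)).tendsto_cofinite
    rw [Nat.cofinite_eq_atTop] at h1
    refine norm_le_zero_iff.mp (ge_of_tendsto h1 ?_)
    filter_upwards [eventually_ge_atTop 1] with n hn
    rw [wronskian_eq hR hsol 0 n]
    exact hbound _ _ ((hnR _ _).trans_le (hbR _ (by omega) _)) ((hnR _ _).trans_le (hbR _ (by omega) _))
  have hWL : wronskian (D.psiL θ) w 0 = 0 := by
    have h1 := hlim.comp ((neg_injective (G := ℤ)).comp (Nat.cast_injective (R := ℤ))).tendsto_cofinite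
    rw [Nat.cofinite_eq_atTop] at h1
    refine norm_le_zero_iff.mp (ge_of_tendsto h1 ?_)
    filter_upwards [eventually_ge_atTop 1] with n hn
    rw [wronskian_eq hL hsol 0 (-n)]
    exact hbound _ _ ((hnL _ _).trans_le (hbL _ (by omega) _)) ((hnL _ _).trans_le (hbL _ (by omega) _))
  obtain ⟨c, hc⟩ := hR.exists_eq_smul D.ne hsol (D.psiR_ne_zero θ) hWR
  have hcW : c * D.W θ = 0 := by
    rw [hc] at hWL
    simp only [W, wronskian, Pi.smul_apply, PiLp.smul_apply, smul_eq_mul] at hWL ⊢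
    linear_combination -hWL
  rw [(mul_eq_zero.mp hcW).resolve_right (D.W_ofReal_ne_zero hres θ), zero_smul] at hc
  exact Subtype.ext hc

/-- The same data with another choice of the sign of the branch. -/
def withSign (s : ℝ) (hs : s ^ 2 = 1) : DiracData := { D with s := s, s_sq := hs }

theorem eq_zero_of_band (hres : NonResonant D.m D.Q) (μ : ℝ) (w : SpinorL2)
    (hμ : |D.m ^ 2 + 2 - μ ^ 2| ≤ 2) (hw : diracOp D.m D.Q hQ w = (μ : ℂ) • w) : w = 0 := by
  obtain ⟨h1, h2⟩ := abs_le.mp hμ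
  set θ := Real.arccos ((D.m ^ 2 + 2 - μ ^ 2) / 2)
  have hcos : Real.cos θ = (D.m ^ 2 + 2 - μ ^ 2) / 2 :=
    Real.cos_arccos (by linarith) (by linarith)
  have hsq := realBranch_sq D.m_pos (s := 1) (by norm_num) θ
  have hsq' : μ ^ 2 = realBranch D.m 1 θ ^ 2 := by rw [hsq, hcos]; ring
  have hsgn : ∃ (s : ℝ) (hs : s ^ 2 = 1), (μ : ℂ) = (D.withSign s hs).lam θ := by
    rcases sq_eq_sq_iff_eq_or_eq_neg.mp hsq' with h | h
    · exact ⟨1, by norm_num, by rw [h, lam_ofReal]; rfl⟩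
    · exact ⟨-1, by norm_num, by rw [h, lam_ofReal]; simp [withSign, realBranch]⟩
  obtain ⟨s, hs, e⟩ := hsgn
  rw [e] at hw
  exact (D.withSign s hs).eq_zero_of_diracOp_eq hQ hres θ hw

theorem exists_isSeparatingHeight (hres : NonResonant D.m D.Q) : ∃ δ : ℝ, 0 < δ ∧ δ < D.η ∧
    (∀ (s : ℝ) (hs : s ^ 2 = 1) (ζ : ℂ), 0 ≤ ζ.im → ζ.im ≤ δ → (D.withSign s hs).W ζ ≠ 0) ∧
    ∀ b : ℝ, 0 < b → b ≤ δ → IsSeparatingHeight (diracOp D.m D.Q hQ) D.m D.η b := by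
  have p1 : (1 : ℝ) ^ 2 = 1 := by norm_num
  have p2 : (-1 : ℝ) ^ 2 = 1 := by norm_num
  obtain ⟨δ₁, h1, h1', hW1⟩ := (D.withSign 1 p1).exists_W_ne_zero_of_im hres
  obtain ⟨δ₂, h2, h2', hW2⟩ := (D.withSign (-1) p2).exists_W_ne_zero_of_im hres
  have hWs : ∀ (s : ℝ) (hs : s ^ 2 = 1) (ζ : ℂ), 0 ≤ ζ.im → ζ.im ≤ min δ₁ δ₂ →
      (D.withSign s hs).W ζ ≠ 0 := by
    intro s hs ζ h0 hle
    rcases (sq_eq_sq_iff_eq_or_eq_neg (b := (1 : ℝ))).mp (hs.trans (one_pow 2).symm) with rfl | rfl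
    · exact hW1 ζ h0 (hle.trans (min_le_left _ _))
    · exact hW2 ζ h0 (hle.trans (min_le_right _ _))
  have hlt : min δ₁ δ₂ < D.η := (min_le_left _ _).trans_lt h1'
  have hnot (s : ℝ) (hs : s ^ 2 = 1) (ζ : ℂ) (h0 : 0 < ζ.im) (hle : ζ.im ≤ min δ₁ δ₂) :
      branch D.m s ζ ∉ spectrum ℂ (diracOp D.m D.Q hQ) :=
    (D.withSign s hs).lam_notMem_spectrum hQ ⟨h0.le, hle.trans_lt hlt⟩ h0 (hWs s hs ζ h0.le hle)
  refine ⟨min δ₁ δ₂, lt_min h1 h2, hlt, hWs, fun b hb hbδ =>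
    ⟨D.cosh_lt, hb, hbδ.trans_lt hlt, fun s hs θ => hnot s hs _ (by simpa using hb) (by simpa using hbδ),
    fun μ hμ => ?_⟩⟩
  have hreal := (isSelfAdjoint_diracOp (m := D.m) (hQ := hQ) D.symm).mem_spectrum_eq_re hμ
  obtain ⟨z, hz0, hz, hiff, hle⟩ := exists_joukowski_root (D.m ^ 2 + 2 - μ.re ^ 2)
  have hcast : (D.m : ℂ) ^ 2 + 2 - μ ^ 2 = ((D.m ^ 2 + 2 - μ.re ^ 2 : ℝ) : ℂ) := by
    rw [hreal]; push_cast [Complex.ofReal_re]; rfl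
  refine ⟨z, hz0, hcast.trans hz, by rw [hcast, Complex.norm_real]; exact hiff, ?_⟩
  by_contra! hcon
  obtain ⟨hne, hge⟩ := hcon
  have hlt1 : ‖z‖ < 1 := lt_of_le_of_ne hle hne
  have hzpos : 0 < ‖z‖ := norm_pos_iff.mpr hz0
  set ζ : ℂ := -Complex.I * Complex.log z with hζ
  have hI : Complex.I * ζ = Complex.log z := by
    rw [hζ]; linear_combination (-Complex.log z) * Complex.I_sq
  have him : ζ.im = -Real.log ‖z‖ := by rw [hζ]; simp [Complex.log_re]
  have hpos : 0 < ζ.im := by rw [him]; linarith [Real.log_neg hzpos hlt1]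
  have hb' : ζ.im ≤ min δ₁ δ₂ := by
    have := (Real.le_log_iff_exp_le hzpos).mpr hge
    rw [him]; linarith
  have hcos : 2 * Complex.cos ζ = z + z⁻¹ := by
    rw [two_cos_eq, Complex.exp_neg, hI, Complex.exp_log hz0]
  have hsq : μ ^ 2 = branch D.m 1 ζ ^ 2 := by
    rw [branch_sq p1, dispSq, hcos, ← hz, ← hcast]; ring
  rcases sq_eq_sq_iff_eq_or_eq_neg.mp hsq with h | h
  · exact hnot 1 p1 ζ hpos hb' (h ▸ hμ)
  · rw [← branch_neg] at h
    exact hnot (-1) p2 ζ hpos hb' (h ▸ hμ)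

end DiracData

namespace DiracData

variable (D : DiracData)

theorem continuousOn_greenEntry (n : ℤ) (i : Fin 2) (k : ℤ) (j : Fin 2) :
    ContinuousOn (fun ζ => D.greenEntry ζ n i k j) D.upper := by
  unfold greenEntry
  split_ifs
  · exact (D.continuousOn_psiR n i).mul (D.continuousOn_psiL k j)
  · exact (D.continuousOn_psiL n i).mul (D.continuousOn_psiR k j)

theorem upper_subset_strip : D.upper ⊆ strip D.η := D.jostR.upper_subset

theorem continuousOn_branchDensity (t : ℝ) :
    ContinuousOn (branchDensity D.m D.s t) D.upper := by
  have h := (branch_differentiableOn (m := D.m) D.s_sq D.cosh_lt).continuousOn.mono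
    D.upper_subset_strip
  unfold branchDensity
  exact (Complex.continuous_exp.comp_continuousOn (continuousOn_const.mul h)).mul
    (Complex.continuous_sin.continuousOn.div h fun ζ hζ =>
      branch_ne_zero D.s_sq D.cosh_lt (D.upper_subset_strip hζ))

/-- The oscillatory integral of Green's function along the horizontal line at height `b`. -/
noncomputable def oscIntegral (t : ℝ) (n : ℤ) (i : Fin 2) (k : ℤ) (j : Fin 2) (b : ℝ) : ℂ :=
  ∫ θ : ℝ in 0..2 * Real.pi, branchDensity D.m D.s t (θ + b * Complex.I) *
    ((D.W (θ + b * Complex.I))⁻¹ * D.greenEntry (θ + b * Complex.I) n i k j)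

theorem continuousOn_oscIntegral {δ : ℝ} (hδ0 : 0 < δ) (hδ : δ < D.η)
    (hW : ∀ ζ : ℂ, 0 ≤ ζ.im → ζ.im ≤ δ → D.W ζ ≠ 0) (t : ℝ) (n : ℤ) (i : Fin 2) (k : ℤ)
    (j : Fin 2) : ContinuousOn (D.oscIntegral t n i k j) (Set.Icc 0 δ) := by
  set S : Set ℂ := {ζ | 0 ≤ ζ.im ∧ ζ.im ≤ δ} with hS
  have hSu : S ⊆ D.upper := fun ζ hζ => ⟨hζ.1, hζ.2.trans_lt hδ⟩
  set F : ℂ → ℂ := fun ζ => branchDensity D.m D.s t ζ * ((D.W ζ)⁻¹ * D.greenEntry ζ n i k j) with hF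
  have hFc : ContinuousOn F S := ((D.continuousOn_branchDensity t).mono hSu).mul
    (((D.continuousOn_W.mono hSu).inv₀ fun ζ hζ => hW ζ hζ.1 hζ.2).mul
      ((D.continuousOn_greenEntry n i k j).mono hSu))
  have hG : Continuous fun b : ℝ => ∫ θ : ℝ in 0..2 * Real.pi,
      F (θ + (max 0 (min b δ) : ℝ) * Complex.I) := by
    refine intervalIntegral.continuous_parametric_intervalIntegral_of_continuous'
      (f := fun (b : ℝ) (θ : ℝ) => F (θ + (max 0 (min b δ) : ℝ) * Complex.I)) ?_ _ _
    refine hFc.comp_continuous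
      (f := fun p : ℝ × ℝ => ((p.2 : ℂ) + (max 0 (min p.1 δ) : ℝ) * Complex.I)) (by fun_prop)
      fun p => ?_
    simp [hS, hδ0.le]
  refine hG.continuousOn.congr fun b hb => ?_
  simp only [oscIntegral, hF, min_eq_left hb.2, max_eq_right hb.1]

theorem oscIntegral_zero (t : ℝ) (n : ℤ) (i : Fin 2) (k : ℤ) (j : Fin 2) :
    D.oscIntegral t n i k j 0 = ∫ θ : ℝ in 0..2 * Real.pi,
      Complex.exp (-Complex.I * t * realBranch D.m D.s θ) *
        (Real.sin θ / realBranch D.m D.s θ : ℝ) *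
        ((D.W θ)⁻¹ * D.greenEntry θ n i k j) := by
  refine intervalIntegral.integral_congr fun θ _ => ?_
  simp only [Complex.ofReal_zero, zero_mul, add_zero, branchDensity, branch_ofReal D.m_pos]
  push_cast
  rfl

variable (hQ : ∃ C : ℝ, ∀ n i j, |D.Q n i j| ≤ C)

theorem inner_propagator_eq_at_height (hres : NonResonant D.m D.Q) {b : ℝ}
    (hb : IsSeparatingHeight (diracOp D.m D.Q hQ) D.m D.η b)
    (hW : ∀ (s : ℝ) (hs : s ^ 2 = 1) (ζ : ℂ), ζ.im = b → (D.withSign s hs).W ζ ≠ 0)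
    (t : ℝ) (n : ℤ) (i : Fin 2) (k : ℤ) (j : Fin 2) :
    ((propagator (diracOp D.m D.Q hQ) t * contProj (diracOp D.m D.Q hQ))
        (lp.single 2 k (EuclideanSpace.single j 1)) : SpinorL2) n i =
      -(Complex.I / (2 * Real.pi)) *
        ((D.withSign 1 (by norm_num)).oscIntegral t n i k j b +
          (D.withSign (-1) (by norm_num)).oscIntegral t n i k j b) := by
  have p1 : (1 : ℝ) ^ 2 = 1 := by norm_num
  have p2 : (-1 : ℝ) ^ 2 = 1 := by norm_num
  have hT : IsSelfAdjoint (diracOp D.m D.Q hQ) := isSelfAdjoint_diracOp D.symm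
  have him (θ : ℝ) : (θ + b * Complex.I : ℂ).im = b := by simp
  have hup (θ : ℝ) : (θ + b * Complex.I : ℂ) ∈ D.upper := by
    constructor <;> rw [him]
    exacts [hb.pos.le, hb.lt]
  have hgr (s : ℝ) (hs : s ^ 2 = 1) (θ : ℝ) := (D.withSign s hs).diracOp_green hQ (hup θ)
    (by rw [him]; exact hb.pos) k j (hW s hs _ (him θ))
  choose g hg1 hg2 using hgr
  have hneg (s : ℝ) (hs : s ^ 2 = 1) (θ : ℝ) : branch D.m s (θ + b * Complex.I) • (-g s hs θ) -
      diracOp D.m D.Q hQ (-g s hs θ) = lp.single 2 k (EuclideanSpace.single j 1) := by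
    rw [← hg2 s hs θ, map_neg, smul_neg, sub_neg_eq_add, neg_add_eq_sub]
    rfl
  rw [contProj_eq_cfc hT hb.continuousOn_bandInd
    (fun V ε hε hV => finiteDimensional_of_sq_bound D.potential_small V hε hV)
    (fun μ w h1 h2 => D.eq_zero_of_band hQ hres μ w h1 h2)]
  have hinner (z : SpinorL2) : z n i = inner ℂ (lp.single 2 n (EuclideanSpace.single i (1 : ℂ)) : SpinorL2) z := by
    rw [lp.inner_single_left, spinor_inner]
    fin_cases i <;> simp
  have hentry (s : ℝ) (hs : s ^ 2 = 1) (θ : ℝ) :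
      inner ℂ (lp.single 2 n (EuclideanSpace.single i (1 : ℂ)) : SpinorL2) (-g s hs θ) =
      -(((D.withSign s hs).W (θ + b * Complex.I))⁻¹ *
        (D.withSign s hs).greenEntry (θ + b * Complex.I) n i k j) := by
    rw [inner_neg_right, ← hinner, hg1]
  rw [hinner, propagator, hb.inner_exp_mul_cfc_bandInd hT t _ _ _ _ (hneg 1 p1) (hneg (-1) p2)]
  simp only [hentry]
  have hii (s : ℝ) (hs : s ^ 2 = 1) : IntervalIntegrable (fun θ : ℝ =>
      branchDensity D.m s t (θ + b * Complex.I) * (((D.withSign s hs).W (θ + b * Complex.I))⁻¹ *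
        (D.withSign s hs).greenEntry (θ + b * Complex.I) n i k j)) volume 0 (2 * Real.pi) := by
    have hc : Continuous fun θ : ℝ => (θ + b * Complex.I : ℂ) := by fun_prop
    refine Continuous.intervalIntegrable (Continuous.mul ?_ (Continuous.mul (Continuous.inv₀ ?_ ?_) ?_)) _ _
    · exact ((D.withSign s hs).continuousOn_branchDensity t).comp_continuous hc hup
    · exact (D.withSign s hs).continuousOn_W.comp_continuous hc hup
    · exact fun θ => hW s hs _ (him θ)
    · exact ((D.withSign s hs).continuousOn_greenEntry n i k j).comp_continuous hc hup
  have hsum := intervalIntegral.integral_add (hii 1 p1) (hii (-1) p2)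
  change _ = (D.withSign 1 p1).oscIntegral t n i k j b + (D.withSign (-1) p2).oscIntegral t n i k j b at hsum
  rw [← hsum, neg_mul, ← mul_neg, ← intervalIntegral.integral_neg]
  congr 1
  refine intervalIntegral.integral_congr fun θ _ => ?_
  ring

/-- The kernel of the propagator on the continuous subspace. -/
theorem propagator_kernel (hres : NonResonant D.m D.Q) (t : ℝ) (n : ℤ) (i : Fin 2) (k : ℤ)
    (j : Fin 2) :
    ((propagator (diracOp D.m D.Q hQ) t * contProj (diracOp D.m D.Q hQ))
        (lp.single 2 k (EuclideanSpace.single j 1)) : SpinorL2) n i =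
      -(Complex.I / (2 * Real.pi)) *
        ((D.withSign 1 (by norm_num)).oscIntegral t n i k j 0 +
          (D.withSign (-1) (by norm_num)).oscIntegral t n i k j 0) := by
  obtain ⟨δ, hδ0, hδ, hW, hsep⟩ := D.exists_isSeparatingHeight hQ hres
  have hc : ContinuousOn (fun b => -(Complex.I / (2 * Real.pi)) *
        ((D.withSign 1 (by norm_num)).oscIntegral t n i k j b +
          (D.withSign (-1) (by norm_num)).oscIntegral t n i k j b)) (Set.Icc 0 δ) :=
    continuousOn_const.mul
      (((D.withSign 1 (by norm_num)).continuousOn_oscIntegral hδ0 hδ (hW 1 _) t n i k j).add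
        ((D.withSign (-1) (by norm_num)).continuousOn_oscIntegral hδ0 hδ (hW (-1) _) t n i k j))
  have h1 := (hc 0 ⟨le_rfl, hδ0.le⟩).mono_left (nhdsWithin_mono 0 Set.Ioc_subset_Icc_self)
  rw [nhdsWithin_Ioc_eq_nhdsGT hδ0] at h1
  refine tendsto_nhds_unique (tendsto_const_nhds.congr' ?_) h1
  filter_upwards [Ioc_mem_nhdsGT hδ0] with b hb
  exact D.inner_propagator_eq_at_height hQ hres (hsep b hb.1 hb.2)
    (fun s hs ζ hζ => hW s hs ζ (hζ ▸ hb.1.le) (hζ ▸ hb.2)) t n i k j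

end DiracData

theorem exists_C2Bound_of_periodic {f : ℝ → ℂ} {c : ℝ} (hc : 0 < c) (hf : ContDiff ℝ 2 f)
    (hp : Function.Periodic f c) : ∃ B : ℝ, 0 ≤ B ∧ C2Bound f B 1 := by
  have h (j : ℕ) (hj : j ≤ 2) : ∃ B : ℝ, ∀ θ, ‖iteratedFDeriv ℝ j f θ‖ ≤ B := by
    have hcont := (hf.continuous_iteratedFDeriv (m := j) (by exact_mod_cast hj)).norm
    have hper : Function.Periodic (fun θ => ‖iteratedFDeriv ℝ j f θ‖) c := fun θ => by
      have : (fun z => f (z + c)) = f := funext hp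
      simp only [← iteratedFDeriv_comp_add_right, this]
    obtain ⟨B, hB⟩ := (isCompact_Icc (a := 0) (b := c)).exists_bound_of_continuousOn hcont.continuousOn
    refine ⟨B, fun θ => ?_⟩
    obtain ⟨y, hy, e⟩ := hper.exists_mem_Ico₀ hc θ
    have e' : ‖iteratedFDeriv ℝ j f θ‖ = ‖iteratedFDeriv ℝ j f y‖ := e
    have := hB y (Set.Ico_subset_Icc_self hy)
    rw [norm_norm] at this
    exact e'.trans_le this
  obtain ⟨B0, h0⟩ := h 0 (by norm_num)
  obtain ⟨B1, h1⟩ := h 1 (by norm_num)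
  obtain ⟨B2, h2⟩ := h 2 le_rfl
  have hB0 : 0 ≤ B0 := (norm_nonneg _).trans (h0 0)
  have hB1 : 0 ≤ B1 := (norm_nonneg _).trans (h1 0)
  have hB2 : 0 ≤ B2 := (norm_nonneg _).trans (h2 0)
  refine ⟨B0 + B1 + B2, by positivity, hf, fun j hj θ => ?_⟩
  rw [one_pow, mul_one]
  interval_cases j
  · linarith [h0 θ]
  · linarith [h1 θ]
  · linarith [h2 θ]

namespace DiracData

theorem mul_periodic_real : Function.Periodic (fun θ : ℝ => mul θ) (2 * Real.pi) := fun θ => by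
  have := mul_periodic θ
  simpa using this

theorem contDiff_mul : ContDiff ℝ 2 fun θ : ℝ => mul θ := by
  unfold mul
  exact (contDiff_const.mul Complex.ofRealCLM.contDiff).cexp

theorem contDiff_mul_inv : ContDiff ℝ 2 fun θ : ℝ => (mul θ)⁻¹ :=
  contDiff_mul.inv fun _ => mul_ne_zero _

theorem exists_C2Bound_mul : ∃ B : ℝ, 0 ≤ B ∧ C2Bound (fun θ : ℝ => mul θ) B 1 ∧
    C2Bound (fun θ : ℝ => (mul θ)⁻¹) B 1 := by
  obtain ⟨B, hB, h⟩ := exists_C2Bound_of_periodic Real.two_pi_pos contDiff_mul mul_periodic_real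
  obtain ⟨B', hB', h'⟩ := exists_C2Bound_of_periodic Real.two_pi_pos contDiff_mul_inv
    fun θ => congrArg _ (mul_periodic_real θ)
  exact ⟨B + B', by positivity, h.mono (by linarith) zero_le_one le_rfl (by positivity),
    h'.mono (by linarith) zero_le_one le_rfl (by positivity)⟩

variable (D : DiracData)

theorem lam_periodic_real : Function.Periodic (fun θ : ℝ => D.lam θ) (2 * Real.pi) := fun θ => by
  have := D.lam_periodic θ
  simpa using this

theorem C2Bound_entry {f : ℝ → Mat2} {C κ : ℝ} (hC : 0 ≤ C) (hκ : 0 ≤ κ) (h : C2Bound f C κ)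
    (i j : Fin 2) : C2Bound (fun θ => (f θ).entry i j) C κ :=
  (h.clm (Mat2.entryCLM i j)).mono (mul_le_of_le_one_left hC (Mat2.norm_entryCLM_le i j)) hκ le_rfl hC

open JostData in
theorem exists_C2Bound_h : ∃ B : ℝ, 0 ≤ B ∧ ∀ (n : ℤ) (i : Fin 2),
    C2Bound (fun θ : ℝ => D.hR θ n i) (B * (1 + defect n)) (1 + defect n) ∧
    C2Bound (fun θ : ℝ => D.hL θ n i) (B * (2 + defect (-n))) (2 + defect (-n)) := by
  obtain ⟨B₁, hB₁, h₁⟩ := D.jostR.exists_sol_C2Bound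
  obtain ⟨B₂, hB₂, h₂⟩ := D.jostL.exists_sol_C2Bound
  obtain ⟨B₀, hB₀, hm, hm'⟩ := exists_C2Bound_mul
  have hd (n : ℤ) : 0 ≤ defect n := Nat.cast_nonneg _
  have hd1 (n : ℤ) : defect (n + 1) ≤ defect n := by
    unfold defect; exact_mod_cast Int.toNat_le_toNat (by omega)
  have hd2 (n : ℤ) : defect (n - 1) ≤ defect n + 1 := by
    unfold defect
    have : (-(n - 1)).toNat ≤ (-n).toNat + 1 := by omega
    exact_mod_cast this
  set B := (1 + 4 * B₀) * (B₁ + B₂)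
  have e1 : B₁ ≤ B := by nlinarith [mul_nonneg hB₀ hB₁, mul_nonneg hB₀ hB₂]
  have e2 : B₂ ≤ B := by nlinarith [mul_nonneg hB₀ hB₁, mul_nonneg hB₀ hB₂]
  have e3 : 4 * (B₀ * B₁) ≤ B := by nlinarith [mul_nonneg hB₀ hB₁, mul_nonneg hB₀ hB₂]
  have e4 : 4 * (B₀ * B₂) ≤ B := by nlinarith [mul_nonneg hB₀ hB₁, mul_nonneg hB₀ hB₂]
  have hB : 0 ≤ B := hB₁.trans e1
  refine ⟨B, hB, fun n i => ⟨?_, ?_⟩⟩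
  · have hdn := hd n
    fin_cases i
    · have hs := (h₁ (n + 1)).mono (C' := B₁ * (1 + defect n)) (κ' := 1 + defect n)
        (by gcongr; exact hd1 n) (by linarith [hd (n + 1)]) (by linarith [hd1 n]) (by positivity)
      have := (hm.mono le_rfl zero_le_one (show (1 : ℝ) ≤ 1 + defect n by linarith) hB₀).mul
        (C2Bound_entry (by positivity) (by positivity) hs 0 0) hB₀ (by positivity) (by positivity)
      refine this.mono ?_ (by positivity) le_rfl (by positivity)
      calc _ = 4 * (B₀ * B₁) * (1 + defect n) := by ring
        _ ≤ _ := by gcongr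
    · exact (C2Bound_entry (by positivity) (by positivity) (h₁ n) 1 0).mono (by gcongr)
        (by positivity) le_rfl (by positivity)
  · have hdn := hd (-n)
    fin_cases i
    · have hs := (h₂ (-n - 1)).mono (C' := B₂ * (2 + defect (-n))) (κ' := 2 + defect (-n))
        (mul_le_mul_of_nonneg_left (by linarith [hd2 (-n)]) hB₂) (by linarith [hd (-n - 1)]) (by linarith [hd2 (-n)])
        (by positivity)
      have := (hm'.mono le_rfl zero_le_one (show (1 : ℝ) ≤ 2 + defect (-n) by linarith) hB₀).mul
        (C2Bound_entry (by positivity) (by positivity) hs 0 0) hB₀ (by positivity) (by positivity)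
      refine this.mono ?_ (by positivity) le_rfl (by positivity)
      calc _ = 4 * (B₀ * B₂) * (2 + defect (-n)) := by ring
        _ ≤ _ := by gcongr
    · refine (C2Bound_entry (by positivity) (by positivity) (h₂ (-n)) 1 0).mono ?_
        (by positivity) (by linarith) (by positivity)
      gcongr
      norm_num

theorem contDiff_W : ContDiff ℝ 2 fun θ : ℝ => D.W θ := by
  obtain ⟨B, _, h⟩ := D.exists_C2Bound_h
  have e (θ : ℝ) : D.W θ = (mul θ)⁻¹ * D.hR θ (-1) 0 * D.hL θ 0 1 -
      D.hR θ 0 1 * (mul θ * D.hL θ (-1) 0) := by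
    simp only [W, wronskian, psiR_apply, psiL_apply, zero_sub, neg_neg, zpow_neg_one, neg_zero,
      zpow_zero, zpow_one, one_mul]
  simp only [e]
  exact ((contDiff_mul_inv.mul (h _ _).1.1).mul (h _ _).2.1).sub
    ((h _ _).1.1.mul (contDiff_mul.mul (h _ _).2.1))

theorem exists_C2Bound_W_inv (hres : NonResonant D.m D.Q) :
    ∃ B : ℝ, 0 ≤ B ∧ C2Bound (fun θ : ℝ => (D.W θ)⁻¹) B 1 :=
  exists_C2Bound_of_periodic Real.two_pi_pos (D.contDiff_W.inv fun θ => D.W_ofReal_ne_zero hres θ)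
    fun θ => congrArg _ (D.W_congr (D.lam_periodic_real θ) (mul_periodic_real θ))

/-- The smaller of the two site weights, up to a factor. -/
noncomputable def freq (n k : ℤ) : ℝ := 2 * (1 + min |(n : ℝ)| |(k : ℝ)|)

theorem one_le_freq (n k : ℤ) : 1 ≤ freq n k := by
  have : 0 ≤ min |(n : ℝ)| |(k : ℝ)| := le_min (abs_nonneg _) (abs_nonneg _)
  unfold freq; linarith

theorem defect_mul_le {n k : ℤ} (h : k ≤ n) :
    (1 + JostData.defect n) * (2 + JostData.defect (-k)) ≤ freq n k := by
  have key : (1 + (-n).toNat) * (2 + (- -k).toNat) ≤ 2 * (1 + min n.natAbs k.natAbs) := by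
    rcases le_or_gt 0 n with hn | hn
    · have : (-n).toNat = 0 := by omega
      rw [this]; omega
    · have : (- -k).toNat = 0 := by omega
      rw [this]; omega
  have : ((1 + (-n).toNat : ℕ) * (2 + (- -k).toNat : ℕ) : ℝ) ≤
      ((2 * (1 + min n.natAbs k.natAbs) : ℕ) : ℝ) := by exact_mod_cast key
  rw [freq, JostData.defect, JostData.defect]
  push_cast [Nat.cast_natAbs] at this ⊢
  exact this

theorem exists_C2Bound_amplitude (hres : NonResonant D.m D.Q) : ∃ B : ℝ, 0 ≤ B ∧
    ∀ (n k : ℤ) (i j : Fin 2), k ≤ n → C2Bound (fun θ : ℝ => (D.W θ)⁻¹ * (D.hR θ n i * D.hL θ k j))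
      (B * freq n k) (freq n k) := by
  obtain ⟨B₀, hB₀, h₀⟩ := D.exists_C2Bound_W_inv hres
  obtain ⟨B, hB, h⟩ := D.exists_C2Bound_h
  refine ⟨4 * (B₀ * (4 * (B * B))), by positivity, fun n k i j hkn => ?_⟩
  have hd (n : ℤ) : 0 ≤ JostData.defect n := Nat.cast_nonneg _
  have hle := defect_mul_le hkn
  have h1 := one_le_freq n k
  have hn := hd n
  have hk := hd (-k)
  have hR := (h n i).1.mono (κ' := freq n k) le_rfl (by positivity) (by nlinarith) (by positivity)
  have hL := (h k j).2.mono (κ' := freq n k) le_rfl (by positivity) (by nlinarith) (by positivity)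
  have := (h₀.mono (κ' := freq n k) le_rfl zero_le_one h1 hB₀).mul
    (hR.mul hL (by positivity) (by positivity) (by positivity)) hB₀ (by positivity) (by positivity)
  refine this.mono ?_ (by positivity) le_rfl (by positivity)
  calc _ = 4 * (B₀ * (4 * (B * B))) * ((1 + JostData.defect n) * (2 + JostData.defect (-k))) := by ring
    _ ≤ _ := by gcongr

/-- The product of the weights of two sites. -/
noncomputable def siteWeight (n k : ℤ) : ℝ := (1 + |(n : ℝ)|) * (1 + |(k : ℝ)|)

theorem exp_int_mul (N : ℤ) (θ : ℝ) : Complex.exp (Complex.I * (((N : ℝ) * θ : ℝ) : ℂ)) = mul θ ^ N := by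
  rw [mul, ← Complex.exp_int_mul]
  congr 1
  push_cast
  ring

/-- Pointwise decay of the kernel of the propagator. -/
theorem exists_oscIntegral_le (hres : NonResonant D.m D.Q) : ∃ C : ℝ, 0 ≤ C ∧
    ∀ (t : ℝ) (n : ℤ) (i : Fin 2) (k : ℤ) (j : Fin 2), 1 ≤ t →
      ‖D.oscIntegral t n i k j 0‖ ≤
        C * (siteWeight n k * √(siteWeight n k) / √t / t) := by
  obtain ⟨C, hC, hosc⟩ := exists_oscillatory_bound D.m_pos D.s_sq
  obtain ⟨B, hB, hamp⟩ := D.exists_C2Bound_amplitude hres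
  have main (t : ℝ) (n k p q : ℤ) (i j : Fin 2) (ht : 1 ≤ t) (hqp : q ≤ p)
      (hpq : (p = n ∧ q = k) ∨ (p = k ∧ q = n)) :
      ‖∫ θ : ℝ in 0..2 * Real.pi, Complex.exp (-Complex.I * t * realBranch D.m D.s θ) *
        (Real.sin θ / realBranch D.m D.s θ : ℝ) *
        ((D.W θ)⁻¹ * (D.psiR θ p i * D.psiL θ q j))‖ ≤
        C * B * 8 * (siteWeight n k * √(siteWeight n k) / √t / t) := by
    set μ := 2 * (1 + max |(p : ℝ)| |(q : ℝ)|) with hμ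
    have hprod : μ * freq p q = 4 * siteWeight n k := by
      have : freq p q * μ = 4 * ((1 + |(p : ℝ)|) * (1 + |(q : ℝ)|)) := by
        have h1 := max_mul_min |(p : ℝ)| |(q : ℝ)|
        have h2 := max_add_min |(p : ℝ)| |(q : ℝ)|
        rw [freq, hμ]
        linear_combination 4 * h1 + 4 * h2
      rw [mul_comm, this, siteWeight]
      rcases hpq with ⟨rfl, rfl⟩ | ⟨rfl, rfl⟩ <;> ring
    have h := hosc t ((p - q : ℤ) : ℝ) μ (freq p q) B
      (fun θ => (D.W θ)⁻¹ * (D.hR θ p i * D.hL θ q j)) ht (one_le_freq p q)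
      (by rw [freq, hμ]; gcongr; exact min_le_max) (by
        push_cast
        have h1 := abs_sub (p : ℝ) q
        have h2 := le_max_left |(p : ℝ)| |(q : ℝ)|
        have h3 := le_max_right |(p : ℝ)| |(q : ℝ)|
        rw [hμ]; linarith [abs_nonneg (p : ℝ)]) hB (hamp p q i j hqp) (by
        have e1 : D.lam ((2 * Real.pi : ℝ) : ℂ) = D.lam ((0 : ℝ) : ℂ) := by
          simpa using D.lam_periodic_real 0
        have e2 : mul ((2 * Real.pi : ℝ) : ℂ) = mul ((0 : ℝ) : ℂ) := by
          simpa using mul_periodic_real 0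
        rw [exp_int_mul, exp_int_mul, D.W_congr e1 e2, D.hR_congr e1 e2, D.hL_congr e1 e2, e2])
    rw [hprod] at h
    have hint (θ : ℝ) : (D.W θ)⁻¹ * (D.psiR θ p i * D.psiL θ q j) =
        Complex.exp (Complex.I * ((((p - q : ℤ) : ℝ) * θ : ℝ) : ℂ)) *
          ((D.W θ)⁻¹ * (D.hR θ p i * D.hL θ q j)) := by
      rw [exp_int_mul, sub_eq_add_neg, zpow_add₀ (mul_ne_zero _), psiR_apply, psiL_apply]
      ring
    simp only [hint]
    refine h.trans_eq ?_
    have h4 : √(4 * siteWeight n k) = 2 * √(siteWeight n k) := by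
      rw [Real.sqrt_mul (by norm_num), show (4 : ℝ) = 2 ^ 2 by norm_num, Real.sqrt_sq (by norm_num)]
    rw [h4]
    ring
  refine ⟨C * B * 8, by positivity, fun t n i k j ht => ?_⟩
  rw [oscIntegral_zero]
  have hi := i.2
  have hj := j.2
  unfold greenEntry
  split_ifs with h
  · exact main t n k n k i j ht (by omega) (Or.inl ⟨rfl, rfl⟩)
  · have := main t n k k n j i ht (by omega) (Or.inr ⟨rfl, rfl⟩)
    simpa only [mul_comm (D.psiR _ k j)] using this

end DiracData

theorem weightedNorm_one_eq_tsum {E : Type*} [NormedAddCommGroup E] (σ : ℝ) (w : ℤ → E) :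
    weightedNorm 1 σ w = ∑' n : ℤ, ENNReal.ofReal ((1 + |(n : ℝ)|) ^ σ) * ‖w n‖ₑ := by
  rw [weightedNorm, eLpNorm_one_eq_lintegral_enorm, lintegral_count]
  refine tsum_congr fun n => ?_
  rw [enorm_mul, Real.enorm_eq_ofReal (by positivity), enorm_norm]

theorem summable_of_weightedNorm_lt_top {q : ℤ → ℝ} (h : weightedNorm 1 3 q < ⊤) :
    Summable fun n : ℤ => (1 + |(n : ℝ)|) ^ 3 * |q n| := by
  rw [weightedNorm, eLpNorm_one_eq_lintegral_enorm, lintegral_count] at h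
  have h' := tsum_enorm_ne_top_iff_summable_norm.1 h.ne
  refine h'.congr fun n => ?_
  have : (0 : ℝ) ≤ 1 + |(n : ℝ)| := by positivity
  rw [norm_mul, norm_norm, Real.norm_of_nonneg (by positivity), Real.norm_eq_abs,
    ← Real.rpow_natCast]
  norm_num

/-- A kernel bound with weights of order `3/2` bounds the values of the operator. -/
theorem enorm_apply_le_weightedNorm_one (A : SpinorL2 →L[ℂ] SpinorL2) {K : ℝ} (hK : 0 ≤ K)
    (hA : ∀ (n : ℤ) (i : Fin 2) (k : ℤ) (j : Fin 2),
      ‖(A (lp.single 2 k (EuclideanSpace.single j 1)) : SpinorL2) n i‖ ≤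
        K * ((1 + |(n : ℝ)|) ^ (3 / 2 : ℝ) * (1 + |(k : ℝ)|) ^ (3 / 2 : ℝ)))
    (w : SpinorL2) (n : ℤ) :
    ‖A w n‖ₑ ≤ ENNReal.ofReal (4 * K * (1 + |(n : ℝ)|) ^ (3 / 2 : ℝ)) *
      weightedNorm 1 (3 / 2) (w : ℤ → Spinor) := by
  have hev : Continuous fun z : SpinorL2 => z n :=
    (continuous_apply n).comp (lp.uniformContinuous_coe (p := 2)).continuous
  have hsum : HasSum (fun k => A (lp.single 2 k (w k)) n) (A w n) :=
    ((lp.hasSum_single (by norm_num) w).mapL A).map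
      ({ toFun := fun z => z n, map_zero' := rfl, map_add' := fun _ _ => rfl } :
        SpinorL2 →+ Spinor) hev
  have hterm (k : ℤ) (v : Spinor) : ‖A (lp.single 2 k v) n‖ ≤
      4 * K * (1 + |(n : ℝ)|) ^ (3 / 2 : ℝ) * ((1 + |(k : ℝ)|) ^ (3 / 2 : ℝ) * ‖v‖) := by
    have hv : v = v 0 • EuclideanSpace.single 0 1 + v 1 • EuclideanSpace.single 1 1 := by
      ext i; fin_cases i <;> simp
    have hs : A (lp.single 2 k v) = v 0 • A (lp.single 2 k (EuclideanSpace.single 0 1)) +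
        v 1 • A (lp.single 2 k (EuclideanSpace.single 1 1)) := by
      conv_lhs => rw [hv]
      rw [lp.single_add, lp.single_smul, lp.single_smul, map_add, map_smul, map_smul]
    have hi (i : Fin 2) : ‖A (lp.single 2 k v) n i‖ ≤
        2 * K * (1 + |(n : ℝ)|) ^ (3 / 2 : ℝ) * ((1 + |(k : ℝ)|) ^ (3 / 2 : ℝ) * ‖v‖) := by
      have e : A (lp.single 2 k v) n i =
          v 0 * A (lp.single 2 k (EuclideanSpace.single 0 1)) n i +
            v 1 * A (lp.single 2 k (EuclideanSpace.single 1 1)) n i := by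
        rw [hs]; rfl
      have h0 := mul_le_mul (PiLp.norm_apply_le v 0) (hA n i k 0) (norm_nonneg _) (norm_nonneg _)
      have h1 := mul_le_mul (PiLp.norm_apply_le v 1) (hA n i k 1) (norm_nonneg _) (norm_nonneg _)
      rw [e]
      refine (norm_add_le _ _).trans ?_
      rw [norm_mul, norm_mul]
      linarith
    have := DiracData.spinor_norm_le (A (lp.single 2 k v) n)
    linarith [hi 0, hi 1]
  rw [← hsum.tsum_eq, weightedNorm_one_eq_tsum, ← ENNReal.tsum_mul_left]
  refine enorm_tsum_le_tsum_enorm.trans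
    (ENNReal.tsum_le_tsum fun k => ?_)
  rw [← ofReal_norm, ← ofReal_norm, ← ENNReal.ofReal_mul (by positivity),
    ← ENNReal.ofReal_mul (by positivity)]
  exact ENNReal.ofReal_le_ofReal (hterm k (w k))

theorem weightedOpNorm_one_top_le (A : SpinorL2 →L[ℂ] SpinorL2) {K : ℝ} (hK : 0 ≤ K)
    (hA : ∀ (n : ℤ) (i : Fin 2) (k : ℤ) (j : Fin 2),
      ‖(A (lp.single 2 k (EuclideanSpace.single j 1)) : SpinorL2) n i‖ ≤
        K * ((1 + |(n : ℝ)|) ^ (3 / 2 : ℝ) * (1 + |(k : ℝ)|) ^ (3 / 2 : ℝ))) :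
    weightedOpNorm 1 (3 / 2) ⊤ (-(3 / 2)) A ≤ ENNReal.ofReal (4 * K) := by
  refine iSup₂_le fun w hw => ?_
  rw [weightedNorm, eLpNorm_exponent_top]
  refine eLpNormEssSup_le_of_ae_enorm_bound (Eventually.of_forall fun n => ?_)
  have ha : (0 : ℝ) < 1 + |(n : ℝ)| := by positivity
  rw [enorm_mul, Real.enorm_eq_ofReal (by positivity), enorm_norm]
  calc _ ≤ ENNReal.ofReal ((1 + |(n : ℝ)|) ^ (-(3 / 2) : ℝ)) *
        (ENNReal.ofReal (4 * K * (1 + |(n : ℝ)|) ^ (3 / 2 : ℝ)) * 1) := by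
        gcongr
        exact (enorm_apply_le_weightedNorm_one A hK hA w n).trans (by gcongr)
    _ = ENNReal.ofReal (4 * K) := by
        rw [mul_one, ← ENNReal.ofReal_mul (by positivity), mul_left_comm, ← Real.rpow_add ha]
        norm_num

theorem eLpNorm_rpow_weight_lt_top {τ : ℝ} (hτ : τ < -(1 / 2)) :
    eLpNorm (fun n : ℤ => (1 + |(n : ℝ)|) ^ τ) 2 Measure.count < ⊤ := by
  have hs : Summable fun n : ℤ => (1 + |(n : ℝ)|) ^ (2 * τ) := by
    have h := Real.summable_abs_int_rpow (b := -(2 * τ)) (by linarith)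
    refine .of_norm_bounded_eventually h ?_
    rw [Filter.eventually_cofinite]
    refine (Set.finite_singleton (0 : ℤ)).subset fun n hn => ?_
    by_contra h0
    refine hn ?_
    rw [Real.norm_of_nonneg (by positivity), neg_neg]
    refine Real.rpow_le_rpow_of_nonpos (abs_pos.2 (Int.cast_ne_zero.2 h0)) ?_ (by linarith)
    linarith
  rw [eLpNorm_lt_top_iff_lintegral_rpow_enorm_lt_top (by norm_num) (by norm_num), lintegral_count]
  refine lt_of_eq_of_lt (tsum_congr fun n => ?_) hs.tsum_ofReal_lt_top
  have ha : (0 : ℝ) ≤ 1 + |(n : ℝ)| := by positivity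
  rw [Real.enorm_eq_ofReal (by positivity), ENNReal.ofReal_rpow_of_nonneg (by positivity)
    (by positivity), ← Real.rpow_mul ha, mul_comm]
  norm_num

theorem weightedNorm_one_le_mul {E : Type*} [NormedAddCommGroup E] (ρ σ : ℝ) (w : ℤ → E) :
    weightedNorm 1 ρ w ≤
      eLpNorm (fun n : ℤ => (1 + |(n : ℝ)|) ^ (ρ - σ)) 2 Measure.count * weightedNorm 2 σ w := by
  have h := eLpNorm_smul_le_mul_eLpNorm (p := 2) (q := 2) (r := 1) (μ := Measure.count)
    (f := fun n : ℤ => (1 + |(n : ℝ)|) ^ σ * ‖w n‖)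
    (φ := fun n : ℤ => (1 + |(n : ℝ)|) ^ (ρ - σ))
    (measurable_of_countable _).aestronglyMeasurable
    (measurable_of_countable _).aestronglyMeasurable
  refine le_of_eq_of_le ?_ h
  rw [weightedNorm]
  congr 1
  funext n
  have ha : (0 : ℝ) < 1 + |(n : ℝ)| := by positivity
  simp only [Pi.smul_apply', smul_eq_mul]
  rw [← mul_assoc, ← Real.rpow_add ha, sub_add_cancel]

theorem weightedOpNorm_two_two_le (A : SpinorL2 →L[ℂ] SpinorL2) {K : ℝ} (hK : 0 ≤ K)
    (hA : ∀ (n : ℤ) (i : Fin 2) (k : ℤ) (j : Fin 2),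
      ‖(A (lp.single 2 k (EuclideanSpace.single j 1)) : SpinorL2) n i‖ ≤
        K * ((1 + |(n : ℝ)|) ^ (3 / 2 : ℝ) * (1 + |(k : ℝ)|) ^ (3 / 2 : ℝ)))
    {σ : ℝ} (hσ : 2 < σ) :
    weightedOpNorm 2 σ 2 (-σ) A ≤ ENNReal.ofReal (4 * K *
      (eLpNorm (fun n : ℤ => (1 + |(n : ℝ)|) ^ (3 / 2 - σ)) 2 Measure.count).toReal ^ 2) := by
  set S := eLpNorm (fun n : ℤ => (1 + |(n : ℝ)|) ^ (3 / 2 - σ)) 2 Measure.count with hSdef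
  have hS : S ≠ ⊤ := (eLpNorm_rpow_weight_lt_top (by linarith)).ne
  refine iSup₂_le fun w hw => ?_
  have hN : weightedNorm 1 (3 / 2) (w : ℤ → Spinor) ≤ S :=
    (weightedNorm_one_le_mul (3 / 2) σ _).trans (mul_le_of_le_one_right' hw)
  have hpt (n : ℤ) : ‖(1 + |(n : ℝ)|) ^ (-σ) * ‖A w n‖‖ₑ ≤
      ‖((4 * K * S.toReal) • fun n : ℤ => (1 + |(n : ℝ)|) ^ (3 / 2 - σ)) n‖ₑ := by
    have ha : (0 : ℝ) < 1 + |(n : ℝ)| := by positivity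
    rw [Pi.smul_apply, smul_eq_mul, enorm_mul, enorm_norm, Real.enorm_eq_ofReal (by positivity),
      Real.enorm_eq_ofReal (by positivity)]
    calc _ ≤ ENNReal.ofReal ((1 + |(n : ℝ)|) ^ (-σ)) *
          (ENNReal.ofReal (4 * K * (1 + |(n : ℝ)|) ^ (3 / 2 : ℝ)) * ENNReal.ofReal S.toReal) := by
          rw [ENNReal.ofReal_toReal hS]
          gcongr
          exact (enorm_apply_le_weightedNorm_one A hK hA w n).trans (by gcongr)
      _ = _ := by
          rw [← ENNReal.ofReal_mul (by positivity), ← ENNReal.ofReal_mul (by positivity),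
            sub_eq_add_neg, Real.rpow_add ha]
          ring_nf
  refine (eLpNorm_mono_enorm hpt).trans_eq ?_
  rw [eLpNorm_const_smul, ← hSdef, Real.enorm_eq_ofReal (by positivity), pow_two, ← mul_assoc,
    ENNReal.ofReal_mul (p := 4 * K * S.toReal) (by positivity), ENNReal.ofReal_toReal hS]

namespace DiracData

/-- Dispersive decay of the entries of the propagator on the continuous subspace. -/
theorem exists_norm_propagator_le (D : DiracData) (hQ : ∃ C : ℝ, ∀ n i j, |D.Q n i j| ≤ C)
    (hres : NonResonant D.m D.Q) : ∃ C : ℝ, 0 ≤ C ∧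
    ∀ t : ℝ, 1 ≤ t → ∀ (n : ℤ) (i : Fin 2) (k : ℤ) (j : Fin 2),
      ‖((propagator (diracOp D.m D.Q hQ) t * contProj (diracOp D.m D.Q hQ))
        (lp.single 2 k (EuclideanSpace.single j 1)) : SpinorL2) n i‖ ≤
      C * t ^ (-(3 / 2) : ℝ) * ((1 + |(n : ℝ)|) ^ (3 / 2 : ℝ) * (1 + |(k : ℝ)|) ^ (3 / 2 : ℝ)) := by
  obtain ⟨C₁, hC₁, h₁⟩ := (D.withSign 1 (by norm_num)).exists_oscIntegral_le hres
  obtain ⟨C₂, hC₂, h₂⟩ := (D.withSign (-1) (by norm_num)).exists_oscIntegral_le hres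
  refine ⟨C₁ + C₂, by positivity, fun t ht n i k j => ?_⟩
  have ht0 : 0 < t := by linarith
  have hr (x : ℝ) (hx : 0 < x) : x ^ (3 / 2 : ℝ) = x * √x := by
    rw [show (3 / 2 : ℝ) = 1 + 1 / 2 by norm_num, Real.rpow_add hx, Real.rpow_one,
      Real.sqrt_eq_rpow]
  have hX : (siteWeight n k * √(siteWeight n k) / √t / t) = t ^ (-(3 / 2) : ℝ) *
      ((1 + |(n : ℝ)|) ^ (3 / 2 : ℝ) * (1 + |(k : ℝ)|) ^ (3 / 2 : ℝ)) := by
    rw [← Real.mul_rpow (by positivity) (by positivity), Real.rpow_neg ht0.le, hr t ht0,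
      hr _ (by positivity), siteWeight, div_div, mul_comm √t, div_eq_inv_mul]
  have hc : ‖-(Complex.I / (2 * Real.pi))‖ ≤ 1 := by
    rw [norm_neg, norm_div, Complex.norm_I, norm_mul, Complex.norm_real, Complex.norm_ofNat,
      Real.norm_of_nonneg Real.pi_pos.le]
    exact div_le_one_of_le₀ (by linarith [Real.pi_gt_three]) (by positivity)
  rw [D.propagator_kernel hQ hres, norm_mul]
  refine (mul_le_of_le_one_left (norm_nonneg _) hc).trans ((norm_add_le _ _).trans ?_)
  rw [mul_assoc, ← hX, add_mul]
  exact add_le_add (h₁ t n i k j ht) (h₂ t n i k j ht)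

end DiracData

theorem theorem6p3 (m : ℝ) (hm : 0 < m) (Q : ℤ → Matrix (Fin 2) (Fin 2) ℝ)
    (hsymm : ∀ n, Q n 0 1 = Q n 1 0) (hne : ∀ n, Q n 1 0 ≠ -1)
    (hQ : ∀ i j, weightedNorm 1 3 (fun n => Q n i j) < ⊤)
    (hres : NonResonant m Q) :
    (∃ C : ℝ, ∀ᶠ t : ℝ in atTop,
      weightedOpNorm 1 (3 / 2) ⊤ (-(3 / 2))
        (propagator (diracOp m Q (bounded_of_weighted hQ)) t *
          contProj (diracOp m Q (bounded_of_weighted hQ)))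
        ≤ ENNReal.ofReal (C * t ^ (-(4 / 3) : ℝ))) ∧
    (∀ σ : ℝ, 2 < σ → ∃ C : ℝ, ∀ᶠ t : ℝ in atTop,
      weightedOpNorm 2 σ 2 (-σ)
        (propagator (diracOp m Q (bounded_of_weighted hQ)) t *
          contProj (diracOp m Q (bounded_of_weighted hQ)))
        ≤ ENNReal.ofReal (C * t ^ (-(3 / 2) : ℝ))) := by
  obtain ⟨η, hη0, hη1, hη⟩ := exists_strip_width hm
  obtain ⟨C, hC, h⟩ := DiracData.exists_norm_propagator_le
    ⟨m, 1, η, Q, hm, by norm_num, hη0, hη1, hη, hsymm, hne,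
      fun i j => summable_of_weightedNorm_lt_top (hQ i j)⟩ (bounded_of_weighted hQ) hres
  refine ⟨⟨4 * C, ?_⟩, fun σ hσ => ⟨4 * C *
    (eLpNorm (fun n : ℤ => (1 + |(n : ℝ)|) ^ (3 / 2 - σ)) 2 Measure.count).toReal ^ 2, ?_⟩⟩
  · filter_upwards [eventually_ge_atTop 1] with t ht
    refine (weightedOpNorm_one_top_le _ (by positivity) (h t ht)).trans
      (ENNReal.ofReal_le_ofReal ?_)
    rw [← mul_assoc]
    gcongr 4 * C * ?_
    exact Real.rpow_le_rpow_of_exponent_le ht (by norm_num)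
  · filter_upwards [eventually_ge_atTop 1] with t ht
    refine (weightedOpNorm_two_two_le _ (by positivity) (h t ht) hσ).trans_eq ?_
    congr 1
    ring
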